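/- **Conventions.** For smooth maps of Riemannian manifolds, $\tau(f)=\operatorname{Tr}_g\nabla(df)$ is the tension field of $f$; $f$ is harmonic if $\tau(f)=0$, and a harmonic immersion if moreover $df$ is injective at every point. A Kaluza–Klein principal $G$-bundle $\pi:(P,\hat g)\to(M,\bar g)$ is a smooth principal $G$-bundle (right action) with a $G$-invariant Riemannian metric $\hat g$ on $P$ and the metric $\bar g$ on $M$ for which $d\pi$ is isometric on horizontal vectors, where vertical means in $\ker d\pi$ and horizontal means $\hat g$-orthogonal to $\ker d\pi$. Write $D=D^V+D^H$ for the corresponding decomposition of a tangent vector. Let $\hat\omega$ be the $\mathfrak g$-valued connection form such that $D^V$ is the value of the fundamental field of $\hat\omega(D)$, let $\hat\Omega(D_1,D_2)=d\hat\omega(D_1,D_2)+[\hat\omega(D_1),\hat\omega(D_2)]$ be its curvature, and let $\Omega(D_1,D_2)$ be the vertical vector given by the fundamental field of $\hat\Omega(D_1,D_2)$. For vertical $V$ the endomorphism $\langle V,\mathcal F\rangle$ is defined by $\hat g(\langle V,\mathcal F\rangle(D_1),D_2)=\hat g(V,\Omega(D_1,D_2))$, and the curvature modified metric is $$\hat g_{\mathcal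 F}(D_1,D_2)=\tfrac12\bigl(\langle D_1^V,\mathcal F\rangle(D_2^H)+\langle D_2^V,\mathcal F\rangle(D_1^H)\bigr).$$ A smooth map $\Phi:(N,g)\to M$ is a generalized magnetic map with background $\pi$ if $\Phi=\pi\circ\tilde\Phi$ for a harmonic map $\tilde\Phi:(N,g)\to(P,\hat g)$. The projection $\pi\circ\tilde\Phi$ of a map $\tilde\Phi$ is uncharged if the Lorentz strength $d\pi\bigl(\operatorname{Tr}_g\tilde\Phi^*\hat g_{\mathcal F}\bigr)$ of $\tilde\Phi$ vanishes identically. **Objects.** Let $S^3\subset\mathbb H$ be the unit quaternions and $S^7\subset\mathbb H\times\mathbb H$ the unit sphere, with their round metrics; let $U(1)=S^1\subset\mathbb C$ act on $S^3$ by $(q,z)\mapsto qz$, and let $SU(2)=S^3$ act on $S^7$ by $((q_1,q_2),q)\mapsto(q_1q,q_2q)$. The Hopf fibrations are $$\pi:S^3\to S^2\subset\mathbb C\times\mathbb R,\quad z_1+z_2j\mapsto(2z_1z_2,|z_1|^2-|z_2|^2),$$ $$\pi:S^7\to S^4\subset\mathbb H\times\mathbb R,\quad (q_1,q_2)\mapsto(2q_1\bar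 q_2,|q_1|^2-|q_2|^2),$$ the bases having the induced metrics, i.e. those of round spheres of radius $1/2$. The manifolds $T^2=S^1\times S^1$ and $S^3\times S^3$ have the product metrics. For $\alpha\in\mathbb R$ put $$\tilde\Phi_\alpha:T^2\to S^3,\quad \tilde\Phi_\alpha(z_1,z_2)=\cos\alpha\,z_1+\sin\alpha\,z_2 j,\qquad \tilde\Psi_\alpha:S^3\times S^3\to S^7,\quad \tilde\Psi_\alpha(q_1,q_2)=(\cos\alpha\,q_1,\sin\alpha\,q_2),$$ and $\Phi_\alpha=\pi\circ\tilde\Phi_\alpha$, $\Psi_\alpha=\pi\circ\tilde\Psi_\alpha$. The standard Clifford torus and the standard immersion of $S^3\times S^3$ are $\tilde\Phi_{\pi/4}$ and $\tilde\Psi_{\pi/4}$. **Statement.** Let $\alpha\in\mathbb R$. 1. If $\alpha\notin\frac\pi2\mathbb Z$, then $\tilde\Phi_\alpha$ and $\tilde\Psi_\alpha$ are harmonic immersions. The Hopf fibrations, with the actions and metrics above, are Kaluza–Klein principal bundles, and $\Phi_\alpha$ and $\Psi_\alpha$ are generalized magnetic maps with these backgrounds. 2. $\Phi_\alpha$ (as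 the projection of $\tilde\Phi_\alpha$) is uncharged if and only if $\alpha\in\frac\pi4\mathbb Z$, if and only if $\tau(\Phi_\alpha)=0$. In the same way $\Psi_\alpha$ (as the projection of $\tilde\Psi_\alpha$) is uncharged if and only if $\alpha\in\frac\pi4\mathbb Z$, if and only if $\tau(\Psi_\alpha)=0$. 3. If $\alpha\notin\frac\pi2\mathbb Z$, then $\Phi_\alpha$ is uncharged if and only if $\tilde\Phi_\alpha$ is the standard Clifford torus up to translations of the factors, i.e. $\tilde\Phi_\alpha(z,w)=\tilde\Phi_{\pi/4}(az,bw)$ for some $a,b\in S^1$ and all $z,w$; and if and only if $\tilde\Phi_\alpha$ and $\tilde\Phi_{\pi/4}$ have the same image. In the same way $\Psi_\alpha$ is uncharged if and only if $\tilde\Psi_\alpha(p,q)=\tilde\Psi_{\pi/4}(ap,bq)$ for some $a,b\in S^3$ and all $p,q\in S^3$, and if and only if $\tilde\Psi_\alpha$ and $\tilde\Psi_{\pi/4}$ have the same image. -/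

import Mathlib

open Set Function Module Bundle
open scoped Topology Manifold ContDiff Quaternion

noncomputable section

namespace KaluzaKlein

/-! ### Riemannian metrics, traces and tension fields -/

section Riemannian

variable {E : Type*} [NormedAddCommGroup E] [NormedSpace ℝ E]
  {H : Type*} [TopologicalSpace H] {I : ModelWithCorners ℝ E H}
  {M : Type*} [TopologicalSpace M] [ChartedSpace H M] [IsManifold I ∞ M]
  {E' : Type*} [NormedAddCommGroup E'] [NormedSpace ℝ E']
  {H' : Type*} [TopologicalSpace H'] {I' : ModelWithCorners ℝ E' H'}
  {M' : Type*} [TopologicalSpace M'] [ChartedSpace H' M'] [IsManifold I' ∞ M']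

variable (I M) in
/-- Smooth Riemannian metrics on a manifold. -/
abbrev RMetric : Type _ :=
  ContMDiffRiemannianMetric I ∞ E (fun x : M => TangentSpace I x)

/-- A basis of `T_x M` that is orthonormal for the metric. -/
def IsOrthonormalFrame (g : RMetric I M) (x : M)
    (e : Basis (Fin (finrank ℝ E)) ℝ (TangentSpace I x)) : Prop :=
  ∀ i j, g.inner x (e i) (e j) = if i = j then 1 else 0

theorem exists_isOrthonormalFrame [FiniteDimensional ℝ E] (g : RMetric I M) (x : M) :
    ∃ e, IsOrthonormalFrame g x e := by
  let c : InnerProductSpace.Core ℝ (TangentSpace I x) := g.toRiemannianMetric.toCore x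
  let _ : NormedAddCommGroup (TangentSpace I x) := c.toNormedAddCommGroup
  let _ : InnerProductSpace ℝ (TangentSpace I x) := InnerProductSpace.ofCore c.toCore
  have : FiniteDimensional ℝ (TangentSpace I x) := inferInstanceAs (FiniteDimensional ℝ E)
  let b := stdOrthonormalBasis ℝ (TangentSpace I x)
  refine ⟨b.toBasis, fun i j => ?_⟩
  change c.inner (b.toBasis i) (b.toBasis j) = _
  have h : c.inner (b i) (b j) = if i = j then 1 else 0 :=
    orthonormal_iff_ite.1 b.orthonormal i j
  rw [← h]
  exact congrArg₂ c.inner (congrFun b.coe_toBasis i) (congrFun b.coe_toBasis j)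

/-- An orthonormal basis of `T_x M`. -/
def frame [FiniteDimensional ℝ E] (g : RMetric I M) (x : M) :
    Basis (Fin (finrank ℝ E)) ℝ (TangentSpace I x) :=
  (exists_isOrthonormalFrame g x).choose

theorem isOrthonormalFrame_frame [FiniteDimensional ℝ E] (g : RMetric I M) (x : M) :
    IsOrthonormalFrame g x (frame g x) :=
  (exists_isOrthonormalFrame g x).choose_spec

/-- The metric trace `∑ᵣ b(Uᵣ, Uᵣ)`, for an orthonormal basis `Uᵣ` of `T_x M`, of a bilinear
map `b` on `T_x M`. -/
def metricTrace [FiniteDimensional ℝ E] (g : RMetric I M) (x : M) {W : Type*} [AddCommGroup W]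
    (b : TangentSpace I x → TangentSpace I x → W) : W :=
  ∑ r, b (frame g x r) (frame g x r)

/-- The trace of a bilinear map may be computed in any orthonormal basis. -/
theorem metricTrace_eq [FiniteDimensional ℝ E] (g : RMetric I M) (x : M) {W : Type*}
    [AddCommGroup W] [Module ℝ W]
    (b : TangentSpace I x →ₗ[ℝ] TangentSpace I x →ₗ[ℝ] W)
    (e : Basis (Fin (finrank ℝ E)) ℝ (TangentSpace I x)) (he : IsOrthonormalFrame g x e) :
    metricTrace g x (fun u v => b u v) = ∑ r, b (e r) (e r) := by
  have hf := isOrthonormalFrame_frame g x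
  set f := frame g x with hfdef
  have expand (a : Basis (Fin (finrank ℝ E)) ℝ (TangentSpace I x))
      (ha : IsOrthonormalFrame g x a) (v : TangentSpace I x) :
      v = ∑ i, g.inner x v (a i) • a i := by
    have h1 : v = ∑ i, a.repr v i • a i := (a.sum_repr v).symm
    have h2 : ∀ j, g.inner x v (a j) = a.repr v j := by
      intro j
      conv_lhs => rw [h1]
      simp only [map_sum, map_smul, _root_.sum_apply, _root_.smul_apply,
        ha _ j]
      simp
    conv_lhs => rw [h1]
    simp only [h2]
  have hP : ∀ i j, ∑ r, g.inner x (f r) (e i) * g.inner x (f r) (e j)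
      = if i = j then 1 else 0 := by
    intro i j
    rw [← he i j]
    conv_rhs => rw [expand f hf (e i)]
    simp only [map_sum, map_smul, _root_.sum_apply, _root_.smul_apply,
      smul_eq_mul]
    refine Finset.sum_congr rfl fun r _ => ?_
    rw [g.symm x (e i) (f r)]
  have hexp : ∀ r, b (f r) (f r)
      = ∑ i, ∑ j, (g.inner x (f r) (e i) * g.inner x (f r) (e j)) • b (e i) (e j) := by
    intro r
    conv_lhs => rw [expand e he (f r)]
    rw [Finset.sum_comm]
    simp only [map_sum, map_smul, LinearMap.sum_apply, LinearMap.smul_apply, Finset.smul_sum,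
      smul_smul]
    refine Finset.sum_congr rfl fun i _ => Finset.sum_congr rfl fun j _ => ?_
    rw [mul_comm]
  change ∑ r, b (f r) (f r) = _
  simp only [hexp]
  rw [Finset.sum_comm]
  refine Finset.sum_congr rfl fun i _ => ?_
  rw [Finset.sum_comm]
  simp only [← Finset.sum_smul, hP]
  simp

/-- The vector metrically dual to a linear form `ℓ` on `T_x M`, that is, the vector `v` with
`g(v, w) = ℓ(w)` for all `w`. -/
def sharp (g : RMetric I M) (x : M) (l : TangentSpace I x → ℝ) : TangentSpace I x :=
  Classical.epsilon fun v => ∀ w, g.inner x v w = l w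

theorem inner_sharp [FiniteDimensional ℝ E] (g : RMetric I M) (x : M)
    (l : TangentSpace I x →ₗ[ℝ] ℝ) (w : TangentSpace I x) :
    g.inner x (sharp g x l) w = l w := by
  have hf := isOrthonormalFrame_frame g x
  set f := frame g x
  have h : ∃ v, ∀ w, g.inner x v w = l w := by
    refine ⟨∑ i, l (f i) • f i, fun w => ?_⟩
    have h1 : (g.inner x (∑ i, l (f i) • f i) : TangentSpace I x →ₗ[ℝ] ℝ) = l := by
      refine f.ext fun j => ?_
      simp only [map_sum, map_smul, ContinuousLinearMap.coe_coe, _root_.sum_apply,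
        _root_.smul_apply, hf _ j]
      simp
    exact congrArg (fun L : TangentSpace I x →ₗ[ℝ] ℝ => L w) h1
  exact Classical.epsilon_spec h w

/-- The metric in the preferred chart at `x`: the coefficient `g(u, v)` at the point of
coordinates `y`, for constant coordinate vectors `u`, `v`. -/
def metricInChart (g : RMetric I M) (x : M) (y u v : E) : ℝ :=
  g.inner ((extChartAt I x).symm y)
    (mfderiv 𝓘(ℝ, E) I (extChartAt I x).symm y u)
    (mfderiv 𝓘(ℝ, E) I (extChartAt I x).symm y v)

/-- The Christoffel symbol `Γ(u, v)` of the Levi-Civita connection at `x`, in the preferred chart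
at `x`, given by Koszul's formula
`g(Γ(u, v), w) = (∂ᵤ g(v, w) + ∂ᵥ g(u, w) - ∂_w g(u, v)) / 2`. The tangent space `T_x M` is
identified with the model space through this chart. -/
def christoffel (g : RMetric I M) (x : M) (u v : TangentSpace I x) : TangentSpace I x :=
  sharp g x fun w =>
    (fderiv ℝ (fun y : E => metricInChart g x y v w) (extChartAt I x x) u
      + fderiv ℝ (fun y : E => metricInChart g x y u w) (extChartAt I x x) v
      - fderiv ℝ (fun y : E => metricInChart g x y u v) (extChartAt I x x) w) / 2

/-- The second derivative at `x` of a map, written in the preferred charts at `x` and `f x`. -/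
def chartHessian (f : M → M') (x : M) (u v : TangentSpace I x) : TangentSpace I' (f x) :=
  (fderiv ℝ (fderiv ℝ (writtenInExtChartAt I I' x f)) (extChartAt I x x) u v : E')

/-- The second fundamental form `∇(df)` of a map of Riemannian manifolds:
`∂²f - df(Γ) + Γ'(df, df)` in the preferred charts. -/
def secondFundamentalForm (g : RMetric I M) (g' : RMetric I' M') (f : M → M') (x : M)
    (u v : TangentSpace I x) : TangentSpace I' (f x) :=
  chartHessian f x u v - mfderiv I I' f x (christoffel g x u v)
    + christoffel g' (f x) (mfderiv I I' f x u) (mfderiv I I' f x v)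

/-- The tension field of a map of Riemannian manifolds. -/
def tension [FiniteDimensional ℝ E] (g : RMetric I M) (g' : RMetric I' M') (f : M → M') (x : M) :
    TangentSpace I' (f x) :=
  metricTrace g x (secondFundamentalForm g g' f x)

/-- Harmonic maps of Riemannian manifolds. -/
def IsHarmonic [FiniteDimensional ℝ E] (g : RMetric I M) (g' : RMetric I' M') (f : M → M') :
    Prop :=
  ContMDiff I I' ∞ f ∧ ∀ x, tension g g' f x = 0

/-- Harmonic maps whose differential is injective at each point. -/
def IsHarmonicImmersion [FiniteDimensional ℝ E] (g : RMetric I M) (g' : RMetric I' M')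
    (f : M → M') : Prop :=
  IsHarmonic g g' f ∧ ∀ x, Injective (mfderiv I I' f x)

set_option synthInstance.maxHeartbeats 200000 in
/-- The Riemannian metric induced by an immersion `f` into a Euclidean space. -/
def inducedMetric {V : Type*} [NormedAddCommGroup V] [InnerProductSpace ℝ V]
    [FiniteDimensional ℝ E] (f : M → V) (hf : ContMDiff I 𝓘(ℝ, V) ∞ f)
    (hinj : ∀ x, Injective (mvfderiv I f x)) : RMetric I M where
  inner x := (ContinuousLinearMap.precomp ℝ (mvfderiv I f x)).comp
    ((innerSL ℝ : V →L[ℝ] V →L[ℝ] ℝ).comp (mvfderiv I f x))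
  symm x v w := by
    simp [real_inner_comm]
  pos x v hv := by
    have h : mvfderiv I f x v ≠ 0 := fun h => hv (hinj x (by rw [h, map_zero]))
    simpa using pow_pos (norm_pos_iff.2 h) 2
  isVonNBounded x := by
    have h := hinj x
    obtain ⟨K, -, hK⟩ := LinearMap.exists_antilipschitzWith
      (show E →ₗ[ℝ] V from (mvfderiv I f x : TangentSpace I x →ₗ[ℝ] V))
      (LinearMap.ker_eq_bot.2 h)
    refine (NormedSpace.isVonNBounded_iff ℝ (E := E)).2 ?_
    refine (Metric.isBounded_closedBall (x := (0 : E)) (r := K * 1)).subset fun v hv => ?_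
    have hv' : ‖mvfderiv I f x v‖ ^ 2 < 1 := by
      rw [← real_inner_self_eq_norm_sq]
      exact hv
    have h1 : ‖mvfderiv I f x v‖ ≤ 1 := by
      nlinarith [norm_nonneg (mvfderiv I f x v)]
    have h2 := hK.le_mul_dist v 0
    rw [mem_closedBall_zero_iff]
    have h3 : dist (mvfderiv I f x v) (mvfderiv I f x (0 : TangentSpace I x))
        = ‖mvfderiv I f x v‖ := by rw [map_zero, dist_zero_right]
    calc ‖v‖ = dist v 0 := (dist_zero_right v).symm
      _ ≤ K * ‖mvfderiv I f x v‖ := by rw [← h3]; exact h2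
      _ ≤ K * 1 := by gcongr
  contMDiff := by
    intro x₀
    rw [contMDiffAt_hom_bundle]
    refine ⟨contMDiffAt_id, ?_⟩
    have hB := (hf x₀).mfderiv_const (m := ∞) (by simp)
    set B : M → E →L[ℝ] V := inTangentCoordinates I 𝓘(ℝ, V) id f (mfderiv I 𝓘(ℝ, V) f) x₀
      with hBdef
    let β : V →L[ℝ] V →L[ℝ] ℝ := innerSL ℝ
    let P : (E →L[ℝ] V) →L[ℝ] (V →L[ℝ] ℝ) →L[ℝ] (E →L[ℝ] ℝ) :=
      (ContinuousLinearMap.compL ℝ E V ℝ).flip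
    have h1 : ContMDiffAt I 𝓘(ℝ, E →L[ℝ] E →L[ℝ] ℝ) ∞
        (fun x => (P (B x)).comp (β.comp (B x))) x₀ := by
      have h3 : ContMDiffAt I 𝓘(ℝ, E →L[ℝ] V →L[ℝ] ℝ) ∞ (fun x => β.comp (B x)) x₀ :=
        contMDiffAt_const.clm_comp hB
      have h4 : ContMDiffAt I 𝓘(ℝ, (V →L[ℝ] ℝ) →L[ℝ] E →L[ℝ] ℝ) ∞ (fun x => P (B x)) x₀ :=
        contMDiffAt_const.clm_apply hB
      exact h4.clm_comp h3
    refine h1.congr_of_eventuallyEq ?_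
    have h2 : ∀ᶠ x in 𝓝 x₀, x ∈ (chartAt H x₀).source :=
      (chartAt H x₀).open_source.mem_nhds (mem_chart_source H x₀)
    filter_upwards [h2] with x hx
    ext u v
    have h5 : x ∈ (trivializationAt (E →L[ℝ] ℝ)
        (fun b : M => TangentSpace I b →L[ℝ] ℝ) x₀).baseSet := by
      simpa using hx
    have key : ∀ L : TangentSpace I x →L[ℝ] ℝ,
        (trivializationAt (E →L[ℝ] ℝ) (fun b : M => TangentSpace I b →L[ℝ] ℝ) x₀).linearMapAt ℝ x L v
          = L ((trivializationAt E (TangentSpace I) x₀).symmL ℝ x v) := by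
      intro L
      have h6 := hom_trivializationAt_apply (RingHom.id ℝ) (F₁ := E) (E₁ := TangentSpace I (M := M))
        (F₂ := ℝ) (E₂ := Bundle.Trivial M ℝ) x₀ ⟨x, L⟩
      have h7 : (trivializationAt (E →L[ℝ] ℝ)
          (fun b : M => TangentSpace I b →L[ℝ] ℝ) x₀).linearMapAt ℝ x L
          = ContinuousLinearMap.inCoordinates E (TangentSpace I (M := M)) ℝ
            (Bundle.Trivial M ℝ) x₀ x x₀ x L := by
        rw [Trivialization.coe_linearMapAt_of_mem _ h5]
        exact congrArg (fun p : M × (E →L[ℝ] ℝ) => p.2) h6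
      rw [h7]
      simp [ContinuousLinearMap.inCoordinates]
    simp [hBdef, inTangentCoordinates, ContinuousLinearMap.inCoordinates]
    refine (key _).trans ?_
    rfl

end Riemannian

/-! ### Principal bundles with an invariant metric -/

section PrincipalBundle

variable {EP : Type*} [NormedAddCommGroup EP] [NormedSpace ℝ EP]
  {HP : Type*} [TopologicalSpace HP] {IP : ModelWithCorners ℝ EP HP}
  {P : Type*} [TopologicalSpace P] [ChartedSpace HP P] [IsManifold IP ∞ P]
  {EM : Type*} [NormedAddCommGroup EM] [NormedSpace ℝ EM]
  {HM : Type*} [TopologicalSpace HM] {IM : ModelWithCorners ℝ EM HM}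
  {M : Type*} [TopologicalSpace M] [ChartedSpace HM M] [IsManifold IM ∞ M]
  {EG : Type*} [NormedAddCommGroup EG] [NormedSpace ℝ EG]
  {HG : Type*} [TopologicalSpace HG] {IG : ModelWithCorners ℝ EG HG}
  {G : Type*} [TopologicalSpace G] [ChartedSpace HG G] [Group G] [LieGroup IG ∞ G]
  {EN : Type*} [NormedAddCommGroup EN] [NormedSpace ℝ EN]
  {HN : Type*} [TopologicalSpace HN] {IN : ModelWithCorners ℝ EN HN}
  {N : Type*} [TopologicalSpace N] [ChartedSpace HN N] [IsManifold IN ∞ N]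

variable (IP IM IG) in
/-- Smooth principal `G`-bundles `pr : P → M`: the group `G` acts smoothly and freely on the right
of `P`, and every point of `M` has a neighbourhood `U` with a smooth section `s` such that
`(x, g) ↦ s(x) g` is an isomorphism from `U × G` onto `pr⁻¹(U)`, with smooth inverse
`p ↦ (pr(p), τ(p))`. -/
structure IsPrincipalBundle (act : P → G → P) (pr : P → M) : Prop where
  contMDiff_act : ContMDiff (IP.prod IG) IP ∞ fun x : P × G => act x.1 x.2
  contMDiff_proj : ContMDiff IP IM ∞ pr
  act_one : ∀ p, act p 1 = p
  act_mul : ∀ p a b, act p (a * b) = act (act p a) b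
  free : ∀ p a, act p a = p → a = 1
  proj_act : ∀ p a, pr (act p a) = pr p
  exists_trivialization : ∀ x, ∃ U : Set M, IsOpen U ∧ x ∈ U ∧ ∃ (s : M → P) (τ : P → G),
    ContMDiffOn IM IP ∞ s U ∧ ContMDiffOn IP IG ∞ τ (pr ⁻¹' U) ∧
    (∀ y ∈ U, pr (s y) = y) ∧ ∀ p ∈ pr ⁻¹' U, act (s (pr p)) (τ p) = p

variable (IM) in
/-- The `ĝ`-orthogonal projection of a tangent vector onto the vertical space `ker d(pr)`. -/
def vertPart (ĝ : RMetric IP P) (pr : P → M) (p : P) (D : TangentSpace IP p) : TangentSpace IP p :=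
  Classical.epsilon fun v =>
    mfderiv IP IM pr p v = 0 ∧ ∀ w, mfderiv IP IM pr p w = 0 → ĝ.inner p (D - v) w = 0

set_option linter.unusedSectionVars false in
theorem vertPart_spec [FiniteDimensional ℝ EP] (ĝ : RMetric IP P) (pr : P → M) (p : P)
    (D : TangentSpace IP p) :
    mfderiv IP IM pr p (vertPart IM ĝ pr p D) = 0 ∧
      ∀ w, mfderiv IP IM pr p w = 0 → ĝ.inner p (D - vertPart IM ĝ pr p D) w = 0 := by
  have h : ∃ v, mfderiv IP IM pr p v = 0 ∧
      ∀ w, mfderiv IP IM pr p w = 0 → ĝ.inner p (D - v) w = 0 := by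
    let K : Submodule ℝ (TangentSpace IP p) := LinearMap.ker (mfderiv IP IM pr p).toLinearMap
    let c : InnerProductSpace.Core ℝ (TangentSpace IP p) := ĝ.toRiemannianMetric.toCore p
    let _ : NormedAddCommGroup (TangentSpace IP p) := c.toNormedAddCommGroup
    let _ : InnerProductSpace ℝ (TangentSpace IP p) := InnerProductSpace.ofCore c.toCore
    have : FiniteDimensional ℝ (TangentSpace IP p) := inferInstanceAs (FiniteDimensional ℝ EP)
    refine ⟨K.starProjection D, K.starProjection_apply_mem D, fun w hw => ?_⟩
    exact K.starProjection_inner_eq_zero D w hw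
  exact Classical.epsilon_spec h

variable (IM) in
/-- The horizontal part of a tangent vector. -/
def horPart (ĝ : RMetric IP P) (pr : P → M) (p : P) (D : TangentSpace IP p) : TangentSpace IP p :=
  D - vertPart IM ĝ pr p D

variable (IM IG) in
/-- Kaluza-Klein principal bundles `pr : (P, ĝ) → (M, ḡ)`: principal `G`-bundles with a
`G`-invariant metric `ĝ` on `P` that induces the metric `ḡ` on the base. -/
structure IsKaluzaKleinBundle (act : P → G → P) (pr : P → M) (ĝ : RMetric IP P)
    (gM : RMetric IM M) : Prop where
  isPrincipalBundle : IsPrincipalBundle IP IM IG act pr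
  invariant : ∀ a p u v,
    ĝ.inner (act p a) (mfderiv IP IP (fun q => act q a) p u) (mfderiv IP IP (fun q => act q a) p v)
      = ĝ.inner p u v
  induces : ∀ p u v,
    gM.inner (pr p) (mfderiv IP IM pr p u) (mfderiv IP IM pr p v)
      = ĝ.inner p (horPart IM ĝ pr p u) (horPart IM ĝ pr p v)

variable (IP IG) in
/-- The value at `p` of the fundamental vector field `ξ*` of the action. -/
def fundamentalField (act : P → G → P) (p : P) (ξ : GroupLieAlgebra IG G) : TangentSpace IP p :=
  (mfderiv IG IP (act p) 1 ξ : EP)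

variable (IM IG) in
/-- The `𝔤`-valued connection form of the metric `ĝ`: its value at a tangent vector `D` is the
element of the Lie algebra whose fundamental field is the vertical part of `D`. -/
def connectionForm (act : P → G → P) (pr : P → M) (ĝ : RMetric IP P) (p : P)
    (D : TangentSpace IP p) : GroupLieAlgebra IG G :=
  Classical.epsilon fun ξ => fundamentalField IP IG act p ξ = vertPart IM ĝ pr p D

variable (IM IG) in
/-- The connection form in the preferred chart at `p`: its value at the point of coordinates `y`
and at the constant coordinate vector `u`. -/
def connectionFormInChart (act : P → G → P) (pr : P → M) (ĝ : RMetric IP P) (p : P) (y u : EP) :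
    EG :=
  connectionForm IM IG act pr ĝ ((extChartAt IP p).symm y)
    (mfderiv 𝓘(ℝ, EP) IP (extChartAt IP p).symm y u)

variable (IM IG) in
/-- The exterior derivative `dω(u, v)` at `p` of the connection form `ω` of `ĝ`, computed in the
preferred chart at `p`. -/
def connectionFormDeriv (act : P → G → P) (pr : P → M) (ĝ : RMetric IP P) (p : P)
    (u v : TangentSpace IP p) : GroupLieAlgebra IG G :=
  (fderiv ℝ (fun y : EP => connectionFormInChart IM IG act pr ĝ p y v) (extChartAt IP p p) u
    - fderiv ℝ (fun y : EP => connectionFormInChart IM IG act pr ĝ p y u) (extChartAt IP p p) v :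
    EG)

variable (IM IG) in
/-- The `𝔤`-valued curvature `dω(u, v) + [ω(u), ω(v)]` of the connection form `ω` of `ĝ`. -/
def curvatureForm (act : P → G → P) (pr : P → M) (ĝ : RMetric IP P) (p : P)
    (u v : TangentSpace IP p) : GroupLieAlgebra IG G :=
  connectionFormDeriv IM IG act pr ĝ p u v
    + ⁅connectionForm IM IG act pr ĝ p u, connectionForm IM IG act pr ĝ p v⁆

variable (IM IG) in
/-- The curvature as a 2-form with values in the vertical vectors. -/
def curvature (act : P → G → P) (pr : P → M) (ĝ : RMetric IP P) (p : P)
    (u v : TangentSpace IP p) : TangentSpace IP p :=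
  fundamentalField IP IG act p (curvatureForm IM IG act pr ĝ p u v)

variable (IM IG) in
/-- The Lorentz endomorphism contracted with `V`: the endomorphism `⟨V, 𝓕⟩` determined by
`ĝ(⟨V, 𝓕⟩(u), v) = ĝ(V, Ω(u, v))`. -/
def lorentzEndomorphism (act : P → G → P) (pr : P → M) (ĝ : RMetric IP P) (p : P)
    (V u : TangentSpace IP p) : TangentSpace IP p :=
  sharp ĝ p fun v => ĝ.inner p V (curvature IM IG act pr ĝ p u v)

variable (IM IG) in
/-- The curvature modified metric
`ĝ_𝓕(u, v) = (⟨uⱽ, 𝓕⟩(vᴴ) + ⟨vⱽ, 𝓕⟩(uᴴ)) / 2`. -/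
def curvatureModifiedMetric (act : P → G → P) (pr : P → M) (ĝ : RMetric IP P) (p : P)
    (u v : TangentSpace IP p) : TangentSpace IP p :=
  (1 / 2 : ℝ) •
    (lorentzEndomorphism IM IG act pr ĝ p (vertPart IM ĝ pr p u) (horPart IM ĝ pr p v)
      + lorentzEndomorphism IM IG act pr ĝ p (vertPart IM ĝ pr p v) (horPart IM ĝ pr p u))

variable (IM IG) in
/-- The Lorentz strength `d(pr)(Tr_g f^*ĝ_𝓕)` of a map `f : N → P`. -/
def lorentzStrength [FiniteDimensional ℝ EN] (act : P → G → P) (pr : P → M) (ĝ : RMetric IP P)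
    (g : RMetric IN N) (f : N → P) (x : N) : TangentSpace IM (pr (f x)) :=
  mfderiv IP IM pr (f x) <| metricTrace g x fun u v =>
    curvatureModifiedMetric IM IG act pr ĝ (f x) (mfderiv IN IP f x u) (mfderiv IN IP f x v)

variable (IM IG) in
/-- The projection to the base of the map `f : N → P` is uncharged: its Lorentz strength
vanishes. -/
def IsUncharged [FiniteDimensional ℝ EN] (act : P → G → P) (pr : P → M) (ĝ : RMetric IP P)
    (g : RMetric IN N) (f : N → P) : Prop :=
  ∀ x, lorentzStrength IM IG act pr ĝ g f x = 0

variable (IG) in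
/-- Generalized magnetic maps with background the Kaluza-Klein principal bundle
`pr : (P, ĝ) → (M, ḡ)`: the projections of the harmonic maps into `(P, ĝ)`. -/
def IsGeneralizedMagnetic [FiniteDimensional ℝ EN] (act : P → G → P) (pr : P → M)
    (ĝ : RMetric IP P) (gM : RMetric IM M) (g : RMetric IN N) (Φ : N → M) : Prop :=
  IsKaluzaKleinBundle IM IG act pr ĝ gM ∧ ContMDiff IN IM ∞ Φ ∧
    ∃ f : N → P, IsHarmonic g ĝ f ∧ Φ = pr ∘ f

end PrincipalBundle

/-! ### Spheres, the Hopf fibrations and the twisted immersions -/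

section Hopf

instance finrank_complex_fact : Fact (finrank ℝ ℂ = 1 + 1) := ⟨Complex.finrank_real_complex⟩

instance finrank_quaternion_fact : Fact (finrank ℝ ℍ[ℝ] = 3 + 1) :=
  ⟨Quaternion.finrank_eq_four⟩

theorem finrank_withLp_prod (A B : Type*) [NormedAddCommGroup A] [NormedSpace ℝ A]
    [NormedAddCommGroup B] [NormedSpace ℝ B] [FiniteDimensional ℝ A] [FiniteDimensional ℝ B] :
    finrank ℝ (WithLp 2 (A × B)) = finrank ℝ A + finrank ℝ B := by
  rw [(WithLp.linearEquiv 2 ℝ (A × B)).finrank_eq, Module.finrank_prod]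

instance finrank_quaternion_prod_fact : Fact (finrank ℝ (WithLp 2 (ℍ[ℝ] × ℍ[ℝ])) = 7 + 1) :=
  ⟨by rw [finrank_withLp_prod, Quaternion.finrank_eq_four]⟩

instance finrank_complex_real_fact : Fact (finrank ℝ (WithLp 2 (ℂ × ℝ)) = 2 + 1) :=
  ⟨by rw [finrank_withLp_prod, Complex.finrank_real_complex, Module.finrank_self]⟩

instance finrank_quaternion_real_fact : Fact (finrank ℝ (WithLp 2 (ℍ[ℝ] × ℝ)) = 4 + 1) :=
  ⟨by rw [finrank_withLp_prod, Quaternion.finrank_eq_four, Module.finrank_self]⟩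

/-- The unit circle in `ℂ`, which is also the group `U(1)`. -/
abbrev S1 : Type := Metric.sphere (0 : ℂ) 1

/-- The unit sphere `S² ⊂ ℂ × ℝ`. -/
abbrev S2 : Type := Metric.sphere (0 : WithLp 2 (ℂ × ℝ)) 1

/-- The unit sphere `S³ ⊂ ℍ`, which is also the group `SU(2)` of unit quaternions. -/
abbrev S3 : Type := Metric.sphere (0 : ℍ[ℝ]) 1

/-- The unit sphere `S⁴ ⊂ ℍ × ℝ`. -/
abbrev S4 : Type := Metric.sphere (0 : WithLp 2 (ℍ[ℝ] × ℝ)) 1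

/-- The unit sphere `S⁷ ⊂ ℍ × ℍ`. -/
abbrev S7 : Type := Metric.sphere (0 : WithLp 2 (ℍ[ℝ] × ℍ[ℝ])) 1

instance lieGroup_S1 : LieGroup (𝓡 1) ∞ S1 :=
  inferInstanceAs (LieGroup (𝓡 1) ∞ Circle)

instance lieGroup_S3 : LieGroup (𝓡 3) ∞ S3 where
  contMDiff_mul := by
    apply ContMDiff.codRestrict_sphere
    let c : S3 → ℍ[ℝ] := (↑)
    have h₂ : ContMDiff (𝓘(ℝ, ℍ[ℝ]).prod 𝓘(ℝ, ℍ[ℝ])) 𝓘(ℝ, ℍ[ℝ]) ∞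
        fun z : ℍ[ℝ] × ℍ[ℝ] => z.fst * z.snd := by
      rw [contMDiff_iff]
      exact ⟨continuous_mul, fun x y => contDiff_mul.contDiffOn⟩
    suffices h₁ : ContMDiff _ _ _ (Prod.map c c) from
      h₂.comp h₁
    apply ContMDiff.prodMap <;> exact contMDiff_coe_sphere
  contMDiff_inv := by
    apply ContMDiff.codRestrict_sphere
    have h (q : S3) : ((q : ℍ[ℝ])⁻¹) = star (q : ℍ[ℝ]) := by
      have hq : ‖(q : ℍ[ℝ])‖ = 1 := norm_eq_of_mem_sphere q
      rw [Quaternion.inv_def, Quaternion.normSq_eq_norm_mul_self, hq]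
      simp
    simp only [h]
    let L : ℍ[ℝ] →ₗ[ℝ] ℍ[ℝ] :=
      { toFun := star, map_add' := star_add, map_smul' := fun r q => by ext <;> simp }
    exact L.toContinuousLinearMap.contDiff.contMDiff.comp contMDiff_coe_sphere

section Metrics

theorem mvfderiv_clm_comp {E : Type*} [NormedAddCommGroup E] [NormedSpace ℝ E]
    {H : Type*} [TopologicalSpace H] {I : ModelWithCorners ℝ E H}
    {M : Type*} [TopologicalSpace M] [ChartedSpace H M]
    {V W : Type*} [NormedAddCommGroup V] [NormedSpace ℝ V] [NormedAddCommGroup W] [NormedSpace ℝ W]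
    {f : M → V} {x : M} (L : V →L[ℝ] W) (hf : MDifferentiableAt I 𝓘(ℝ, V) f x)
    (v : TangentSpace I x) :
    mvfderiv I (fun y => L (f y)) x v = L (mvfderiv I f x v) := by
  have h := mfderiv_comp x (L.mdifferentiableAt (x := f x)) hf
  have h' := congrArg (fun A => A v) h
  exact h'.trans (by rw [ContinuousLinearMap.mfderiv_eq]; rfl)

variable {V : Type*} [NormedAddCommGroup V] [InnerProductSpace ℝ V]

/-- The round metric of the sphere of radius `r`, as a metric on the unit sphere: it is induced by
the embedding `x ↦ r x` in the Euclidean space. -/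
def sphereMetric (n : ℕ) [Fact (finrank ℝ V = n + 1)] (r : ℝ) (hr : r ≠ 0) :
    RMetric (𝓡 n) (Metric.sphere (0 : V) 1) :=
  inducedMetric (fun x : Metric.sphere (0 : V) 1 => r • (x : V))
    ((contDiff_const_smul r).contMDiff.comp contMDiff_coe_sphere) (by
      intro x v w h
      have hc := (contMDiff_coe_sphere (E := V) (n := n) (m := ∞)).mdifferentiableAt
        (x := x) (by simp)
      have h1 := mvfderiv_clm_comp (r • ContinuousLinearMap.id ℝ V) hc
      have h2 : r • mvfderiv (𝓡 n) (fun x : Metric.sphere (0 : V) 1 => (x : V)) x v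
          = r • mvfderiv (𝓡 n) (fun x : Metric.sphere (0 : V) 1 => (x : V)) x w :=
        (h1 v).symm.trans (h.trans (h1 w))
      exact injective_mvfderiv_subtypeVal_sphere x (smul_right_injective V hr h2))

/-- The product of the round metrics of two unit spheres: it is induced by the embedding in the
product of the Euclidean spaces. -/
def sphereProdMetric {V' : Type*} [NormedAddCommGroup V'] [InnerProductSpace ℝ V']
    (n n' : ℕ) [Fact (finrank ℝ V = n + 1)] [Fact (finrank ℝ V' = n' + 1)] :
    RMetric ((𝓡 n).prod (𝓡 n')) (Metric.sphere (0 : V) 1 × Metric.sphere (0 : V') 1) :=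
  inducedMetric (fun x => WithLp.toLp 2 ((x.1 : V), (x.2 : V')))
    ((WithLp.contDiff_toLp (𝕜 := ℝ)).contMDiff.comp
      ((contMDiff_coe_sphere.comp contMDiff_fst).prodMk_space
        (contMDiff_coe_sphere.comp contMDiff_snd))) (by
      intro x v w h
      have hc := (contMDiff_coe_sphere (E := V) (n := n) (m := ∞)).mdifferentiableAt
        (x := x.1) (by simp)
      have hc' := (contMDiff_coe_sphere (E := V') (n := n') (m := ∞)).mdifferentiableAt
        (x := x.2) (by simp)
      have hf := (((WithLp.contDiff_toLp (𝕜 := ℝ)).contMDiff.comp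
        ((contMDiff_coe_sphere.comp contMDiff_fst).prodMk_space
        (contMDiff_coe_sphere.comp contMDiff_snd)) : ContMDiff ((𝓡 n).prod (𝓡 n'))
        𝓘(ℝ, WithLp 2 (V × V')) ∞ fun x : Metric.sphere (0 : V) 1 × Metric.sphere (0 : V') 1 =>
          WithLp.toLp 2 ((x.1 : V), (x.2 : V')))).mdifferentiableAt (x := x) (by simp)
      have h1 := mvfderiv_clm_comp (WithLp.fstL 2 ℝ V V') hf
      have h2 := mvfderiv_clm_comp (WithLp.sndL 2 ℝ V V') hf
      refine Prod.ext (injective_mvfderiv_subtypeVal_sphere x.1 ?_)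
        (injective_mvfderiv_subtypeVal_sphere x.2 ?_)
      · have h3 := (h1 v).trans ((congrArg _ h).trans (h1 w).symm)
        have h5 := mfderiv_comp x hc (mdifferentiableAt_fst (I := 𝓡 n) (I' := 𝓡 n') (x := x))
        have h4 (u : TangentSpace ((𝓡 n).prod (𝓡 n')) x) := congrArg (fun A => A u) h5
        simp only [mfderiv_fst] at h4
        exact (h4 v).symm.trans (h3.trans (h4 w))
      · have h3 := (h2 v).trans ((congrArg _ h).trans (h2 w).symm)
        have h5 := mfderiv_comp x hc' (mdifferentiableAt_snd (I := 𝓡 n) (I' := 𝓡 n') (x := x))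
        have h4 (u : TangentSpace ((𝓡 n).prod (𝓡 n')) x) := congrArg (fun A => A u) h5
        simp only [mfderiv_snd] at h4
        exact (h4 v).symm.trans (h3.trans (h4 w)))

end Metrics

/-- The product metric of the torus `S¹ × S¹`. -/
def metricT2 : RMetric ((𝓡 1).prod (𝓡 1)) (S1 × S1) := sphereProdMetric 1 1

/-- The product metric of `S³ × S³`. -/
def metricS3S3 : RMetric ((𝓡 3).prod (𝓡 3)) (S3 × S3) := sphereProdMetric 3 3

/-- The round metric of the unit sphere `S³`. -/
def metricS3 : RMetric (𝓡 3) S3 := sphereMetric 3 1 one_ne_zero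

/-- The round metric of the unit sphere `S⁷`. -/
def metricS7 : RMetric (𝓡 7) S7 := sphereMetric 7 1 one_ne_zero

/-- The metric induced on the base `S²` of the Hopf fibration: the round metric of the sphere of
radius `1/2`. -/
def metricS2 : RMetric (𝓡 2) S2 := sphereMetric 2 (1 / 2) (by norm_num)

/-- The metric induced on the base `S⁴` of the Hopf fibration: the round metric of the sphere of
radius `1/2`. -/
def metricS4 : RMetric (𝓡 4) S4 := sphereMetric 4 (1 / 2) (by norm_num)

theorem norm_coeComplex (z : ℂ) : ‖Quaternion.coeComplex z‖ = ‖z‖ := by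
  have h : ‖Quaternion.coeComplex z‖ ^ 2 = ‖z‖ ^ 2 := by
    rw [sq, ← Quaternion.normSq_eq_norm_mul_self, ← Complex.normSq_eq_norm_sq,
      Quaternion.normSq_def', Complex.normSq_apply]
    simp
    ring
  exact (sq_eq_sq₀ (norm_nonneg _) (norm_nonneg _)).1 h

theorem norm_sq_eq_one {V : Type*} [NormedAddCommGroup V] (x : Metric.sphere (0 : V) 1) :
    ‖(x : V)‖ ^ 2 = 1 := by
  rw [norm_eq_of_mem_sphere x, one_pow]

theorem mem_sphere_toLp {V W : Type*} [NormedAddCommGroup V] [NormedAddCommGroup W] {a : V} {b : W}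
    (h : ‖a‖ ^ 2 + ‖b‖ ^ 2 = 1) : WithLp.toLp 2 (a, b) ∈ Metric.sphere (0 : WithLp 2 (V × W)) 1 := by
  rw [mem_sphere_zero_iff_norm, WithLp.prod_norm_eq_of_L2]
  simp [h]

theorem norm_sq_fst_add_norm_sq_snd (p : S7) :
    ‖(p : WithLp 2 (ℍ[ℝ] × ℍ[ℝ])).fst‖ ^ 2 + ‖(p : WithLp 2 (ℍ[ℝ] × ℍ[ℝ])).snd‖ ^ 2 = 1 := by
  rw [← WithLp.prod_norm_sq_eq_of_L2, norm_sq_eq_one]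

theorem norm_sq_add_norm_sq_of_mem_S3 (q : S3) :
    ‖(⟨(q : ℍ[ℝ]).re, (q : ℍ[ℝ]).imI⟩ : ℂ)‖ ^ 2 + ‖(⟨(q : ℍ[ℝ]).imJ, (q : ℍ[ℝ]).imK⟩ : ℂ)‖ ^ 2
      = 1 := by
  have h := norm_sq_eq_one q
  rw [sq, ← Quaternion.normSq_eq_norm_mul_self, Quaternion.normSq_def'] at h
  rw [← Complex.normSq_eq_norm_sq, ← Complex.normSq_eq_norm_sq, Complex.normSq_apply,
    Complex.normSq_apply]
  linear_combination h

theorem hopf_identity {a b : ℝ} (h : a ^ 2 + b ^ 2 = 1) :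
    (2 * a * b) ^ 2 + ‖a ^ 2 - b ^ 2‖ ^ 2 = 1 := by
  rw [Real.norm_eq_abs, sq_abs]
  linear_combination (a ^ 2 + b ^ 2 + 1) * h

/-- The right action of `U(1)` on `S³` by quaternion multiplication. -/
def actS3 (q : S3) (z : S1) : S3 :=
  ⟨(q : ℍ[ℝ]) * Quaternion.coeComplex z, by
    rw [mem_sphere_zero_iff_norm, norm_mul, norm_coeComplex, norm_eq_of_mem_sphere q,
      norm_eq_of_mem_sphere z, one_mul]⟩

/-- The right action of `SU(2)` on `S⁷`: `(q₁, q₂) q = (q₁ q, q₂ q)`. -/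
def actS7 (p : S7) (q : S3) : S7 :=
  ⟨WithLp.toLp 2 ((p : WithLp 2 (ℍ[ℝ] × ℍ[ℝ])).fst * q, (p : WithLp 2 (ℍ[ℝ] × ℍ[ℝ])).snd * q), mem_sphere_toLp (by
    rw [norm_mul, norm_mul, norm_eq_of_mem_sphere q, mul_one, mul_one]
    exact norm_sq_fst_add_norm_sq_snd p)⟩

/-- The complex Hopf fibration `S³ → S²`,
`z₁ + z₂ j ↦ (2 z₁ z₂, |z₁|² - |z₂|²)`. -/
def hopfC (q : S3) : S2 :=
  let z₁ : ℂ := ⟨(q : ℍ[ℝ]).re, (q : ℍ[ℝ]).imI⟩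
  let z₂ : ℂ := ⟨(q : ℍ[ℝ]).imJ, (q : ℍ[ℝ]).imK⟩
  ⟨WithLp.toLp 2 (2 * z₁ * z₂, ‖z₁‖ ^ 2 - ‖z₂‖ ^ 2), mem_sphere_toLp (by
    rw [norm_mul, norm_mul, Complex.norm_two]
    exact hopf_identity (norm_sq_add_norm_sq_of_mem_S3 q))⟩

/-- The quaternionic Hopf fibration `S⁷ → S⁴`,
`(q₁, q₂) ↦ (2 q₁ q̄₂, |q₁|² - |q₂|²)`. -/
def hopfH (p : S7) : S4 :=
  let q₁ := (p : WithLp 2 (ℍ[ℝ] × ℍ[ℝ])).fst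
  let q₂ := (p : WithLp 2 (ℍ[ℝ] × ℍ[ℝ])).snd
  ⟨WithLp.toLp 2 (2 * q₁ * star q₂, ‖q₁‖ ^ 2 - ‖q₂‖ ^ 2), mem_sphere_toLp (by
    have h2 : ‖(2 : ℍ[ℝ])‖ = 2 := Quaternion.norm_coe 2 |>.trans (by simp)
    rw [norm_mul, norm_mul, h2, Quaternion.norm_star]
    exact hopf_identity (norm_sq_fst_add_norm_sq_snd p))⟩

/-- The quaternion `j`. -/
def quaternionJ : ℍ[ℝ] := ⟨0, 0, 1, 0⟩

theorem quaternionJ_re : quaternionJ.re = 0 := rfl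
theorem quaternionJ_imI : quaternionJ.imI = 0 := rfl
theorem quaternionJ_imJ : quaternionJ.imJ = 1 := rfl
theorem quaternionJ_imK : quaternionJ.imK = 0 := rfl

/-- The map `Φ̃_α : S¹ × S¹ → S³`, `(z₁, z₂) ↦ cos α z₁ + sin α z₂ j`. -/
def twistedTorus (α : ℝ) (z : S1 × S1) : S3 :=
  ⟨Real.cos α • Quaternion.coeComplex z.1
    + Real.sin α • (Quaternion.coeComplex z.2 * quaternionJ), by
    have h1 := norm_sq_eq_one z.1
    have h2 := norm_sq_eq_one z.2
    rw [mem_sphere_zero_iff_norm, ← sq_eq_sq₀ (norm_nonneg _) zero_le_one, sq,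
      ← Quaternion.normSq_eq_norm_mul_self, Quaternion.normSq_def']
    rw [← Complex.normSq_eq_norm_sq, Complex.normSq_apply] at h1 h2
    simp [quaternionJ_re, quaternionJ_imI, quaternionJ_imJ, quaternionJ_imK]
    linear_combination Real.cos α ^ 2 * h1 + Real.sin α ^ 2 * h2 + Real.cos_sq_add_sin_sq α⟩

/-- The map `Ψ̃_α : S³ × S³ → S⁷`, `(q₁, q₂) ↦ (cos α q₁, sin α q₂)`. -/
def twistedSphere (α : ℝ) (q : S3 × S3) : S7 :=
  ⟨WithLp.toLp 2 (Real.cos α • (q.1 : ℍ[ℝ]), Real.sin α • (q.2 : ℍ[ℝ])), mem_sphere_toLp (by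
    rw [norm_smul, norm_smul, mul_pow, mul_pow, norm_sq_eq_one, norm_sq_eq_one, Real.norm_eq_abs,
      Real.norm_eq_abs, sq_abs, sq_abs, mul_one, mul_one, Real.cos_sq_add_sin_sq])⟩

end Hopf

end KaluzaKlein

end

open KaluzaKlein

noncomputable section

namespace KaluzaKlein

open scoped InnerProductSpace ComplexConjugate

/-! ### Derivatives of maps into vector spaces, read in charts -/

section Induced

variable {E : Type*} [NormedAddCommGroup E] [NormedSpace ℝ E]
  {H : Type*} [TopologicalSpace H] {I : ModelWithCorners ℝ E H}
  {M : Type*} [TopologicalSpace M] [ChartedSpace H M]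
  {E' : Type*} [NormedAddCommGroup E'] [NormedSpace ℝ E']
  {H' : Type*} [TopologicalSpace H'] {I' : ModelWithCorners ℝ E' H'}
  {M' : Type*} [TopologicalSpace M'] [ChartedSpace H' M']
  {V : Type*} [NormedAddCommGroup V] [NormedSpace ℝ V]
  {V' : Type*} [NormedAddCommGroup V'] [NormedSpace ℝ V']

/-! Every metric in the statement is induced by an embedding in a Euclidean space, so tension fields
and curvatures reduce to second derivatives of ambient maps. Both Hopf fibrations and both families
are moreover given by bilinear and linear ambient maps. Two structures, `IsBilinearHopf` and
`IsTwistedFamily`, record what the argument needs, and `IsTwistedFamily.main` treats the complex and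
quaternionic cases at once. Write c = cos α, s = sin α.

Tension. By the Gauss formula, if a map F into a submanifold extends to an ambient map G, then ∇dF
is the tangential part of D²G(u, u) + DG(N(u, u)), where N is the normal second fundamental form of
the domain. For a product of unit spheres N(u, u) = (-|u₁|² x, -|u₂|² y). Thus, when D²G vanishes on
pairs of equal vectors from one factor, the tension is minus the tangential part of n DG(x, 0) + n'
DG(0, y) (`tension_sphereProdMetric_eq_zero_iff`, where a scaling r of the target is also allowed).
The map (x, y) ↦ c j₁x + s j₂y is linear, so with n = n' this vector is n times the image point,
which is normal: the map is harmonic. Its projection is (c² - s²) e + 2cs m with m = q(j₁x, j₂y) a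
unit vector orthogonal to e. Here the vector is a multiple of cs m, and the tangential part of m has
squared length (c² - s²)². Hence the tension vanishes exactly when cs(c² - s²) = sin(4α)/4 is zero.

Charge. The connection form is θ(p, u), which stands for p̄u (its complex part in the complex case).
Its exterior derivative is θ(u, v) - θ(v, u), and the bracket term disappears when u is horizontal.
The Lorentz strength therefore pairs with a horizontal η as the trace of ⟨θ(p, u), θ(u, η) - θ(η,
u)⟩. On the family this trace is -2n(c² - s²) c⟨j₁x, η⟩. The horizontal vector η = s j₁x - c j₂y
turns it into a nonzero multiple of the same product cs(c² - s²).

Clifford position. If cs ≠ 0, vanishing means c² = s² = 1/2, so c and s agree with √2/2 up to signs,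
which are absorbed by translating by ±1. Conversely the image determines c², since c x is the first
component of a point of the image. -/

theorem two_le_infty : (2 : ℕ∞ω) ≤ ∞ :=
  WithTop.coe_le_coe.2 (le_top : (2 : ℕ∞) ≤ ⊤)

theorem mvfderiv_comp_mfderiv {g : M' → V} {f : M → M'} (x : M)
    (hg : MDifferentiableAt I' 𝓘(ℝ, V) g (f x)) (hf : MDifferentiableAt I I' f x)
    (v : TangentSpace I x) :
    mvfderiv I (fun y => g (f y)) x v = mvfderiv I' g (f x) (mfderiv I I' f x v) :=
  congrArg (fun A => A v) (mfderiv_comp x hg hf)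

theorem mvfderiv_fderiv_comp {G : V → V'} {f : M → V} (x : M)
    (hG : DifferentiableAt ℝ G (f x)) (hf : MDifferentiableAt I 𝓘(ℝ, V) f x)
    (v : TangentSpace I x) :
    mvfderiv I (fun y => G (f y)) x v = fderiv ℝ G (f x) (mvfderiv I f x v) := by
  refine (congrArg (fun A => A v) (mfderiv_comp x hG.mdifferentiableAt hf)).trans ?_
  rw [mfderiv_eq_fderiv]
  rfl

variable [I.Boundaryless] [I'.Boundaryless]

theorem mvfderiv_eq_fderiv_comp_extChartAt_symm {f : M → V} {x : M}
    (hf : MDifferentiableAt I 𝓘(ℝ, V) f x) (v : TangentSpace I x) :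
    mvfderiv I f x v = fderiv ℝ (fun y : E => f ((extChartAt I x).symm y)) (extChartAt I x x) v := by
  rw [hf.mvfderiv, I.range_eq_univ, fderivWithin_univ]
  rfl

theorem contDiffAt_comp_extChartAt_symm [IsManifold I ∞ M] {f : M → V}
    (hf : ContMDiff I 𝓘(ℝ, V) ∞ f) (x : M) {y : E} (hy : y ∈ (extChartAt I x).target) :
    ContDiffAt ℝ ∞ (fun y : E => f ((extChartAt I x).symm y)) y := by
  have h := (hf.comp_contMDiffOn (contMDiffOn_extChartAt_symm (n := ∞) (I := I) x)).contMDiffAt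
    ((isOpen_extChartAt_target x).mem_nhds hy)
  exact h.contDiffAt

theorem mvfderiv_mfderiv_extChartAt_symm [IsManifold I ∞ M] {f : M → V}
    (hf : ContMDiff I 𝓘(ℝ, V) ∞ f) (x : M) {y : E} (hy : y ∈ (extChartAt I x).target) (u : E) :
    mvfderiv I f ((extChartAt I x).symm y) (mfderiv 𝓘(ℝ, E) I (extChartAt I x).symm y u)
      = fderiv ℝ (fun y : E => f ((extChartAt I x).symm y)) y u := by
  have h := (contMDiffOn_extChartAt_symm (n := ∞) (I := I) x).contMDiffAt
    ((isOpen_extChartAt_target x).mem_nhds hy)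
  refine (mvfderiv_comp_mfderiv (g := f) y (hf.mdifferentiableAt (by simp))
    (h.mdifferentiableAt (by simp)) u).symm.trans ?_
  rw [← mfderiv_eq_fderiv]
  rfl

end Induced

/-! ### The Gauss formula for induced metrics -/

section Immersion

variable {E : Type*} [NormedAddCommGroup E] [NormedSpace ℝ E] [FiniteDimensional ℝ E]
  {H : Type*} [TopologicalSpace H] {I : ModelWithCorners ℝ E H} [I.Boundaryless]
  {M : Type*} [TopologicalSpace M] [ChartedSpace H M] [IsManifold I ∞ M]
  {E' : Type*} [NormedAddCommGroup E'] [NormedSpace ℝ E'] [FiniteDimensional ℝ E']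
  {H' : Type*} [TopologicalSpace H'] {I' : ModelWithCorners ℝ E' H'} [I'.Boundaryless]
  {M' : Type*} [TopologicalSpace M'] [ChartedSpace H' M'] [IsManifold I' ∞ M']
  {V : Type*} [NormedAddCommGroup V] [InnerProductSpace ℝ V]
  {V' : Type*} [NormedAddCommGroup V'] [InnerProductSpace ℝ V']
  {f : M → V} (hf : ContMDiff I 𝓘(ℝ, V) ∞ f) (hinj : ∀ x, Injective (mvfderiv I f x))
  {f' : M' → V'} (hf' : ContMDiff I' 𝓘(ℝ, V') ∞ f') (hinj' : ∀ x, Injective (mvfderiv I' f' x))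

omit [I.Boundaryless] in
theorem inducedMetric_inner (x : M) (u v : TangentSpace I x) :
    (inducedMetric f hf hinj).inner x u v = ⟪mvfderiv I f x u, mvfderiv I f x v⟫_ℝ := rfl

/-- The second derivative of a map into a vector space in the preferred chart. -/
def ambientHessian (I : ModelWithCorners ℝ E H) {V : Type*} [NormedAddCommGroup V]
    [NormedSpace ℝ V] (f : M → V) (x : M) : TangentSpace I x →L[ℝ] TangentSpace I x →L[ℝ] V :=
  show E →L[ℝ] E →L[ℝ] V from fderiv ℝ (fderiv ℝ (fun y : E => f ((extChartAt I x).symm y))) (extChartAt I x x)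

theorem metricInChart_inducedMetric (x : M) {y : E} (hy : y ∈ (extChartAt I x).target) (u v : E) :
    metricInChart (inducedMetric f hf hinj) x y u v
      = ⟪fderiv ℝ (fun y : E => f ((extChartAt I x).symm y)) y u,
          fderiv ℝ (fun y : E => f ((extChartAt I x).symm y)) y v⟫_ℝ := by
  rw [metricInChart, inducedMetric_inner, mvfderiv_mfderiv_extChartAt_symm hf x hy,
    mvfderiv_mfderiv_extChartAt_symm hf x hy]

omit [FiniteDimensional ℝ E] in
include hf in
theorem hasFDerivAt_fderiv_comp_extChartAt_symm (x : M) (u : E) :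
    HasFDerivAt (fun y => fderiv ℝ (fun y : E => f ((extChartAt I x).symm y)) y u)
      ((fderiv ℝ (fderiv ℝ (fun y : E => f ((extChartAt I x).symm y))) (extChartAt I x x)).flip u)
      (extChartAt I x x) := by
  have h := (contDiffAt_comp_extChartAt_symm hf x (mem_extChartAt_target x)).fderiv_right
    (m := 1) two_le_infty
  have h' := (h.differentiableAt (by simp)).hasFDerivAt.clm_apply (hasFDerivAt_const u _)
  refine h'.congr_fderiv ?_
  ext v
  simp

theorem fderiv_metricInChart_inducedMetric (x : M) (u v w : TangentSpace I x) :
    fderiv ℝ (fun y => metricInChart (inducedMetric f hf hinj) x y u v) (extChartAt I x x) w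
      = ⟪mvfderiv I f x u, ambientHessian I f x w v⟫_ℝ
        + ⟪ambientHessian I f x w u, mvfderiv I f x v⟫_ℝ := by
  have h : (fun y => metricInChart (inducedMetric f hf hinj) x y u v)
      =ᶠ[𝓝 (extChartAt I x x)] fun y =>
        ⟪fderiv ℝ (fun y : E => f ((extChartAt I x).symm y)) y u,
          fderiv ℝ (fun y : E => f ((extChartAt I x).symm y)) y v⟫_ℝ := by
    filter_upwards [(isOpen_extChartAt_target x).mem_nhds (mem_extChartAt_target (I := I) x)]
      with y hy using metricInChart_inducedMetric hf hinj x hy u v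
  rw [h.fderiv_eq, ((hasFDerivAt_fderiv_comp_extChartAt_symm hf x u).inner ℝ
    (hasFDerivAt_fderiv_comp_extChartAt_symm hf x v)).fderiv]
  have hd := hf.mdifferentiableAt (x := x) (by simp)
  rw [mvfderiv_eq_fderiv_comp_extChartAt_symm hd u, mvfderiv_eq_fderiv_comp_extChartAt_symm hd v]
  simp
  rfl

omit [FiniteDimensional ℝ E] in
include hf in
theorem ambientHessian_symm (x : M) (u v : TangentSpace I x) :
    ambientHessian I f x u v = ambientHessian I f x v u := by
  have h := contDiffAt_comp_extChartAt_symm hf x (mem_extChartAt_target (I := I) x)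
  exact (h.isSymmSndFDerivAt (by simpa using two_le_infty)) u v

/-- Each coefficient derivative in Koszul's formula is a sum of two terms, by the product rule.
Symmetry of the second derivative cancels four of the six and leaves twice ⟨∂²f(u, v), df(w)⟩. So
the Christoffel symbol is the tangential part of the second derivative. -/
theorem inner_mvfderiv_christoffel (x : M) (u v w : TangentSpace I x) :
    ⟪mvfderiv I f x (christoffel (inducedMetric f hf hinj) x u v), mvfderiv I f x w⟫_ℝ
      = ⟪ambientHessian I f x u v, mvfderiv I f x w⟫_ℝ := by
  rw [← inducedMetric_inner hf hinj]
  let l : TangentSpace I x →ₗ[ℝ] ℝ :=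
    (innerSL ℝ (ambientHessian I f x u v)).toLinearMap ∘ₗ (mvfderiv I f x).toLinearMap
  -- `sharp` is characterized only for linear forms, so the Koszul expression is first identified
  -- with the linear form `l`.
  have hl : christoffel (inducedMetric f hf hinj) x u v
      = sharp (inducedMetric f hf hinj) x l := by
    unfold christoffel
    congr 1
    funext w
    refine (congrArg (· / 2) (congrArg₂ (· - ·) (congrArg₂ (· + ·)
      (fderiv_metricInChart_inducedMetric hf hinj x v w u)
      (fderiv_metricInChart_inducedMetric hf hinj x u w v))
      (fderiv_metricInChart_inducedMetric hf hinj x u v w))).trans ?_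
    have h1 : l w = ⟪ambientHessian I f x u v, mvfderiv I f x w⟫_ℝ := rfl
    rw [h1]
    rw [ambientHessian_symm hf x v u, ambientHessian_symm hf x w u, ambientHessian_symm hf x w v]
    rw [real_inner_comm (mvfderiv I f x v) (ambientHessian I f x u w)]
    ring
  rw [hl, inner_sharp]
  rfl

omit [FiniteDimensional ℝ E] [IsManifold I ∞ M] [FiniteDimensional ℝ E'] in
include hf' in
-- The second-order chain rule for `X' ∘ K`, where `K` is F in charts and `X'` is the immersion f'
-- in the chart at F x. It separates the chart Hessian of F from that of the immersion, which is
-- what a comparison with `secondFundamentalForm` needs.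
theorem ambientHessian_comp {F : M → M'} (hF : ContMDiff I I' ∞ F) (x : M)
    (u v : TangentSpace I x) :
    ambientHessian I (fun y => f' (F y)) x u v
      = mvfderiv I' f' (F x) (chartHessian (I := I) (I' := I') F x u v)
        + ambientHessian I' f' (F x) (mfderiv I I' F x u) (mfderiv I I' F x v) := by
  set φ := extChartAt I x
  set φ' := extChartAt I' (F x)
  set X' := fun y : E' => f' (φ'.symm y) with hX'
  set K := writtenInExtChartAt I I' x F with hK
  have hKx : K (φ x) = φ' (F x) := by simp [hK, writtenInExtChartAt, φ, φ']
  have hKc : ContDiffAt ℝ ∞ K (φ x) := by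
    have := ((contMDiffAt_iff).1 (hF x)).2
    rw [I.range_eq_univ, contDiffWithinAt_univ] at this
    exact this
  have hX'c : ContDiffAt ℝ ∞ X' (K (φ x)) := by
    rw [hKx]
    exact contDiffAt_comp_extChartAt_symm hf' (F x) (mem_extChartAt_target (I := I') (F x))
  have hcomp : (fun y : E => f' (F (φ.symm y))) =ᶠ[𝓝 (φ x)] fun y => X' (K y) := by
    have h1 : ∀ᶠ y in 𝓝 (φ x), F (φ.symm y) ∈ φ'.source := by
      have hc : ContinuousAt (fun y => F (φ.symm y)) (φ x) :=
        hF.continuous.continuousAt.comp (continuousAt_extChartAt_symm x)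
      refine hc.eventually ((isOpen_extChartAt_source (I := I') (F x)).mem_nhds ?_)
      simp [φ]
    filter_upwards [h1] with y hy
    simp only [hX', hK, writtenInExtChartAt, comp_apply]
    exact congrArg f' (φ'.left_inv hy).symm
  have hd : fderiv ℝ (fun y : E => f' (F (φ.symm y)))
      =ᶠ[𝓝 (φ x)] fun y => (fderiv ℝ X' (K y)).comp (fderiv ℝ K y) := by
    have hK1 : ∀ᶠ y in 𝓝 (φ x), ContDiffAt ℝ 1 K y :=
      (hKc.of_le (by simp)).eventually (by simp)
    have hX1 : ∀ᶠ y in 𝓝 (φ x), ContDiffAt ℝ 1 X' (K y) :=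
      hKc.continuousAt.eventually ((hX'c.of_le (by simp)).eventually (by simp))
    filter_upwards [hcomp.eventuallyEq_nhds, hK1, hX1] with y h1 h2 h3
    rw [h1.fderiv_eq]
    exact fderiv_comp y (h3.differentiableAt (by simp)) (h2.differentiableAt (by simp))
  have hA : HasFDerivAt (fun y => fderiv ℝ X' (K y))
      ((fderiv ℝ (fderiv ℝ X') (K (φ x))).comp (fderiv ℝ K (φ x))) (φ x) :=
    (((hX'c.fderiv_right (m := 1) two_le_infty).differentiableAt (by simp)).hasFDerivAt).comp _
      (hKc.differentiableAt (by simp)).hasFDerivAt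
  have hB : HasFDerivAt (fderiv ℝ K) (fderiv ℝ (fderiv ℝ K) (φ x)) (φ x) :=
    ((hKc.fderiv_right (m := 1) two_le_infty).differentiableAt (by simp)).hasFDerivAt
  have hmF : mfderiv I I' F x = fderiv ℝ K (φ x) := by
    rw [(hF.mdifferentiableAt (by simp)).mfderiv, I.range_eq_univ, fderivWithin_univ]
  unfold ambientHessian
  rw [hd.fderiv_eq, (hA.clm_comp hB).fderiv,
    mvfderiv_eq_fderiv_comp_extChartAt_symm (hf'.mdifferentiableAt (by simp))]
  simp only [hKx, hmF]
  rfl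

omit [FiniteDimensional ℝ E] in
/-- The Gauss formula for a map into an immersed submanifold. -/
theorem inner_mvfderiv_secondFundamentalForm {F : M → M'} (hF : ContMDiff I I' ∞ F)
    (g : RMetric I M) (x : M) (u v : TangentSpace I x) (w : TangentSpace I' (F x)) :
    ⟪mvfderiv I' f' (F x) (secondFundamentalForm g (inducedMetric f' hf' hinj') F x u v),
        mvfderiv I' f' (F x) w⟫_ℝ
      = ⟪ambientHessian I (fun y => f' (F y)) x u v
          - mvfderiv I (fun y => f' (F y)) x (christoffel g x u v),
        mvfderiv I' f' (F x) w⟫_ℝ := by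
  rw [ambientHessian_comp hf' hF, mvfderiv_comp_mfderiv x (hf'.mdifferentiableAt (by simp))
    (hF.mdifferentiableAt (by simp))]
  unfold secondFundamentalForm
  rw [map_add, map_sub, inner_add_left, inner_sub_left,
    inner_mvfderiv_christoffel hf' hinj', inner_sub_left, inner_add_left]
  ring

/-- The normal component of the second derivative of an immersion. -/
def normalForm (x : M) (u v : TangentSpace I x) : V :=
  ambientHessian I f x u v - mvfderiv I f x (christoffel (inducedMetric f hf hinj) x u v)

theorem inner_normalForm_mvfderiv (x : M) (u v w : TangentSpace I x) :
    ⟪normalForm hf hinj x u v, mvfderiv I f x w⟫_ℝ = 0 := by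
  rw [normalForm, inner_sub_left, inner_mvfderiv_christoffel, sub_self]

omit [FiniteDimensional ℝ E] in
include hf in
-- The same chain rule with the smooth map G on the outside, where no target chart is needed.
theorem ambientHessian_contDiff_comp {G : V → V'} (hG : ContDiff ℝ ∞ G) (x : M)
    (u v : TangentSpace I x) :
    ambientHessian I (fun y => G (f y)) x u v
      = fderiv ℝ (fderiv ℝ G) (f x) (mvfderiv I f x u) (mvfderiv I f x v)
        + fderiv ℝ G (f x) (ambientHessian I f x u v) := by
  set φ := extChartAt I x
  set X := fun y : E => f (φ.symm y) with hX
  have hXx : X (φ x) = f x := by simp [hX, φ]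
  have hXc : ContDiffAt ℝ ∞ X (φ x) :=
    contDiffAt_comp_extChartAt_symm hf x (mem_extChartAt_target (I := I) x)
  have hd : fderiv ℝ (fun y : E => G (f (φ.symm y)))
      =ᶠ[𝓝 (φ x)] fun y => (fderiv ℝ G (X y)).comp (fderiv ℝ X y) := by
    have hX1 : ∀ᶠ y in 𝓝 (φ x), ContDiffAt ℝ 1 X y :=
      (hXc.of_le (by simp)).eventually (by simp)
    filter_upwards [hX1] with y h2
    exact fderiv_comp y (hG.differentiable (by simp) _) (h2.differentiableAt (by simp))
  have hA : HasFDerivAt (fun y => fderiv ℝ G (X y))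
      ((fderiv ℝ (fderiv ℝ G) (X (φ x))).comp (fderiv ℝ X (φ x))) (φ x) :=
    (((hG.fderiv_right (m := 1) two_le_infty).differentiable (by simp) _).hasFDerivAt).comp _
      (hXc.differentiableAt (by simp)).hasFDerivAt
  have hB : HasFDerivAt (fderiv ℝ X) (fderiv ℝ (fderiv ℝ X) (φ x)) (φ x) :=
    ((hXc.fderiv_right (m := 1) two_le_infty).differentiableAt (by simp)).hasFDerivAt
  have hmf (u : TangentSpace I x) : mvfderiv I f x u = fderiv ℝ X (φ x) u :=
    mvfderiv_eq_fderiv_comp_extChartAt_symm (hf.mdifferentiableAt (by simp)) u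
  unfold ambientHessian
  rw [hd.fderiv_eq, (hA.clm_comp hB).fderiv]
  simp only [hXx, hmf]
  rw [add_comm]
  rfl

/-- The Christoffel term of the domain combines with its ambient Hessian into the normal form,
because DG is linear. What remains involves only ambient derivatives of G and the extrinsic geometry
of the domain. -/
theorem inner_mvfderiv_secondFundamentalForm_of_comp_eq {F : M → M'} (hF : ContMDiff I I' ∞ F)
    {G : V → V'} (hG : ContDiff ℝ ∞ G) (hFG : ∀ x, f' (F x) = G (f x))
    (x : M) (u v : TangentSpace I x) (w : TangentSpace I' (F x)) :
    ⟪mvfderiv I' f' (F x) (secondFundamentalForm (inducedMetric f hf hinj)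
        (inducedMetric f' hf' hinj') F x u v), mvfderiv I' f' (F x) w⟫_ℝ
      = ⟪fderiv ℝ (fderiv ℝ G) (f x) (mvfderiv I f x u) (mvfderiv I f x v)
          + fderiv ℝ G (f x) (normalForm hf hinj x u v), mvfderiv I' f' (F x) w⟫_ℝ := by
  rw [inner_mvfderiv_secondFundamentalForm hf' hinj' hF]
  have h : (fun y => f' (F y)) = fun y => G (f y) := funext hFG
  rw [h, ambientHessian_contDiff_comp hf hG, mvfderiv_fderiv_comp x
    (hG.differentiable (by simp) _) (hf.mdifferentiableAt (by simp)), normalForm, map_sub]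
  congr 1
  abel

end Immersion

/-! ### Tangent spaces and round metrics of spheres -/

section Sphere

variable {V : Type*} [NormedAddCommGroup V] [InnerProductSpace ℝ V]
  {n : ℕ} [Fact (finrank ℝ V = n + 1)]

/-- The differential of the inclusion of the unit sphere. -/
abbrev sphereIncl (x : Metric.sphere (0 : V) 1) : TangentSpace (𝓡 n) x →L[ℝ] V :=
  mvfderiv (𝓡 n) (fun y : Metric.sphere (0 : V) 1 => (y : V)) x

theorem mdifferentiableAt_coe_sphere (x : Metric.sphere (0 : V) 1) :
    MDifferentiableAt (𝓡 n) 𝓘(ℝ, V) (fun y : Metric.sphere (0 : V) 1 => (y : V)) x :=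
  contMDiff_coe_sphere.mdifferentiableAt (n := 1) (by simp)

theorem inner_coe_sphereIncl (x : Metric.sphere (0 : V) 1) (u : TangentSpace (𝓡 n) x) :
    ⟪(x : V), sphereIncl x u⟫_ℝ = 0 := by
  have h : sphereIncl x u ∈ (mvfderiv (𝓡 n) ((↑) : Metric.sphere (0 : V) 1 → V) x).range :=
    ⟨u, rfl⟩
  rw [range_mvfderiv_subtypeVal] at h
  exact Submodule.mem_orthogonal_singleton_iff_inner_right.1 h

theorem exists_sphereIncl_eq (x : Metric.sphere (0 : V) 1) {a : V} (ha : ⟪(x : V), a⟫_ℝ = 0) :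
    ∃ u : TangentSpace (𝓡 n) x, sphereIncl x u = a := by
  have h : a ∈ (ℝ ∙ (x : V))ᗮ := Submodule.mem_orthogonal_singleton_iff_inner_right.2 ha
  rw [← range_mvfderiv_subtypeVal (n := n)] at h
  exact h

theorem inner_self_coe_sphere (x : Metric.sphere (0 : V) 1) : ⟪(x : V), (x : V)⟫_ℝ = 1 := by
  rw [real_inner_self_eq_norm_sq, norm_sq_eq_one]

theorem mvfderiv_smul_coe_sphere (r : ℝ) (x : Metric.sphere (0 : V) 1)
    (u : TangentSpace (𝓡 n) x) :
    mvfderiv (𝓡 n) (fun y : Metric.sphere (0 : V) 1 => r • (y : V)) x u = r • sphereIncl x u :=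
  mvfderiv_clm_comp (r • ContinuousLinearMap.id ℝ V) (mdifferentiableAt_coe_sphere x) u

theorem contMDiff_smul_coe_sphere (r : ℝ) :
    ContMDiff (𝓡 n) 𝓘(ℝ, V) ∞ (fun y : Metric.sphere (0 : V) 1 => r • (y : V)) :=
  (contDiff_const_smul r).contMDiff.comp contMDiff_coe_sphere

theorem injective_mvfderiv_smul_coe_sphere {r : ℝ} (hr : r ≠ 0) (x : Metric.sphere (0 : V) 1) :
    Injective (mvfderiv (𝓡 n) (fun y : Metric.sphere (0 : V) 1 => r • (y : V)) x) := by
  intro v w h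
  rw [mvfderiv_smul_coe_sphere, mvfderiv_smul_coe_sphere] at h
  exact injective_mvfderiv_subtypeVal_sphere x (smul_right_injective V hr h)

theorem sphereMetric_eq (r : ℝ) (hr : r ≠ 0) :
    sphereMetric (V := V) n r hr = inducedMetric (fun y : Metric.sphere (0 : V) 1 => r • (y : V))
      (contMDiff_smul_coe_sphere r) (injective_mvfderiv_smul_coe_sphere hr) := rfl

theorem sphereMetric_inner (r : ℝ) (hr : r ≠ 0) (x : Metric.sphere (0 : V) 1)
    (u v : TangentSpace (𝓡 n) x) :
    (sphereMetric (V := V) n r hr).inner x u v = r ^ 2 * ⟪sphereIncl x u, sphereIncl x v⟫_ℝ := by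
  rw [sphereMetric_eq, inducedMetric_inner, mvfderiv_smul_coe_sphere, mvfderiv_smul_coe_sphere,
    real_inner_smul_left, real_inner_smul_right]
  ring

end Sphere

/-! ### Tension of maps from a product of spheres to a sphere -/

section SphereProd

variable {V : Type*} [NormedAddCommGroup V] [InnerProductSpace ℝ V]
  {n : ℕ} [Fact (finrank ℝ V = n + 1)]
  {V' : Type*} [NormedAddCommGroup V'] [InnerProductSpace ℝ V']
  {n' : ℕ} [Fact (finrank ℝ V' = n' + 1)]

/-- The inclusion of the product of two unit spheres in the product of the Euclidean spaces. -/
def prodCoe (x : Metric.sphere (0 : V) 1 × Metric.sphere (0 : V') 1) : WithLp 2 (V × V') :=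
  WithLp.toLp 2 ((x.1 : V), (x.2 : V'))

theorem contMDiff_prodCoe :
    ContMDiff ((𝓡 n).prod (𝓡 n')) 𝓘(ℝ, WithLp 2 (V × V')) ∞ (prodCoe (V := V) (V' := V')) :=
  (WithLp.contDiff_toLp (𝕜 := ℝ)).contMDiff.comp
      ((contMDiff_coe_sphere.comp contMDiff_fst).prodMk_space
        (contMDiff_coe_sphere.comp contMDiff_snd))

variable (x : Metric.sphere (0 : V) 1 × Metric.sphere (0 : V') 1)

theorem fst_mvfderiv_prodCoe (u : TangentSpace ((𝓡 n).prod (𝓡 n')) x) :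
    (mvfderiv ((𝓡 n).prod (𝓡 n')) (prodCoe (V := V) (V' := V')) x u).fst
      = sphereIncl (n := n) x.1 u.1 := by
  have h1 := mvfderiv_clm_comp (WithLp.fstL 2 ℝ V V')
    (contMDiff_prodCoe.mdifferentiableAt (x := x) (by simp)) u
  have h2 := mvfderiv_comp_mfderiv x (mdifferentiableAt_coe_sphere (n := n) x.1)
    (mdifferentiableAt_fst (I := 𝓡 n) (I' := 𝓡 n') (x := x)) u
  rw [mfderiv_fst] at h2
  exact h1.symm.trans h2

theorem snd_mvfderiv_prodCoe (u : TangentSpace ((𝓡 n).prod (𝓡 n')) x) :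
    (mvfderiv ((𝓡 n).prod (𝓡 n')) (prodCoe (V := V) (V' := V')) x u).snd
      = sphereIncl (n := n') x.2 u.2 := by
  have h1 := mvfderiv_clm_comp (WithLp.sndL 2 ℝ V V')
    (contMDiff_prodCoe.mdifferentiableAt (x := x) (by simp)) u
  have h2 := mvfderiv_comp_mfderiv x (mdifferentiableAt_coe_sphere (n := n') x.2)
    (mdifferentiableAt_snd (I := 𝓡 n) (I' := 𝓡 n') (x := x)) u
  rw [mfderiv_snd] at h2
  exact h1.symm.trans h2

theorem inner_coe_fst_mvfderiv_prodCoe (u : TangentSpace ((𝓡 n).prod (𝓡 n')) x) :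
    ⟪(x.1 : V), (mvfderiv ((𝓡 n).prod (𝓡 n')) (prodCoe (V := V) (V' := V')) x u).fst⟫_ℝ = 0 := by
  rw [fst_mvfderiv_prodCoe]
  exact inner_coe_sphereIncl x.1 _

theorem inner_coe_snd_mvfderiv_prodCoe (u : TangentSpace ((𝓡 n).prod (𝓡 n')) x) :
    ⟪(x.2 : V'), (mvfderiv ((𝓡 n).prod (𝓡 n')) (prodCoe (V := V) (V' := V')) x u).snd⟫_ℝ = 0 := by
  rw [snd_mvfderiv_prodCoe]
  exact inner_coe_sphereIncl x.2 _

/-- The tangent vector of a product with given components. -/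
def prodTangent (u : TangentSpace (𝓡 n) x.1) (v : TangentSpace (𝓡 n') x.2) :
    TangentSpace ((𝓡 n).prod (𝓡 n')) x :=
  show EuclideanSpace ℝ (Fin n) × EuclideanSpace ℝ (Fin n') from (u, v)

theorem mvfderiv_prodCoe (u : TangentSpace ((𝓡 n).prod (𝓡 n')) x) :
    mvfderiv ((𝓡 n).prod (𝓡 n')) (prodCoe (V := V) (V' := V')) x u
      = WithLp.toLp 2 (sphereIncl (n := n) x.1 u.1, sphereIncl (n := n') x.2 u.2) := by
  rw [← fst_mvfderiv_prodCoe, ← snd_mvfderiv_prodCoe]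
  rfl

theorem mvfderiv_prodCoe_prodTangent (u : TangentSpace (𝓡 n) x.1) (v : TangentSpace (𝓡 n') x.2) :
    mvfderiv ((𝓡 n).prod (𝓡 n')) (prodCoe (V := V) (V' := V')) x (prodTangent x u v)
      = WithLp.toLp 2 (sphereIncl (n := n) x.1 u, sphereIncl (n := n') x.2 v) :=
  mvfderiv_prodCoe x _

theorem injective_mvfderiv_prodCoe :
    Injective (mvfderiv ((𝓡 n).prod (𝓡 n')) (prodCoe (V := V) (V' := V')) x) := by
  intro u w h
  refine Prod.ext (injective_mvfderiv_subtypeVal_sphere x.1 ?_)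
    (injective_mvfderiv_subtypeVal_sphere x.2 ?_)
  · exact (fst_mvfderiv_prodCoe x u).symm.trans ((congrArg _ h).trans (fst_mvfderiv_prodCoe x w))
  · exact (snd_mvfderiv_prodCoe x u).symm.trans ((congrArg _ h).trans (snd_mvfderiv_prodCoe x w))

theorem sphereProdMetric_eq :
    sphereProdMetric (V := V) (V' := V') n n'
      = inducedMetric (prodCoe (V := V) (V' := V')) (contMDiff_prodCoe (n := n) (n' := n'))
        (fun x => injective_mvfderiv_prodCoe (n := n) (n' := n') x) := rfl

/-- Differentiate the constant function ‖L y‖² = 1 twice. The map L serves as the projection to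
either Euclidean factor. -/
theorem inner_ambientHessian_of_norm_eq_one {W : Type*} [NormedAddCommGroup W]
    [InnerProductSpace ℝ W] (L : WithLp 2 (V × V') →L[ℝ] W)
    (hL : ∀ y : Metric.sphere (0 : V) 1 × Metric.sphere (0 : V') 1, ‖L (prodCoe y)‖ = 1)
    (u v : TangentSpace ((𝓡 n).prod (𝓡 n')) x) :
    ⟪L (prodCoe x), L (ambientHessian ((𝓡 n).prod (𝓡 n')) (prodCoe (V := V) (V' := V')) x u v)⟫_ℝ
      = - ⟪L (mvfderiv ((𝓡 n).prod (𝓡 n')) (prodCoe (V := V) (V' := V')) x u),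
        L (mvfderiv ((𝓡 n).prod (𝓡 n')) (prodCoe (V := V) (V' := V')) x v)⟫_ℝ := by
  have hd : fderiv ℝ (fun z => ⟪L z, L z⟫_ℝ)
      = fun z => (2 : ℝ) • (innerSL ℝ (L z)).comp L := by
    funext z
    refine ((L.hasFDerivAt (x := z)).inner ℝ L.hasFDerivAt).fderiv.trans ?_
    ext w
    simp [fderivInnerCLM_apply, real_inner_comm, two_mul]
  have hd2 (z : WithLp 2 (V × V')) :
      fderiv ℝ (fun z => (2 : ℝ) • (innerSL ℝ (L z)).comp L) z
        = (2 : ℝ) • ((ContinuousLinearMap.precomp ℝ L).comp ((innerSL ℝ).comp L)) :=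
    ((2 : ℝ) • ((ContinuousLinearMap.precomp ℝ L).comp ((innerSL ℝ).comp L))).fderiv
  have hG : ContDiff ℝ ∞ fun z => ⟪L z, L z⟫_ℝ := L.contDiff.inner ℝ L.contDiff
  have h := ambientHessian_contDiff_comp (contMDiff_prodCoe (V := V) (V' := V') (n := n) (n' := n'))
    hG x u v
  have h0 : (fun y : Metric.sphere (0 : V) 1 × Metric.sphere (0 : V') 1 =>
      ⟪L (prodCoe y), L (prodCoe y)⟫_ℝ) = fun _ => 1 := by
    funext y
    rw [real_inner_self_eq_norm_sq, hL, one_pow]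
  rw [h0, hd, hd2] at h
  have h1 : ambientHessian ((𝓡 n).prod (𝓡 n')) (fun _ : Metric.sphere (0 : V) 1 ×
      Metric.sphere (0 : V') 1 => (1 : ℝ)) x u v = 0 := by
    simp [ambientHessian]
    rfl
  rw [h1] at h
  simp at h
  have h2 : (0 : ℝ) = 2 * ⟪L (mvfderiv ((𝓡 n).prod (𝓡 n')) (prodCoe (V := V) (V' := V')) x u),
        L (mvfderiv ((𝓡 n).prod (𝓡 n')) (prodCoe (V := V) (V' := V')) x v)⟫_ℝ
    + 2 * ⟪L (prodCoe x),
      L (ambientHessian ((𝓡 n).prod (𝓡 n')) (prodCoe (V := V) (V' := V')) x u v)⟫_ℝ := h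
  linarith

/-- The radial component comes from differentiating |x₁|² = 1 twice. The rest of the first component
is tangent to the first sphere, and it is orthogonal to all such tangent vectors because the form is
normal; hence it vanishes. -/
theorem fst_normalForm_prodCoe (u v : TangentSpace ((𝓡 n).prod (𝓡 n')) x) :
    (normalForm (contMDiff_prodCoe (V := V) (V' := V')) injective_mvfderiv_prodCoe x u v).fst
      = -⟪sphereIncl (n := n) x.1 u.1, sphereIncl (n := n) x.1 v.1⟫_ℝ • (x.1 : V) := by
  have h1 := inner_ambientHessian_of_norm_eq_one x (WithLp.fstL 2 ℝ V V')
    (fun y => norm_eq_of_mem_sphere y.1) u v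
  set N := normalForm (contMDiff_prodCoe (V := V) (V' := V')) injective_mvfderiv_prodCoe x u v
    with hN
  have h2 : ⟪(x.1 : V), N.fst⟫_ℝ
      = -⟪sphereIncl (n := n) x.1 u.1, sphereIncl (n := n) x.1 v.1⟫_ℝ := by
    rw [hN, normalForm, WithLp.sub_fst, inner_sub_right,
      inner_coe_fst_mvfderiv_prodCoe, sub_zero]
    exact h1.trans (congrArg Neg.neg (congrArg₂ (fun a b => ⟪a, b⟫_ℝ)
      (fst_mvfderiv_prodCoe x u) (fst_mvfderiv_prodCoe x v)))
  -- Testing normality against the tangential remainder itself forces its norm to be zero.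
  obtain ⟨a, ha⟩ := exists_sphereIncl_eq (n := n) x.1 (a := N.fst - ⟪(x.1 : V), N.fst⟫_ℝ • (x.1 : V))
    (by rw [inner_sub_right, real_inner_smul_right, inner_self_coe_sphere]; ring)
  have h3 := inner_normalForm_mvfderiv (contMDiff_prodCoe (V := V) (V' := V'))
    injective_mvfderiv_prodCoe x u v (prodTangent x a 0)
  rw [mvfderiv_prodCoe_prodTangent, WithLp.prod_inner_apply] at h3
  simp only [map_zero, inner_zero_right, add_zero] at h3
  have h4 : ⟪sphereIncl (n := n) x.1 a, sphereIncl (n := n) x.1 a⟫_ℝ = 0 := by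
    nth_rewrite 1 [ha]
    rw [inner_sub_left, real_inner_smul_left, inner_coe_sphereIncl, mul_zero, sub_zero]
    exact h3
  rw [inner_self_eq_zero, ha, sub_eq_zero] at h4
  rw [h4, h2]

theorem snd_normalForm_prodCoe (u v : TangentSpace ((𝓡 n).prod (𝓡 n')) x) :
    (normalForm (contMDiff_prodCoe (V := V) (V' := V')) injective_mvfderiv_prodCoe x u v).snd
      = -⟪sphereIncl (n := n') x.2 u.2, sphereIncl (n := n') x.2 v.2⟫_ℝ • (x.2 : V') := by
  have h1 := inner_ambientHessian_of_norm_eq_one x (WithLp.sndL 2 ℝ V V')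
    (fun y => norm_eq_of_mem_sphere y.2) u v
  set N := normalForm (contMDiff_prodCoe (V := V) (V' := V')) injective_mvfderiv_prodCoe x u v
    with hN
  have h2 : ⟪(x.2 : V'), N.snd⟫_ℝ
      = -⟪sphereIncl (n := n') x.2 u.2, sphereIncl (n := n') x.2 v.2⟫_ℝ := by
    rw [hN, normalForm, WithLp.sub_snd, inner_sub_right,
      inner_coe_snd_mvfderiv_prodCoe, sub_zero]
    exact h1.trans (congrArg Neg.neg (congrArg₂ (fun a b => ⟪a, b⟫_ℝ)
      (snd_mvfderiv_prodCoe x u) (snd_mvfderiv_prodCoe x v)))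
  obtain ⟨a, ha⟩ := exists_sphereIncl_eq (n := n') x.2
    (a := N.snd - ⟪(x.2 : V'), N.snd⟫_ℝ • (x.2 : V'))
    (by rw [inner_sub_right, real_inner_smul_right, inner_self_coe_sphere]; ring)
  have h3 := inner_normalForm_mvfderiv (contMDiff_prodCoe (V := V) (V' := V'))
    injective_mvfderiv_prodCoe x u v (prodTangent x 0 a)
  rw [mvfderiv_prodCoe_prodTangent, WithLp.prod_inner_apply] at h3
  simp only [map_zero, inner_zero_right, zero_add] at h3
  have h4 : ⟪sphereIncl (n := n') x.2 a, sphereIncl (n := n') x.2 a⟫_ℝ = 0 := by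
    nth_rewrite 1 [ha]
    rw [inner_sub_left, real_inner_smul_left, inner_coe_sphereIncl, mul_zero, sub_zero]
    exact h3
  rw [inner_self_eq_zero, ha, sub_eq_zero] at h4
  rw [h4, h2]

/-- Orthonormal frames of the two factors together form one of the product, so only the values of B
on vectors from a single factor enter. -/
theorem metricTrace_sphereProdMetric {z z' : ℝ}
    (B : WithLp 2 (V × V') →L[ℝ] WithLp 2 (V × V') →L[ℝ] ℝ)
    (hz : ∀ a : V, ⟪(x.1 : V), a⟫_ℝ = 0 → B (WithLp.toLp 2 (a, 0)) (WithLp.toLp 2 (a, 0))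
      = ‖a‖ ^ 2 * z)
    (hz' : ∀ a : V', ⟪(x.2 : V'), a⟫_ℝ = 0 → B (WithLp.toLp 2 (0, a)) (WithLp.toLp 2 (0, a))
      = ‖a‖ ^ 2 * z') :
    metricTrace (sphereProdMetric (V := V) (V' := V') n n') x (fun u v =>
      B (mvfderiv ((𝓡 n).prod (𝓡 n')) prodCoe x u) (mvfderiv ((𝓡 n).prod (𝓡 n')) prodCoe x v))
      = n * z + n' * z' := by
  let e₁ := frame (sphereMetric (V := V) n 1 one_ne_zero) x.1
  let e₂ := frame (sphereMetric (V := V') n' 1 one_ne_zero) x.2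
  have he₁ (i j) : ⟪sphereIncl x.1 (e₁ i), sphereIncl x.1 (e₁ j)⟫_ℝ = if i = j then 1 else 0 := by
    have h := isOrthonormalFrame_frame (sphereMetric (V := V) n 1 one_ne_zero) x.1 i j
    rwa [sphereMetric_inner, one_pow, one_mul] at h
  have he₂ (i j) : ⟪sphereIncl x.2 (e₂ i), sphereIncl x.2 (e₂ j)⟫_ℝ = if i = j then 1 else 0 := by
    have h := isOrthonormalFrame_frame (sphereMetric (V := V') n' 1 one_ne_zero) x.2 i j
    rwa [sphereMetric_inner, one_pow, one_mul] at h
  let σ : Fin (finrank ℝ (EuclideanSpace ℝ (Fin n))) ⊕ Fin (finrank ℝ (EuclideanSpace ℝ (Fin n')))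
      ≃ Fin (finrank ℝ (EuclideanSpace ℝ (Fin n) × EuclideanSpace ℝ (Fin n'))) :=
    finSumFinEquiv.trans (finCongr (Module.finrank_prod).symm)
  let e₁' : Basis _ ℝ (EuclideanSpace ℝ (Fin n)) := e₁
  let e₂' : Basis _ ℝ (EuclideanSpace ℝ (Fin n')) := e₂
  let e' : Basis (Fin (finrank ℝ (EuclideanSpace ℝ (Fin n) × EuclideanSpace ℝ (Fin n')))) ℝ
      (EuclideanSpace ℝ (Fin n) × EuclideanSpace ℝ (Fin n')) := (e₁'.prod e₂').reindex σ
  let e : Basis (Fin (finrank ℝ (EuclideanSpace ℝ (Fin n) × EuclideanSpace ℝ (Fin n')))) ℝ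
      (TangentSpace ((𝓡 n).prod (𝓡 n')) x) := e'
  have hl (i) : mvfderiv ((𝓡 n).prod (𝓡 n')) (prodCoe (V := V) (V' := V')) x (e (σ (Sum.inl i)))
      = WithLp.toLp 2 (sphereIncl x.1 (e₁ i), 0) := by
    have h' : e' (σ (Sum.inl i)) = (e₁' i, 0) := by
      refine (Basis.reindex_apply _ _ _).trans ?_
      rw [Equiv.symm_apply_apply]
      exact Prod.ext (Basis.prod_apply_inl_fst _ _ _) (Basis.prod_apply_inl_snd _ _ _)
    have h : e (σ (Sum.inl i)) = prodTangent x (e₁ i) 0 := h'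
    rw [h, mvfderiv_prodCoe_prodTangent, map_zero]
  have hr (i) : mvfderiv ((𝓡 n).prod (𝓡 n')) (prodCoe (V := V) (V' := V')) x (e (σ (Sum.inr i)))
      = WithLp.toLp 2 (0, sphereIncl x.2 (e₂ i)) := by
    have h' : e' (σ (Sum.inr i)) = (0, e₂' i) := by
      refine (Basis.reindex_apply _ _ _).trans ?_
      rw [Equiv.symm_apply_apply]
      exact Prod.ext (Basis.prod_apply_inr_fst _ _ _) (Basis.prod_apply_inr_snd _ _ _)
    have h : e (σ (Sum.inr i)) = prodTangent x 0 (e₂ i) := h'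
    rw [h, mvfderiv_prodCoe_prodTangent, map_zero]
  have he : IsOrthonormalFrame (sphereProdMetric (V := V) (V' := V') n n') x e := by
    intro i j
    obtain ⟨i, rfl⟩ := σ.surjective i
    obtain ⟨j, rfl⟩ := σ.surjective j
    rw [sphereProdMetric_eq, inducedMetric_inner]
    rcases i with i | i <;> rcases j with j | j <;>
      simp only [hl, hr, WithLp.prod_inner_apply, he₁, he₂, inner_zero_left, inner_zero_right,
        add_zero, zero_add, σ.injective.eq_iff, Sum.inl.injEq, Sum.inr.injEq, reduceCtorEq,
        if_false]
  let D : TangentSpace ((𝓡 n).prod (𝓡 n')) x →ₗ[ℝ] WithLp 2 (V × V') :=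
    (mvfderiv ((𝓡 n).prod (𝓡 n')) (prodCoe (V := V) (V' := V')) x).toLinearMap
  let b : TangentSpace ((𝓡 n).prod (𝓡 n')) x →ₗ[ℝ] TangentSpace ((𝓡 n).prod (𝓡 n')) x →ₗ[ℝ] ℝ :=
    LinearMap.mk₂ ℝ (fun u v => B (D u) (D v)) (by intros; simp) (by intros; simp)
      (by intros; simp) (by intros; simp)
  refine (metricTrace_eq _ x b e he).trans ?_
  have hb (u v) : b u v = B (D u) (D v) := rfl
  rw [← σ.sum_comp, Fintype.sum_sum_type]
  have h1 (i) : b (e (σ (Sum.inl i))) (e (σ (Sum.inl i))) = z := by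
    rw [hb]
    change B (mvfderiv ((𝓡 n).prod (𝓡 n')) prodCoe x _)
      (mvfderiv ((𝓡 n).prod (𝓡 n')) prodCoe x _) = z
    rw [hl, hz _ (inner_coe_sphereIncl x.1 _), ← real_inner_self_eq_norm_sq, he₁]
    simp
  have h2 (i) : b (e (σ (Sum.inr i))) (e (σ (Sum.inr i))) = z' := by
    rw [hb]
    change B (mvfderiv ((𝓡 n).prod (𝓡 n')) prodCoe x _)
      (mvfderiv ((𝓡 n).prod (𝓡 n')) prodCoe x _) = z'
    rw [hr, hz' _ (inner_coe_sphereIncl x.2 _), ← real_inner_self_eq_norm_sq, he₂]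
    simp
  simp only [h1, h2]
  simp

variable {W : Type*} [NormedAddCommGroup W] [InnerProductSpace ℝ W] {m : ℕ}
  [Fact (finrank ℝ W = m + 1)]

/-- Without pure second derivatives of G, the trace sees only the normal form of the domain, which
contributes minus x n times and minus y n' times. The tension is tangent to the target, so it is
detected by its products with vectors orthogonal to F x. -/
theorem tension_sphereProdMetric_eq_zero_iff {r : ℝ} (hr : r ≠ 0)
    {F : Metric.sphere (0 : V) 1 × Metric.sphere (0 : V') 1 → Metric.sphere (0 : W) 1}
    (hF : ContMDiff ((𝓡 n).prod (𝓡 n')) (𝓡 m) ∞ F) {G : WithLp 2 (V × V') → W}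
    (hG : ContDiff ℝ ∞ G) (hFG : ∀ y, r • (F y : W) = G (prodCoe y))
    (h₁ : ∀ a, fderiv ℝ (fderiv ℝ G) (prodCoe x) (WithLp.toLp 2 (a, 0)) (WithLp.toLp 2 (a, 0)) = 0)
    (h₂ : ∀ a, fderiv ℝ (fderiv ℝ G) (prodCoe x) (WithLp.toLp 2 (0, a)) (WithLp.toLp 2 (0, a))
      = 0) :
    tension (sphereProdMetric (V := V) (V' := V') n n') (sphereMetric (V := W) m r hr) F x = 0 ↔
      ∀ a, ⟪(F x : W), a⟫_ℝ = 0 →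
        ⟪(n : ℝ) • fderiv ℝ G (prodCoe x) (WithLp.toLp 2 ((x.1 : V), 0))
          + (n' : ℝ) • fderiv ℝ G (prodCoe x) (WithLp.toLp 2 (0, (x.2 : V'))), a⟫_ℝ = 0 := by
  set ι' := fun y : Metric.sphere (0 : W) 1 => r • (y : W)
  set dG := fderiv ℝ G (prodCoe x)
  set ddG := fderiv ℝ (fderiv ℝ G) (prodCoe x)
  have key (w : TangentSpace (𝓡 m) (F x)) :
      ⟪mvfderiv (𝓡 m) ι' (F x) (tension (sphereProdMetric (V := V) (V' := V') n n')
        (sphereMetric (V := W) m r hr) F x), mvfderiv (𝓡 m) ι' (F x) w⟫_ℝ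
      = - ⟪(n : ℝ) • dG (WithLp.toLp 2 ((x.1 : V), 0))
          + (n' : ℝ) • dG (WithLp.toLp 2 (0, (x.2 : V'))), mvfderiv (𝓡 m) ι' (F x) w⟫_ℝ := by
    set ν := mvfderiv (𝓡 m) ι' (F x) w
    let i₁ : WithLp 2 (V × V') →L[ℝ] WithLp 2 (V × V') →L[ℝ] ℝ :=
      (ContinuousLinearMap.precomp ℝ (WithLp.fstL 2 ℝ V V')).comp
        ((innerSL ℝ : V →L[ℝ] V →L[ℝ] ℝ).comp (WithLp.fstL 2 ℝ V V'))
    let i₂ : WithLp 2 (V × V') →L[ℝ] WithLp 2 (V × V') →L[ℝ] ℝ :=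
      (ContinuousLinearMap.precomp ℝ (WithLp.sndL 2 ℝ V V')).comp
        ((innerSL ℝ : V' →L[ℝ] V' →L[ℝ] ℝ).comp (WithLp.sndL 2 ℝ V V'))
    -- The ν-component of D²G(ξ, η) + DG(N(ξ, η)), with the normal form of the product of spheres
    -- written out and extended to all ambient vectors.
    let B : WithLp 2 (V × V') →L[ℝ] WithLp 2 (V × V') →L[ℝ] ℝ :=
      (ContinuousLinearMap.postcomp (WithLp 2 (V × V')) (innerSL ℝ ν)).comp ddG
        - ⟪ν, dG (WithLp.toLp 2 ((x.1 : V), 0))⟫_ℝ • i₁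
        - ⟪ν, dG (WithLp.toLp 2 (0, (x.2 : V')))⟫_ℝ • i₂
    have hB (ξ η : WithLp 2 (V × V')) : B ξ η = ⟪ν, ddG ξ η⟫_ℝ
        - ⟪ν, dG (WithLp.toLp 2 ((x.1 : V), 0))⟫_ℝ * ⟪ξ.fst, η.fst⟫_ℝ
        - ⟪ν, dG (WithLp.toLp 2 (0, (x.2 : V')))⟫_ℝ * ⟪ξ.snd, η.snd⟫_ℝ := rfl
    have ht := metricTrace_sphereProdMetric (n := n) (n' := n') x
      (z := -⟪ν, dG (WithLp.toLp 2 ((x.1 : V), 0))⟫_ℝ)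
      (z' := -⟪ν, dG (WithLp.toLp 2 (0, (x.2 : V')))⟫_ℝ) B
      (fun a _ => by
        rw [hB, h₁]
        simp
        ring)
      (fun a _ => by
        rw [hB, h₂]
        simp
        ring)
    have hsum : ⟪mvfderiv (𝓡 m) ι' (F x) (tension (sphereProdMetric (V := V) (V' := V') n n')
        (sphereMetric (V := W) m r hr) F x), ν⟫_ℝ
        = metricTrace (sphereProdMetric (V := V) (V' := V') n n') x (fun u v =>
      B (mvfderiv ((𝓡 n).prod (𝓡 n')) prodCoe x u)
        (mvfderiv ((𝓡 n).prod (𝓡 n')) prodCoe x v)) := by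
      unfold tension metricTrace
      rw [map_sum, sum_inner]
      refine Finset.sum_congr rfl fun i _ => ?_
      set e := frame (sphereProdMetric (V := V) (V' := V') n n') x i
      rw [sphereMetric_eq, sphereProdMetric_eq]
      rw [inner_mvfderiv_secondFundamentalForm_of_comp_eq _ _ _ _ hF hG hFG]
      refine Eq.trans ?_ (hB _ _).symm
      have hN : normalForm (contMDiff_prodCoe (V := V) (V' := V')) injective_mvfderiv_prodCoe x e e
          = -⟪sphereIncl (n := n) x.1 e.1, sphereIncl (n := n) x.1 e.1⟫_ℝ
              • (WithLp.toLp 2 ((x.1 : V), (0 : V')))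
            + -⟪sphereIncl (n := n') x.2 e.2, sphereIncl (n := n') x.2 e.2⟫_ℝ
              • (WithLp.toLp 2 ((0 : V), (x.2 : V'))) := by
        refine WithLp.ofLp_injective 2 (Prod.ext ?_ ?_)
        · refine (fst_normalForm_prodCoe x e e).trans ?_
          simp
        · refine (snd_normalForm_prodCoe x e e).trans ?_
          simp
      rw [hN, fst_mvfderiv_prodCoe, snd_mvfderiv_prodCoe, real_inner_comm]
      rw [map_add, map_smul, map_smul, inner_add_right, inner_add_right, real_inner_smul_right,
        real_inner_smul_right]
      ring
    rw [hsum, ht, inner_add_left, real_inner_smul_left, real_inner_smul_left,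
      real_inner_comm ν, real_inner_comm ν]
    ring
  have hι (w : TangentSpace (𝓡 m) (F x)) : mvfderiv (𝓡 m) ι' (F x) w = r • sphereIncl (F x) w :=
    mvfderiv_smul_coe_sphere r (F x) w
  constructor
  · intro h a ha
    obtain ⟨w, rfl⟩ := exists_sphereIncl_eq (n := m) (F x) ha
    have h1 := key w
    rw [h, map_zero, inner_zero_left, hι, real_inner_smul_right] at h1
    simpa [hr] using h1
  · intro h
    -- Testing the tension against itself shows that its norm vanishes.
    have h1 := key (tension (sphereProdMetric (V := V) (V' := V') n n')
        (sphereMetric (V := W) m r hr) F x)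
    nth_rewrite 3 [hι] at h1
    rw [real_inner_smul_right, h _ (inner_coe_sphereIncl _ _), mul_zero, neg_zero,
      inner_self_eq_zero] at h1
    exact injective_mvfderiv_smul_coe_sphere hr (F x) (h1.trans (map_zero _).symm)

end SphereProd

/-! ### Vertical vectors and the connection form of a bilinear Hopf fibration -/

section Hopf

variable {VP : Type*} [NormedAddCommGroup VP] [InnerProductSpace ℝ VP]
  {nP : ℕ} [Fact (finrank ℝ VP = nP + 1)]
  {VM : Type*} [NormedAddCommGroup VM] [InnerProductSpace ℝ VM]
  {nM : ℕ} [Fact (finrank ℝ VM = nM + 1)]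
  {A : Type*} [NormedAddCommGroup A] [InnerProductSpace ℝ A]
  {nG : ℕ} [Fact (finrank ℝ A = nG + 1)]
  [Group (Metric.sphere (0 : A) 1)]

/-- An action `(p, a) ↦ B p a` of a sphere on a sphere and a map `p ↦ q p p` of spheres which, like
the Hopf fibrations, are given by bilinear maps. The bilinear map `θ`, which is `(p, u) ↦ p̄ u` in
the case of the Hopf fibrations, gives the connection form. -/
structure IsBilinearHopf (act : Metric.sphere (0 : VP) 1 → Metric.sphere (0 : A) 1 →
      Metric.sphere (0 : VP) 1)
    (pr : Metric.sphere (0 : VP) 1 → Metric.sphere (0 : VM) 1)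
    (B : VP →L[ℝ] A →L[ℝ] VP) (θ : VP →L[ℝ] VP →L[ℝ] A) (q : VP →L[ℝ] VP →L[ℝ] VM) : Prop where
  coe_act : ∀ p a, (act p a : VP) = B p a
  coe_proj : ∀ p, (pr p : VM) = q p p
  act_one : ∀ p, act p 1 = p
  symm : ∀ p u, q p u = q u p
  inner_act_right : ∀ p u a, ⟪B p a, B u a⟫_ℝ = ⟪p, u⟫_ℝ * ‖a‖ ^ 2
  inner_act_left : ∀ p a b, ⟪B p a, B p b⟫_ℝ = ‖p‖ ^ 2 * ⟪a, b⟫_ℝ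
  connection_act : ∀ p a, θ p (B p a) = ‖p‖ ^ 2 • a
  inner_one_connection : ∀ p u, ⟪((1 : Metric.sphere (0 : A) 1) : A), θ p u⟫_ℝ = ⟪p, u⟫_ℝ
  inner_add_inner : ∀ p u v, ⟪p, u⟫_ℝ = 0 → ⟪p, v⟫_ℝ = 0 →
    ⟪q p u, q p v⟫_ℝ + ⟪θ p u, θ p v⟫_ℝ = ‖p‖ ^ 2 * ⟪u, v⟫_ℝ
  connection_act_left : ∀ p u a, θ p u = 0 → θ (B p a) u = 0
  connection_act_right : ∀ p u a, θ p u = 0 → θ u (B p a) = 0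

namespace IsBilinearHopf

variable {act : Metric.sphere (0 : VP) 1 → Metric.sphere (0 : A) 1 → Metric.sphere (0 : VP) 1}
  {pr : Metric.sphere (0 : VP) 1 → Metric.sphere (0 : VM) 1}
  {B : VP →L[ℝ] A →L[ℝ] VP} {θ : VP →L[ℝ] VP →L[ℝ] A} {q : VP →L[ℝ] VP →L[ℝ] VM}
  (h : IsBilinearHopf act pr B θ q)

include h

theorem contMDiff_act : ContMDiff ((𝓡 nP).prod (𝓡 nG)) (𝓡 nP) ∞
    fun x : Metric.sphere (0 : VP) 1 × Metric.sphere (0 : A) 1 => act x.1 x.2 := by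
  have h1 : ContMDiff ((𝓡 nP).prod (𝓡 nG)) 𝓘(ℝ, VP) ∞
      fun x : Metric.sphere (0 : VP) 1 × Metric.sphere (0 : A) 1 => (act x.1 x.2 : VP) := by
    simp only [h.coe_act]
    exact (B.isBoundedBilinearMap.contDiff.contMDiff).comp
      ((contMDiff_coe_sphere.comp contMDiff_fst).prodMk_space
        (contMDiff_coe_sphere.comp contMDiff_snd))
  exact h1.codRestrict_sphere fun x => (act x.1 x.2).2

theorem contMDiff_act_right (a : Metric.sphere (0 : A) 1) :
    ContMDiff (𝓡 nP) (𝓡 nP) ∞ fun p => act p a := by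
  have h1 : ContMDiff (𝓡 nP) 𝓘(ℝ, VP) ∞ fun p => (act p a : VP) := by
    simp only [h.coe_act]
    exact (B.flip a).contDiff.contMDiff.comp contMDiff_coe_sphere
  exact h1.codRestrict_sphere fun x => (act x a).2

theorem contMDiff_act_left (p : Metric.sphere (0 : VP) 1) :
    ContMDiff (𝓡 nG) (𝓡 nP) ∞ (act p) := by
  have h1 : ContMDiff (𝓡 nG) 𝓘(ℝ, VP) ∞ fun a => (act p a : VP) := by
    simp only [h.coe_act]
    exact (B p).contDiff.contMDiff.comp contMDiff_coe_sphere
  exact h1.codRestrict_sphere fun x => (act p x).2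

theorem contMDiff_proj : ContMDiff (𝓡 nP) (𝓡 nM) ∞ pr := by
  have h1 : ContMDiff (𝓡 nP) 𝓘(ℝ, VM) ∞ fun p => (pr p : VM) := by
    simp only [h.coe_proj]
    exact (q.isBoundedBilinearMap.contDiff.contMDiff).comp
      (contMDiff_coe_sphere.prodMk_space contMDiff_coe_sphere)
  exact h1.codRestrict_sphere fun x => (pr x).2

theorem sphereIncl_mfderiv_act_right (a : Metric.sphere (0 : A) 1) (p : Metric.sphere (0 : VP) 1)
    (u : TangentSpace (𝓡 nP) p) :
    sphereIncl (act p a) (mfderiv (𝓡 nP) (𝓡 nP) (fun p => act p a) p u)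
      = B (sphereIncl p u) a := by
  have h1 := mvfderiv_comp_mfderiv (f := fun p => act p a) p
    (mdifferentiableAt_coe_sphere (n := nP) (act p a))
    ((h.contMDiff_act_right a).mdifferentiableAt (by simp)) u
  rw [sphereIncl, ← h1]
  simp only [h.coe_act]
  exact mvfderiv_clm_comp (B.flip a) (mdifferentiableAt_coe_sphere p) u

theorem sphereIncl_mfderiv_proj (p : Metric.sphere (0 : VP) 1) (u : TangentSpace (𝓡 nP) p) :
    sphereIncl (pr p) (mfderiv (𝓡 nP) (𝓡 nM) pr p u) = (2 : ℝ) • q p (sphereIncl p u) := by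
  have h1 := mvfderiv_comp_mfderiv (f := pr) p
    (mdifferentiableAt_coe_sphere (n := nM) (pr p))
    (h.contMDiff_proj.mdifferentiableAt (by simp)) u
  rw [sphereIncl, ← h1]
  simp only [h.coe_proj]
  have h2 : HasFDerivAt (fun z => q z z) ((q p) + q.flip p) (p : VP) := by
    refine (q.hasFDerivAt.clm_apply (hasFDerivAt_id (p : VP))).congr_fderiv ?_
    ext w
    simp
  refine (mvfderiv_fderiv_comp (G := fun z => q z z) p h2.differentiableAt
    (mdifferentiableAt_coe_sphere p) u).trans ?_
  rw [h2.fderiv]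
  simp only [_root_.add_apply, ContinuousLinearMap.flip_apply]
  rw [h.symm _ (p : VP), two_smul]

theorem mfderiv_proj_eq_zero_iff (p : Metric.sphere (0 : VP) 1) (u : TangentSpace (𝓡 nP) p) :
    mfderiv (𝓡 nP) (𝓡 nM) pr p u = 0 ↔ q p (sphereIncl p u) = 0 := by
  rw [← (injective_mvfderiv_subtypeVal_sphere (pr p)).eq_iff, map_zero]
  change sphereIncl (pr p) _ = 0 ↔ _
  rw [h.sphereIncl_mfderiv_proj]
  simp

/-- On vectors orthogonal to a unit vector p, the pair (`q p`, `θ p`) is an isometry: `q p` sees the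
horizontal part and `θ p` the vertical part. -/
theorem inner_eq (p : Metric.sphere (0 : VP) 1) (u v : TangentSpace (𝓡 nP) p) :
    ⟪sphereIncl p u, sphereIncl p v⟫_ℝ
      = ⟪q p (sphereIncl p u), q p (sphereIncl p v)⟫_ℝ
        + ⟪θ p (sphereIncl p u), θ p (sphereIncl p v)⟫_ℝ := by
  rw [h.inner_add_inner _ _ _ (inner_coe_sphereIncl p u) (inner_coe_sphereIncl p v),
    norm_sq_eq_one, one_mul]

theorem inner_coe_act (p : VP) (a : A) :
    ⟪p, B p a⟫_ℝ = ‖p‖ ^ 2 * ⟪((1 : Metric.sphere (0 : A) 1) : A), a⟫_ℝ := by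
  rw [← h.inner_one_connection, h.connection_act, real_inner_smul_right]

/-- For a orthogonal to 1, `θ p` already accounts for the whole norm of `B p a`, so nothing is left
for `q p`. These vectors are therefore vertical. -/
theorem proj_act_eq_zero (p : VP) {a : A} (ha : ⟪((1 : Metric.sphere (0 : A) 1) : A), a⟫_ℝ = 0) :
    q p (B p a) = 0 := by
  have h0 : ⟪p, B p a⟫_ℝ = 0 := by rw [h.inner_coe_act, ha, mul_zero]
  have h1 := h.inner_add_inner p _ _ h0 h0
  rw [h.connection_act, h.inner_act_left, real_inner_smul_left, real_inner_smul_right] at h1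
  exact inner_self_eq_zero.1 (by linarith : ⟪q p (B p a), q p (B p a)⟫_ℝ = 0)

theorem connection_act_sphere (p : Metric.sphere (0 : VP) 1) (a : A) : θ p (B p a) = a := by
  rw [h.connection_act, norm_sq_eq_one, one_smul]

theorem inner_one_connection_sphereIncl (p : Metric.sphere (0 : VP) 1)
    (u : TangentSpace (𝓡 nP) p) :
    ⟪((1 : Metric.sphere (0 : A) 1) : A), θ p (sphereIncl p u)⟫_ℝ = 0 := by
  rw [h.inner_one_connection, inner_coe_sphereIncl]

/-- The vector `B p (θ p u)` is vertical and has the same `θ p` as u. Vertical vectors are measured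
by `θ p` alone, so orthogonality of u - v to the vertical difference v - b makes that difference
zero. -/
theorem sphereIncl_vertPart (p : Metric.sphere (0 : VP) 1) (u : TangentSpace (𝓡 nP) p) :
    sphereIncl p (vertPart (𝓡 nM) (sphereMetric nP 1 one_ne_zero) pr p u)
      = B p (θ p (sphereIncl p u)) := by
  obtain ⟨h1, h2⟩ := vertPart_spec (IM := 𝓡 nM) (sphereMetric nP 1 one_ne_zero) pr p u
  set v := vertPart (𝓡 nM) (sphereMetric nP 1 one_ne_zero) pr p u
  have hb : ⟪(p : VP), B p (θ p (sphereIncl p u))⟫_ℝ = 0 := by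
    rw [h.inner_coe_act, h.inner_one_connection_sphereIncl, mul_zero]
  obtain ⟨b, hb'⟩ := exists_sphereIncl_eq (n := nP) p hb
  rw [h.mfderiv_proj_eq_zero_iff] at h1
  have hqb : q p (sphereIncl p b) = 0 := by
    rw [hb', h.proj_act_eq_zero _ (h.inner_one_connection_sphereIncl p u)]
  have h3 := h2 (v - b) (by
    rw [h.mfderiv_proj_eq_zero_iff, map_sub, map_sub, h1, hqb, sub_zero])
  rw [sphereMetric_inner, one_pow, one_mul, h.inner_eq, map_sub, map_sub, map_sub, map_sub,
    map_sub, map_sub, h1, hqb, sub_zero, sub_zero, inner_zero_right, zero_add] at h3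
  have h4 : θ p (sphereIncl p b) = θ p (sphereIncl p u) := by
    rw [hb', h.connection_act_sphere]
  have h5 : ⟪sphereIncl p (v - b), sphereIncl p (v - b)⟫_ℝ = 0 := by
    rw [h.inner_eq, map_sub, map_sub, map_sub, h1, hqb, sub_zero, inner_zero_left, zero_add, h4]
    rw [h4, ← neg_sub, inner_neg_left, neg_eq_zero] at h3
    exact h3
  rw [inner_self_eq_zero, map_sub, sub_eq_zero] at h5
  rw [h5, hb']

theorem sphereIncl_horPart (p : Metric.sphere (0 : VP) 1) (u : TangentSpace (𝓡 nP) p) :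
    sphereIncl p (horPart (𝓡 nM) (sphereMetric nP 1 one_ne_zero) pr p u)
      = sphereIncl p u - B p (θ p (sphereIncl p u)) := by
  rw [horPart, map_sub, h.sphereIncl_vertPart]

theorem connection_horPart (p : Metric.sphere (0 : VP) 1) (u : TangentSpace (𝓡 nP) p) :
    θ p (sphereIncl p (horPart (𝓡 nM) (sphereMetric nP 1 one_ne_zero) pr p u)) = 0 := by
  rw [h.sphereIncl_horPart, map_sub, h.connection_act_sphere, sub_self]

theorem proj_horPart (p : Metric.sphere (0 : VP) 1) (u : TangentSpace (𝓡 nP) p) :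
    q p (sphereIncl p (horPart (𝓡 nM) (sphereMetric nP 1 one_ne_zero) pr p u))
      = q p (sphereIncl p u) := by
  rw [h.sphereIncl_horPart, map_sub, h.proj_act_eq_zero _ (h.inner_one_connection_sphereIncl p u),
    sub_zero]

/-- A principal bundle given by bilinear maps is a Kaluza-Klein bundle over the sphere of
radius `1/2`. -/
theorem isKaluzaKleinBundle {r : ℝ} (hr : r ≠ 0)
    (hr2 : r = 1 / 2) (hp : IsPrincipalBundle (𝓡 nP) (𝓡 nM) (𝓡 nG) act pr) :
    IsKaluzaKleinBundle (𝓡 nM) (𝓡 nG) act pr (sphereMetric (V := VP) nP 1 one_ne_zero)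
      (sphereMetric (V := VM) nM r hr) where
  isPrincipalBundle := hp
  invariant a p u v := by
    rw [sphereMetric_inner, sphereMetric_inner, h.sphereIncl_mfderiv_act_right,
      h.sphereIncl_mfderiv_act_right, h.inner_act_right, norm_sq_eq_one, mul_one]
  -- The differential of the projection is 2 `q p`; the factor 4 in the squared norm is cancelled by
  -- r² = 1/4.
  induces p u v := by
    rw [sphereMetric_inner, sphereMetric_inner, h.sphereIncl_mfderiv_proj,
      h.sphereIncl_mfderiv_proj, h.inner_eq, h.connection_horPart, h.proj_horPart, h.proj_horPart,
      real_inner_smul_left, real_inner_smul_right, inner_zero_left, hr2]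
    ring

theorem sphereIncl_fundamentalField (p : Metric.sphere (0 : VP) 1)
    (ξ : GroupLieAlgebra (𝓡 nG) (Metric.sphere (0 : A) 1)) :
    sphereIncl p (fundamentalField (𝓡 nP) (𝓡 nG) act p ξ)
      = B p (sphereIncl (1 : Metric.sphere (0 : A) 1) ξ) := by
  have h1 := mvfderiv_comp_mfderiv (f := act p) (1 : Metric.sphere (0 : A) 1)
    (mdifferentiableAt_coe_sphere (n := nP) (act p 1))
    ((h.contMDiff_act_left p).mdifferentiableAt (by simp)) ξ
  -- The differential of the orbit map is based at `act p 1`, while the fundamental field is read at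
  -- p. Both tangent spaces are the same model space, but the inclusion depends on the base point
  -- and has to be transported.
  have h2 : ∀ (x y : Metric.sphere (0 : VP) 1) (_ : x = y) (e : EuclideanSpace ℝ (Fin nP)),
      sphereIncl (n := nP) x e = sphereIncl (n := nP) y e := by
    rintro x _ rfl e
    rfl
  refine (h2 _ _ (h.act_one p).symm _).trans (h1.symm.trans ?_)
  simp only [h.coe_act]
  exact mvfderiv_clm_comp (B p) (mdifferentiableAt_coe_sphere _) ξ

/-- Since θ(p, u) is orthogonal to 1, it is a tangent vector of the group whose fundamental field is
the vertical part of u. Applying `θ p` recovers any element from its fundamental field, so the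
chosen value is this one. -/
theorem sphereIncl_connectionForm (p : Metric.sphere (0 : VP) 1) (u : TangentSpace (𝓡 nP) p) :
    sphereIncl (1 : Metric.sphere (0 : A) 1)
        (connectionForm (𝓡 nM) (𝓡 nG) act pr (sphereMetric nP 1 one_ne_zero) p u)
      = θ p (sphereIncl p u) := by
  have hex : ∃ ξ, fundamentalField (𝓡 nP) (𝓡 nG) act p ξ
      = vertPart (𝓡 nM) (sphereMetric nP 1 one_ne_zero) pr p u := by
    obtain ⟨ξ, hξ⟩ := exists_sphereIncl_eq (n := nG) (1 : Metric.sphere (0 : A) 1)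
      (h.inner_one_connection_sphereIncl p u)
    refine ⟨ξ, injective_mvfderiv_subtypeVal_sphere p ?_⟩
    exact (h.sphereIncl_fundamentalField p ξ).trans
      ((congrArg (B p) hξ).trans (h.sphereIncl_vertPart p u).symm)
  have h1 : fundamentalField (𝓡 nP) (𝓡 nG) act p
      (connectionForm (𝓡 nM) (𝓡 nG) act pr (sphereMetric nP 1 one_ne_zero) p u)
      = vertPart (𝓡 nM) (sphereMetric nP 1 one_ne_zero) pr p u := Classical.epsilon_spec hex
  have h2 := congrArg (fun w => θ p (sphereIncl p w)) h1
  simp only [h.sphereIncl_fundamentalField, h.sphereIncl_vertPart, h.connection_act_sphere] at h2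
  exact h2

end IsBilinearHopf

end Hopf

/-! ### Curvature, Lorentz endomorphism and Lorentz strength -/

section Curvature

variable {VP : Type*} [NormedAddCommGroup VP] [InnerProductSpace ℝ VP]
  {nP : ℕ} [Fact (finrank ℝ VP = nP + 1)]
  {VM : Type*} [NormedAddCommGroup VM] [InnerProductSpace ℝ VM]
  {nM : ℕ} [Fact (finrank ℝ VM = nM + 1)]
  {A : Type*} [NormedAddCommGroup A] [InnerProductSpace ℝ A]
  {nG : ℕ} [Fact (finrank ℝ A = nG + 1)]
  [Group (Metric.sphere (0 : A) 1)]

/-- Taken at the identity, such a map converts values of θ, which lie in the ambient space of the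
group, into Lie algebra elements. The connection form is thereby differentiated as a composition of
linear and bilinear maps. -/
theorem exists_leftInverse_sphereIncl {V : Type*} [NormedAddCommGroup V] [InnerProductSpace ℝ V]
    {n : ℕ} [Fact (finrank ℝ V = n + 1)] (x : Metric.sphere (0 : V) 1) :
    ∃ κ : V →L[ℝ] EuclideanSpace ℝ (Fin n), ∀ u : TangentSpace (𝓡 n) x, κ (sphereIncl x u) = u := by
  have : FiniteDimensional ℝ V := FiniteDimensional.of_fact_finrank_eq_succ n
  let D : EuclideanSpace ℝ (Fin n) →ₗ[ℝ] V := (sphereIncl (n := n) x).toLinearMap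
  obtain ⟨κ, hκ⟩ := D.exists_leftInverse_of_injective
    (LinearMap.ker_eq_bot.2 (injective_mvfderiv_subtypeVal_sphere x))
  exact ⟨LinearMap.toContinuousLinearMap κ, fun u => congrArg (fun L => L u) hκ⟩

namespace IsBilinearHopf

variable {act : Metric.sphere (0 : VP) 1 → Metric.sphere (0 : A) 1 → Metric.sphere (0 : VP) 1}
  {pr : Metric.sphere (0 : VP) 1 → Metric.sphere (0 : VM) 1}
  {B : VP →L[ℝ] A →L[ℝ] VP} {θ : VP →L[ℝ] VP →L[ℝ] A} {q : VP →L[ℝ] VP →L[ℝ] VM}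
  (h : IsBilinearHopf act pr B θ q)

include h

/-- In the chart X the form is y ↦ κ θ(X y, DX(y) v); this is the product rule. -/
theorem fderiv_connectionFormInChart {κ : A →L[ℝ] EuclideanSpace ℝ (Fin nG)}
    (hκ : ∀ u : TangentSpace (𝓡 nG) (1 : Metric.sphere (0 : A) 1), κ (sphereIncl 1 u) = u)
    (p : Metric.sphere (0 : VP) 1) (u v : TangentSpace (𝓡 nP) p) :
    fderiv ℝ (fun y => connectionFormInChart (𝓡 nM) (𝓡 nG) act pr
        (sphereMetric nP 1 one_ne_zero) p y v) (extChartAt (𝓡 nP) p p) u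
      = κ (θ (sphereIncl p u) (sphereIncl p v)
          + θ p (ambientHessian (𝓡 nP) (fun x : Metric.sphere (0 : VP) 1 => (x : VP)) p u v)) := by
  set ι := fun x : Metric.sphere (0 : VP) 1 => (x : VP)
  have hι : ContMDiff (𝓡 nP) 𝓘(ℝ, VP) ∞ ι := contMDiff_coe_sphere
  set φ := extChartAt (𝓡 nP) p
  set X := fun y => ι (φ.symm y)
  have hXp : X (φ p) = p := by simp [X, φ, ι]
  have heq : (fun y => connectionFormInChart (𝓡 nM) (𝓡 nG) act pr
        (sphereMetric nP 1 one_ne_zero) p y v) =ᶠ[𝓝 (φ p)] fun y => κ (θ (X y) (fderiv ℝ X y v)) := by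
    filter_upwards [(isOpen_extChartAt_target p).mem_nhds (mem_extChartAt_target (I := 𝓡 nP) p)]
      with y hy
    refine (hκ _).symm.trans ((congrArg κ (h.sphereIncl_connectionForm _ _)).trans ?_)
    exact congrArg (fun w => κ (θ (X y) w)) (mvfderiv_mfderiv_extChartAt_symm hι p hy v)
  have hX : HasFDerivAt X (fderiv ℝ X (φ p)) (φ p) :=
    ((contDiffAt_comp_extChartAt_symm hι p (mem_extChartAt_target p)).differentiableAt
      (by simp)).hasFDerivAt
  have hdX := hasFDerivAt_fderiv_comp_extChartAt_symm hι p v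
  have hd := κ.hasFDerivAt.comp (φ p) ((θ.hasFDerivAt.comp (φ p) hX).clm_apply hdX)
  have hXu (w : TangentSpace (𝓡 nP) p) : sphereIncl p w = fderiv ℝ X (φ p) w :=
    mvfderiv_eq_fderiv_comp_extChartAt_symm (hι.mdifferentiableAt (by simp)) w
  refine (congrArg (fun L => L u) (heq.fderiv_eq.trans hd.fderiv)).trans ?_
  rw [hXu, hXu, add_comm]
  simp only [← hXp]
  rfl

/-- Antisymmetrization removes the second derivatives of the chart, which are symmetric. -/
theorem connectionFormDeriv_eq {κ : A →L[ℝ] EuclideanSpace ℝ (Fin nG)}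
    (hκ : ∀ u : TangentSpace (𝓡 nG) (1 : Metric.sphere (0 : A) 1), κ (sphereIncl 1 u) = u)
    (p : Metric.sphere (0 : VP) 1) (u v : TangentSpace (𝓡 nP) p) :
    connectionFormDeriv (𝓡 nM) (𝓡 nG) act pr (sphereMetric nP 1 one_ne_zero) p u v
      = κ (θ (sphereIncl p u) (sphereIncl p v) - θ (sphereIncl p v) (sphereIncl p u)) := by
  refine (congrArg₂ (fun a b : EuclideanSpace ℝ (Fin nG) => a - b)
    (h.fderiv_connectionFormInChart hκ p u v) (h.fderiv_connectionFormInChart hκ p v u)).trans ?_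
  rw [← map_sub, ambientHessian_symm contMDiff_coe_sphere p v u, add_sub_add_right_eq_sub]

omit h in
theorem zero_bracket (ξ : GroupLieAlgebra (𝓡 nG) (Metric.sphere (0 : A) 1)) :
    ⁅(0 : GroupLieAlgebra (𝓡 nG) (Metric.sphere (0 : A) 1)), ξ⁆ = 0 := by
  have h0 : mulInvariantVectorField (I := 𝓡 nG)
      (0 : GroupLieAlgebra (𝓡 nG) (Metric.sphere (0 : A) 1)) = 0 := by
    funext g
    exact map_zero _
  rw [GroupLieAlgebra.bracket_def, h0, VectorField.mlieBracket_zero_left]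
  rfl

/-- For horizontal u the connection form vanishes on u, hence so does the bracket, and the Lie
bracket of the group is never computed. This is enough, because the Lorentz endomorphism is only
evaluated on horizontal vectors. -/
theorem sphereIncl_curvature (p : Metric.sphere (0 : VP) 1) (u v : TangentSpace (𝓡 nP) p)
    (hu : θ p (sphereIncl p u) = 0) :
    sphereIncl p (curvature (𝓡 nM) (𝓡 nG) act pr (sphereMetric nP 1 one_ne_zero) p u v)
      = B p (θ (sphereIncl p u) (sphereIncl p v) - θ (sphereIncl p v) (sphereIncl p u)) := by
  obtain ⟨κ, hκ⟩ := exists_leftInverse_sphereIncl (n := nG) (1 : Metric.sphere (0 : A) 1)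
  have h0 : connectionForm (𝓡 nM) (𝓡 nG) act pr (sphereMetric nP 1 one_ne_zero) p u = 0 := by
    apply injective_mvfderiv_subtypeVal_sphere (1 : Metric.sphere (0 : A) 1)
    exact (h.sphereIncl_connectionForm p u).trans (hu.trans (map_zero _).symm)
  have h1 : curvatureForm (𝓡 nM) (𝓡 nG) act pr (sphereMetric nP 1 one_ne_zero) p u v
      = κ (θ (sphereIncl p u) (sphereIncl p v) - θ (sphereIncl p v) (sphereIncl p u)) := by
    rw [curvatureForm, h0, zero_bracket, add_zero]
    exact h.connectionFormDeriv_eq hκ p u v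
  -- The difference is orthogonal to 1, as ⟨1, θ(u, v)⟩ = ⟨u, v⟩ is symmetric. It is thus tangent to
  -- the group at 1, where κ inverts the inclusion.
  obtain ⟨ξ, hξ⟩ := exists_sphereIncl_eq (n := nG) (1 : Metric.sphere (0 : A) 1)
    (a := θ (sphereIncl p u) (sphereIncl p v) - θ (sphereIncl p v) (sphereIncl p u)) (by
      rw [inner_sub_right, h.inner_one_connection, h.inner_one_connection, real_inner_comm, sub_self])
  rw [← hξ, hκ ξ] at h1
  rw [curvature, h.sphereIncl_fundamentalField, h1, hξ]

theorem inner_lorentzEndomorphism (p : Metric.sphere (0 : VP) 1) (w u v : TangentSpace (𝓡 nP) p)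
    (hu : θ p (sphereIncl p u) = 0) :
    (sphereMetric nP 1 one_ne_zero).inner p
        (lorentzEndomorphism (𝓡 nM) (𝓡 nG) act pr (sphereMetric nP 1 one_ne_zero) p w u) v
      = ⟪sphereIncl p w,
          B p (θ (sphereIncl p u) (sphereIncl p v) - θ (sphereIncl p v) (sphereIncl p u))⟫_ℝ := by
  let L : VP →L[ℝ] ℝ := (innerSL ℝ (sphereIncl p w)).comp
    ((B p).comp (θ (sphereIncl p u) - θ.flip (sphereIncl p u)))
  let l : TangentSpace (𝓡 nP) p →ₗ[ℝ] ℝ := L.toLinearMap ∘ₗ (sphereIncl p).toLinearMap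
  have hl : lorentzEndomorphism (𝓡 nM) (𝓡 nG) act pr (sphereMetric nP 1 one_ne_zero) p w u
      = sharp (sphereMetric nP 1 one_ne_zero) p l := by
    unfold lorentzEndomorphism
    congr 1
    funext v
    rw [sphereMetric_inner, one_pow, one_mul, h.sphereIncl_curvature p u v hu]
    rfl
  rw [hl, inner_sharp]
  rfl

/-- The vertical part of u enters through θ(p, u) because `B p` is an isometry onto its image up to
the factor ‖p‖ = 1. In the curvature, the horizontal part of u may be replaced by u: the two differ
by a vertical vector `B p a`, which θ pairs to zero, in either order, with the horizontal v. -/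
theorem inner_curvatureModifiedMetric (p : Metric.sphere (0 : VP) 1) (u v : TangentSpace (𝓡 nP) p)
    (hv : θ p (sphereIncl p v) = 0) :
    (sphereMetric nP 1 one_ne_zero).inner p
        (curvatureModifiedMetric (𝓡 nM) (𝓡 nG) act pr (sphereMetric nP 1 one_ne_zero) p u u) v
      = ⟪θ p (sphereIncl p u),
          θ (sphereIncl p u) (sphereIncl p v) - θ (sphereIncl p v) (sphereIncl p u)⟫_ℝ := by
  have h1 : curvatureModifiedMetric (𝓡 nM) (𝓡 nG) act pr (sphereMetric nP 1 one_ne_zero) p u u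
      = lorentzEndomorphism (𝓡 nM) (𝓡 nG) act pr (sphereMetric nP 1 one_ne_zero) p
        (vertPart (𝓡 nM) (sphereMetric nP 1 one_ne_zero) pr p u)
        (horPart (𝓡 nM) (sphereMetric nP 1 one_ne_zero) pr p u) := by
    rw [curvatureModifiedMetric, ← two_smul ℝ, smul_smul]
    norm_num
  rw [h1, h.inner_lorentzEndomorphism p _ _ _ (h.connection_horPart p u), h.sphereIncl_vertPart,
    h.inner_act_left, norm_sq_eq_one, one_mul, h.sphereIncl_horPart, map_sub, map_sub,
    h.connection_act_right _ _ _ hv, sub_zero, _root_.sub_apply,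
    h.connection_act_left _ _ _ hv, sub_zero]

variable {EN : Type*} [NormedAddCommGroup EN] [NormedSpace ℝ EN] [FiniteDimensional ℝ EN]
  {HN : Type*} [TopologicalSpace HN] {IN : ModelWithCorners ℝ EN HN}
  {N : Type*} [TopologicalSpace N] [ChartedSpace HN N] [IsManifold IN ∞ N]

/-- Projecting the trace to the base kills it exactly when its horizontal part is zero, and that is
tested against horizontal vectors η. -/
theorem lorentzStrength_eq_zero_iff (g : RMetric IN N) {f : N → Metric.sphere (0 : VP) 1}
    (hf : ContMDiff IN (𝓡 nP) ∞ f) (x : N) :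
    lorentzStrength (𝓡 nM) (𝓡 nG) act pr (sphereMetric nP 1 one_ne_zero) g f x = 0 ↔
      ∀ η, ⟪(f x : VP), η⟫_ℝ = 0 → θ (f x) η = 0 →
        metricTrace g x (fun u v => ⟪θ (f x) (mvfderiv IN (fun y => (f y : VP)) x u),
          θ (mvfderiv IN (fun y => (f y : VP)) x v) η
            - θ η (mvfderiv IN (fun y => (f y : VP)) x v)⟫_ℝ) = 0 := by
  set p := f x
  set Z := metricTrace g x fun u v =>
    curvatureModifiedMetric (𝓡 nM) (𝓡 nG) act pr (sphereMetric nP 1 one_ne_zero) p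
      (mfderiv IN (𝓡 nP) f x u) (mfderiv IN (𝓡 nP) f x v) with hZ
  have hZv (v : TangentSpace (𝓡 nP) p) (hv : θ p (sphereIncl p v) = 0) :
      ⟪sphereIncl p Z, sphereIncl p v⟫_ℝ
        = metricTrace g x (fun u u' => ⟪θ p (mvfderiv IN (fun y => (f y : VP)) x u),
          θ (mvfderiv IN (fun y => (f y : VP)) x u') (sphereIncl p v)
            - θ (sphereIncl p v) (mvfderiv IN (fun y => (f y : VP)) x u')⟫_ℝ) := by
    rw [hZ, metricTrace, metricTrace, map_sum, sum_inner]
    refine Finset.sum_congr rfl fun i _ => ?_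
    have h1 := h.inner_curvatureModifiedMetric (nG := nG) (nM := nM) p (mfderiv IN (𝓡 nP) f x (frame g x i)) v hv
    rw [sphereMetric_inner, one_pow, one_mul] at h1
    rw [mvfderiv_comp_mfderiv x (mdifferentiableAt_coe_sphere (n := nP) (f x))
      (hf.mdifferentiableAt (by simp))]
    exact h1
  have hl : lorentzStrength (𝓡 nM) (𝓡 nG) act pr (sphereMetric nP 1 one_ne_zero) g f x = 0
      ↔ q p (sphereIncl p Z) = 0 := h.mfderiv_proj_eq_zero_iff p Z
  rw [hl]
  constructor
  · intro h0 η h1 h2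
    obtain ⟨v, rfl⟩ := exists_sphereIncl_eq (n := nP) p h1
    rw [← hZv v h2, h.inner_eq, h0, h2, inner_zero_left, inner_zero_right, add_zero]
  · intro h0
    -- The test vector is the horizontal part of the trace itself.
    have h1 := h0 _ (inner_coe_sphereIncl p _) (h.connection_horPart (nM := nM) p Z)
    rw [← hZv _ (h.connection_horPart (nM := nM) p Z), h.inner_eq, h.connection_horPart, inner_zero_right,
      add_zero, h.proj_horPart] at h1
    exact inner_self_eq_zero.1 h1

end IsBilinearHopf

end Curvature

/-! ### Harmonicity and charge of the twisted families -/

section Twisted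

variable {VP : Type*} [NormedAddCommGroup VP] [InnerProductSpace ℝ VP]
  {nP : ℕ} [Fact (finrank ℝ VP = nP + 1)]
  {VM : Type*} [NormedAddCommGroup VM] [InnerProductSpace ℝ VM]
  {nM : ℕ} [Fact (finrank ℝ VM = nM + 1)]
  {A : Type*} [NormedAddCommGroup A] [InnerProductSpace ℝ A]
  {n : ℕ} [Fact (finrank ℝ A = n + 1)]
  [Group (Metric.sphere (0 : A) 1)]

/-- The maps `(x, y) ↦ cos α j₁ x + sin α j₂ y`, for orthogonal isometric embeddings `j₁`, `j₂`
of `A` that are compatible with the bilinear maps of a Hopf fibration. -/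
structure IsTwistedFamily
    (f : ℝ → Metric.sphere (0 : A) 1 × Metric.sphere (0 : A) 1 → Metric.sphere (0 : VP) 1)
    (θ : VP →L[ℝ] VP →L[ℝ] A) (q : VP →L[ℝ] VP →L[ℝ] VM) (j₁ j₂ : A →L[ℝ] VP) (e : VM) :
    Prop where
  coe_apply : ∀ α x, (f α x : VP) = Real.cos α • j₁ x.1 + Real.sin α • j₂ x.2
  inner_left : ∀ a b, ⟪j₁ a, j₁ b⟫_ℝ = ⟪a, b⟫_ℝ
  inner_right : ∀ a b, ⟪j₂ a, j₂ b⟫_ℝ = ⟪a, b⟫_ℝ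
  inner_left_right : ∀ a b, ⟪j₁ a, j₂ b⟫_ℝ = 0
  connection_left_right : ∀ a b, θ (j₁ a) (j₂ b) = 0
  connection_right_left : ∀ a b, θ (j₂ a) (j₁ b) = 0
  connection_left : ∀ a, θ (j₁ a) (j₁ a) = ‖a‖ ^ 2 • ((1 : Metric.sphere (0 : A) 1) : A)
  connection_right : ∀ a, θ (j₂ a) (j₂ a) = ‖a‖ ^ 2 • ((1 : Metric.sphere (0 : A) 1) : A)
  inner_curvature_left : ∀ x a η, ⟪x, a⟫_ℝ = 0 →
    ⟪θ (j₁ x) (j₁ a), θ (j₁ a) η - θ η (j₁ a)⟫_ℝ = ‖a‖ ^ 2 * (-2 * ⟪j₁ x, η⟫_ℝ)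
  inner_curvature_right : ∀ x a η, ⟪x, a⟫_ℝ = 0 →
    ⟪θ (j₂ x) (j₂ a), θ (j₂ a) η - θ η (j₂ a)⟫_ℝ = ‖a‖ ^ 2 * (-2 * ⟪j₂ x, η⟫_ℝ)
  proj_left : ∀ a, q (j₁ a) (j₁ a) = ‖a‖ ^ 2 • e
  proj_right : ∀ a, q (j₂ a) (j₂ a) = -(‖a‖ ^ 2 • e)
  norm_proj : ∀ a b, ‖q (j₁ a) (j₂ b)‖ = ‖a‖ * ‖b‖
  inner_proj : ∀ a b, ⟪q (j₁ a) (j₂ b), e⟫_ℝ = 0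

/-- The linear map that extends `(x, y) ↦ cos α j₁ x + sin α j₂ y`. -/
def twistedLinear (j₁ j₂ : A →L[ℝ] VP) (α : ℝ) : WithLp 2 (A × A) →L[ℝ] VP :=
  Real.cos α • j₁.comp (WithLp.fstL 2 ℝ A A) + Real.sin α • j₂.comp (WithLp.sndL 2 ℝ A A)

omit [Group (Metric.sphere (0 : A) 1)] [Fact (finrank ℝ A = n + 1)]
  [Fact (finrank ℝ VP = nP + 1)] in
theorem twistedLinear_apply (j₁ j₂ : A →L[ℝ] VP) (α : ℝ) (z : WithLp 2 (A × A)) :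
    twistedLinear j₁ j₂ α z = Real.cos α • j₁ z.fst + Real.sin α • j₂ z.snd := rfl

theorem fderiv_const_add_smul_bilinear {W V : Type*} [NormedAddCommGroup W] [NormedSpace ℝ W]
    [NormedAddCommGroup V] [NormedSpace ℝ V] (c : V) (k : ℝ) (β : W →L[ℝ] W →L[ℝ] V) :
    fderiv ℝ (fun z => c + k • β z z) = ⇑(k • (β + β.flip)) := by
  funext z
  have h : HasFDerivAt (fun z => c + k • β z z) (k • (β z + β.flip z)) z := by
    refine ((β.hasFDerivAt.clm_apply (hasFDerivAt_id z)).const_smul k).const_add c |>.congr_fderiv ?_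
    ext w
    simp
  rw [h.fderiv]
  rfl

/-- The product is sin(4α)/4. -/
theorem cos_mul_sin_mul_eq_zero_iff (α : ℝ) :
    Real.cos α * Real.sin α * (Real.cos α ^ 2 - Real.sin α ^ 2) = 0
      ↔ ∃ k : ℤ, α = k * (Real.pi / 4) := by
  have h : Real.sin (4 * α) = 4 * (Real.cos α * Real.sin α * (Real.cos α ^ 2 - Real.sin α ^ 2)) := by
    rw [show 4 * α = 2 * (2 * α) by ring, Real.sin_two_mul, Real.sin_two_mul, Real.cos_two_mul']
    ring
  have h' : Real.cos α * Real.sin α * (Real.cos α ^ 2 - Real.sin α ^ 2) = 0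
      ↔ Real.sin (4 * α) = 0 := by
    rw [h]
    simp
  rw [h', Real.sin_eq_zero_iff]
  exact exists_congr fun k => ⟨fun h => by linarith, fun h => by linarith⟩

theorem cos_ne_zero_and_sin_ne_zero {α : ℝ} (hα : ¬ ∃ k : ℤ, α = k * (Real.pi / 2)) :
    Real.cos α ≠ 0 ∧ Real.sin α ≠ 0 := by
  have h : Real.sin (2 * α) ≠ 0 := fun h => hα (by
    obtain ⟨k, hk⟩ := Real.sin_eq_zero_iff.1 h
    exact ⟨k, by linarith⟩)
  rw [Real.sin_two_mul] at h
  exact ⟨fun h0 => h (by rw [h0, mul_zero]), fun h0 => h (by rw [h0, mul_zero, zero_mul])⟩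

theorem range_eq_of_translation {G X : Type*} [Group G] {f g : G × G → X} {a b : G}
    (hab : ∀ z w : G, f (z, w) = g (a * z, b * w)) : range f = range g := by
  ext p
  constructor
  · rintro ⟨x, rfl⟩
    exact ⟨_, (hab x.1 x.2).symm⟩
  · rintro ⟨x, rfl⟩
    refine ⟨(a⁻¹ * x.1, b⁻¹ * x.2), ?_⟩
    rw [hab, mul_inv_cancel_left, mul_inv_cancel_left]

namespace IsTwistedFamily

variable {f : ℝ → Metric.sphere (0 : A) 1 × Metric.sphere (0 : A) 1 → Metric.sphere (0 : VP) 1}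
  {θ : VP →L[ℝ] VP →L[ℝ] A} {q : VP →L[ℝ] VP →L[ℝ] VM} {j₁ j₂ : A →L[ℝ] VP} {e : VM}
  (t : IsTwistedFamily f θ q j₁ j₂ e) (α : ℝ)

include t

theorem coe_eq (x : Metric.sphere (0 : A) 1 × Metric.sphere (0 : A) 1) :
    (f α x : VP) = twistedLinear j₁ j₂ α (prodCoe x) := t.coe_apply α x

theorem contMDiff : ContMDiff ((𝓡 n).prod (𝓡 n)) (𝓡 nP) ∞ (f α) := by
  have h1 : ContMDiff ((𝓡 n).prod (𝓡 n)) 𝓘(ℝ, VP) ∞ fun x => (f α x : VP) := by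
    simp only [t.coe_eq]
    exact (twistedLinear j₁ j₂ α).contDiff.contMDiff.comp contMDiff_prodCoe
  exact h1.codRestrict_sphere fun x => (f α x).2

theorem mvfderiv_coe (x : Metric.sphere (0 : A) 1 × Metric.sphere (0 : A) 1)
    (u : TangentSpace ((𝓡 n).prod (𝓡 n)) x) :
    mvfderiv ((𝓡 n).prod (𝓡 n)) (fun y => (f α y : VP)) x u
      = twistedLinear j₁ j₂ α (mvfderiv ((𝓡 n).prod (𝓡 n)) prodCoe x u) := by
  simp only [t.coe_eq]
  exact mvfderiv_clm_comp (twistedLinear j₁ j₂ α)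
    (contMDiff_prodCoe.mdifferentiableAt (x := x) (by simp)) u

/-- The extension is linear and both factors have dimension n, so the vector to be tested is n times
the image point, which is normal to the sphere. This holds for every α; only injectivity of the
differential requires c and s to be nonzero. -/
theorem isHarmonic : IsHarmonic (sphereProdMetric (V := A) (V' := A) n n)
    (sphereMetric (V := VP) nP 1 one_ne_zero) (f α) := by
  refine ⟨t.contMDiff α, fun x => ?_⟩
  have hd : fderiv ℝ (twistedLinear j₁ j₂ α) = fun _ => twistedLinear j₁ j₂ α :=
    funext fun z => (twistedLinear j₁ j₂ α).fderiv
  refine (tension_sphereProdMetric_eq_zero_iff x one_ne_zero (t.contMDiff α)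
    (twistedLinear j₁ j₂ α).contDiff (fun y => by rw [one_smul, t.coe_eq])
    (by simp [hd]) (by simp [hd])).2 fun a ha => ?_
  rw [hd, ← smul_add, ← map_add, real_inner_smul_left]
  have h1 : WithLp.toLp 2 ((x.1 : A), (0 : A)) + WithLp.toLp 2 ((0 : A), (x.2 : A)) = prodCoe x := by
    rw [← WithLp.toLp_add, Prod.mk_add_mk, add_zero, zero_add]
    rfl
  rw [h1, ← t.coe_eq, ha, mul_zero]

theorem inner_twisted_left (c s : ℝ) (a b y : A) :
    ⟪c • j₁ a + s • j₂ b, j₁ y⟫_ℝ = c * ⟪a, y⟫_ℝ := by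
  rw [inner_add_left, real_inner_smul_left, real_inner_smul_left, t.inner_left,
    real_inner_comm (j₁ y) (j₂ b), t.inner_left_right, mul_zero, add_zero]

theorem inner_twisted_right (c s : ℝ) (a b y : A) :
    ⟪c • j₁ a + s • j₂ b, j₂ y⟫_ℝ = s * ⟪b, y⟫_ℝ := by
  rw [inner_add_left, real_inner_smul_left, real_inner_smul_left, t.inner_right,
    t.inner_left_right, mul_zero, zero_add]

theorem injective_twistedLinear (hc : Real.cos α ≠ 0) (hs : Real.sin α ≠ 0) :
    Injective (twistedLinear j₁ j₂ α) := by
  refine (injective_iff_map_eq_zero _).2 fun z hz => ?_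
  rw [twistedLinear_apply] at hz
  have h1 := t.inner_twisted_left (Real.cos α) (Real.sin α) z.fst z.snd z.fst
  have h2 := t.inner_twisted_right (Real.cos α) (Real.sin α) z.fst z.snd z.snd
  rw [hz, inner_zero_left, zero_eq_mul, inner_self_eq_zero] at h1 h2
  exact WithLp.ofLp_injective 2 (Prod.ext (h1.resolve_left hc) (h2.resolve_left hs))

theorem isHarmonicImmersion (hc : Real.cos α ≠ 0) (hs : Real.sin α ≠ 0) :
    IsHarmonicImmersion (sphereProdMetric (V := A) (V' := A) n n)
      (sphereMetric (V := VP) nP 1 one_ne_zero) (f α) := by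
  refine ⟨t.isHarmonic α, fun x u v huv => ?_⟩
  have h1 (u : TangentSpace ((𝓡 n).prod (𝓡 n)) x) := mvfderiv_comp_mfderiv x
    (mdifferentiableAt_coe_sphere (n := nP) (f α x))
    ((t.contMDiff (n := n) α).mdifferentiableAt (by simp)) u
  have h2 := (h1 u).trans ((congrArg _ huv).trans (h1 v).symm)
  rw [t.mvfderiv_coe, t.mvfderiv_coe] at h2
  exact injective_mvfderiv_prodCoe x (t.injective_twistedLinear α hc hs h2)

section Bundle

variable {act : Metric.sphere (0 : VP) 1 → Metric.sphere (0 : A) 1 → Metric.sphere (0 : VP) 1}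
  {pr : Metric.sphere (0 : VP) 1 → Metric.sphere (0 : VM) 1} {B : VP →L[ℝ] A →L[ℝ] VP}
  (h : IsBilinearHopf act pr B θ q)

include h

omit [Fact (finrank ℝ A = n + 1)] [Fact (finrank ℝ VP = nP + 1)]
  [Fact (finrank ℝ VM = nM + 1)] in
theorem coe_proj (x : Metric.sphere (0 : A) 1 × Metric.sphere (0 : A) 1) :
    (pr (f α x) : VM) = (Real.cos α ^ 2 - Real.sin α ^ 2) • e
      + (2 * (Real.cos α * Real.sin α)) • q (j₁ x.1) (j₂ x.2) := by
  rw [h.coe_proj, t.coe_apply]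
  simp only [map_add, map_smul, _root_.add_apply, _root_.smul_apply, t.proj_left, t.proj_right,
    norm_sq_eq_one, h.symm (j₂ _) (j₁ _)]
  module

/-- The image point is d e + 2k m with k = cs, d = c² - s² and e, m orthonormal, while the vector to
be tested is 2nk m. It is normal when k = 0, or when d = 0 and the image point is a multiple of m.
-/
theorem tension_proj_eq_zero_iff (hn : n ≠ 0) {r : ℝ} (hr : r ≠ 0) (hr2 : r = 1 / 2)
    (hpr : ContMDiff ((𝓡 n).prod (𝓡 n)) (𝓡 nM) ∞ (pr ∘ f α))
    (x : Metric.sphere (0 : A) 1 × Metric.sphere (0 : A) 1) :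
    tension (sphereProdMetric (V := A) (V' := A) n n) (sphereMetric (V := VM) nM r hr)
      (pr ∘ f α) x = 0 ↔
      Real.cos α * Real.sin α * (Real.cos α ^ 2 - Real.sin α ^ 2) = 0 := by
  let β : WithLp 2 (A × A) →L[ℝ] WithLp 2 (A × A) →L[ℝ] VM :=
    (ContinuousLinearMap.precomp VM (j₂.comp (WithLp.sndL 2 ℝ A A))).comp
      (q.comp (j₁.comp (WithLp.fstL 2 ℝ A A)))
  have hβ (z w : WithLp 2 (A × A)) : β z w = q (j₁ z.fst) (j₂ w.snd) := rfl
  set k := Real.cos α * Real.sin α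
  set d := Real.cos α ^ 2 - Real.sin α ^ 2
  -- On the product of spheres the pure quadratic terms c²|x|² e and -s²|y|² e are constant.
  -- Replacing them by constants gives an extension whose second derivative vanishes on each factor.
  let G : WithLp 2 (A × A) → VM := fun z => (r * d) • e + k • β z z
  have hG : ContDiff ℝ ∞ G :=
    contDiff_const.add (contDiff_const.smul (β.contDiff.clm_apply contDiff_id))
  have hFG (y : Metric.sphere (0 : A) 1 × Metric.sphere (0 : A) 1) :
      r • ((pr ∘ f α) y : VM) = G (prodCoe y) := by
    rw [comp_apply, t.coe_proj α h, smul_add, smul_smul, smul_smul,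
      show r * (2 * (Real.cos α * Real.sin α)) = k by rw [hr2]; ring]
    rfl
  have hd : fderiv ℝ G = ⇑(k • (β + β.flip)) := fderiv_const_add_smul_bilinear _ _ _
  have hdd (z) : fderiv ℝ (fderiv ℝ G) z = k • (β + β.flip) := by
    rw [hd]
    exact ContinuousLinearMap.fderiv _
  rw [tension_sphereProdMetric_eq_zero_iff x hr hpr hG hFG
    (fun a => by rw [hdd]; simp [hβ]) (fun a => by rw [hdd]; simp [hβ]), hd]
  set m := q (j₁ x.1) (j₂ x.2)
  have hm1 : (k • (β + β.flip)) (prodCoe x) (WithLp.toLp 2 ((x.1 : A), 0)) = k • m := by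
    simp [hβ, m, prodCoe]
  have hm2 : (k • (β + β.flip)) (prodCoe x) (WithLp.toLp 2 (0, (x.2 : A))) = k • m := by
    simp [hβ, m, prodCoe]
  rw [hm1, hm2]
  have hF : ((pr ∘ f α) x : VM) = d • e + (2 * k) • m := t.coe_proj α h x
  have hmm : ⟪m, m⟫_ℝ = 1 := by
    rw [real_inner_self_eq_norm_sq, t.norm_proj, norm_eq_of_mem_sphere, norm_eq_of_mem_sphere]
    norm_num
  have hFm : ⟪((pr ∘ f α) x : VM), m⟫_ℝ = 2 * k := by
    rw [hF, inner_add_left, real_inner_smul_left, real_inner_smul_left, hmm, real_inner_comm,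
      t.inner_proj]
    ring
  have hkd : 1 - 4 * k ^ 2 = d ^ 2 := by
    have := Real.cos_sq_add_sin_sq α
    simp only [k, d]
    linear_combination (-1 - Real.cos α ^ 2 - Real.sin α ^ 2) * this
  have hn' : (n : ℝ) ≠ 0 := Nat.cast_ne_zero.2 hn
  constructor
  · intro h0
    -- The tangential component of m at the image point; its product with m is 1 - 4k² = d².
    have h1 := h0 (m - (2 * k) • ((pr ∘ f α) x : VM)) (by
      rw [inner_sub_right, hFm, real_inner_smul_right, inner_self_coe_sphere]
      ring)
    have h2 : ⟪m, m - (2 * k) • ((pr ∘ f α) x : VM)⟫_ℝ = d ^ 2 := by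
      rw [inner_sub_right, hmm, real_inner_smul_right, real_inner_comm, hFm, ← hkd]
      ring
    rw [← smul_add, ← two_smul ℝ, smul_smul, smul_smul, real_inner_smul_left, h2] at h1
    have h3 : (n * 2 * d) * (k * d) = 0 := by linear_combination h1
    rcases mul_eq_zero.1 h3 with h4 | h4
    · have : d = 0 := by simpa [hn'] using h4
      rw [this, mul_zero]
    · exact h4
  · intro h0 a ha
    rw [← smul_add, ← two_smul ℝ, smul_smul, smul_smul, real_inner_smul_left]
    rcases mul_eq_zero.1 h0 with h1 | h1
    · rw [h1]
      ring
    · rw [hF, h1, zero_smul, zero_add, real_inner_smul_left] at ha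
      linear_combination n * ha

/-- Vectors of the first factor contribute c³, namely c² from θ(f, u) and c from the curvature, and
vectors of the second contribute s³. Orthogonality of η to the image point merges the two
contributions into one with factor c² - s². -/
theorem isUncharged_iff (hn : n ≠ 0) :
    IsUncharged (𝓡 nM) (𝓡 n) act pr (sphereMetric (V := VP) nP 1 one_ne_zero)
      (sphereProdMetric (V := A) (V' := A) n n) (f α) ↔
      Real.cos α * Real.sin α * (Real.cos α ^ 2 - Real.sin α ^ 2) = 0 := by
  set c := Real.cos α with hc
  set s := Real.sin α with hs
  have hL (z : WithLp 2 (A × A)) : twistedLinear j₁ j₂ α z = c • j₁ z.fst + s • j₂ z.snd := rfl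
  have key (x : Metric.sphere (0 : A) 1 × Metric.sphere (0 : A) 1) (η : VP)
      (hη : ⟪(f α x : VP), η⟫_ℝ = 0) :
      metricTrace (sphereProdMetric (V := A) (V' := A) n n) x (fun u v =>
        ⟪θ (f α x) (mvfderiv ((𝓡 n).prod (𝓡 n)) (fun y => (f α y : VP)) x u),
          θ (mvfderiv ((𝓡 n).prod (𝓡 n)) (fun y => (f α y : VP)) x v) η
            - θ η (mvfderiv ((𝓡 n).prod (𝓡 n)) (fun y => (f α y : VP)) x v)⟫_ℝ)
        = n * (-2 * (c ^ 2 - s ^ 2) * (c * ⟪j₁ x.1, η⟫_ℝ)) := by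
    let L := twistedLinear j₁ j₂ α
    let T : WithLp 2 (A × A) →L[ℝ] WithLp 2 (A × A) →L[ℝ] ℝ :=
      (ContinuousLinearMap.precomp ℝ ((θ.flip η - θ η).comp L)).comp
        ((innerSL ℝ).comp ((θ (f α x)).comp L))
    have hT (z w) : T z w = ⟪θ (f α x) (L z), θ (L w) η - θ η (L w)⟫_ℝ := rfl
    have ht := metricTrace_sphereProdMetric (n := n) (n' := n) x
      (z := -2 * c ^ 3 * ⟪j₁ x.1, η⟫_ℝ) (z' := -2 * s ^ 3 * ⟪j₂ x.2, η⟫_ℝ) T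
      (fun a ha => by
        have h1 : L (WithLp.toLp 2 (a, 0)) = c • j₁ a := by simp [L, hL]
        have h2 := t.inner_curvature_left _ _ η ha
        rw [hT, h1, t.coe_apply, ← hc, ← hs]
        simp only [map_add, map_smul, _root_.add_apply, _root_.smul_apply,
          t.connection_right_left, smul_zero, add_zero, ← smul_sub, real_inner_smul_left,
          real_inner_smul_right, h2]
        ring)
      (fun a ha => by
        have h1 : L (WithLp.toLp 2 (0, a)) = s • j₂ a := by simp [L, hL]
        have h2 := t.inner_curvature_right _ _ η ha
        rw [hT, h1, t.coe_apply, ← hc, ← hs]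
        simp only [map_add, map_smul, _root_.add_apply, _root_.smul_apply,
          t.connection_left_right, smul_zero, zero_add, ← smul_sub, real_inner_smul_left,
          real_inner_smul_right, h2]
        ring)
    have hη' : c * ⟪j₁ x.1, η⟫_ℝ + s * ⟪j₂ x.2, η⟫_ℝ = 0 := by
      rw [t.coe_apply, inner_add_left, real_inner_smul_left, real_inner_smul_left] at hη
      exact hη
    simp only [t.mvfderiv_coe]
    refine ht.trans ?_
    -- The relation s⟨j₂y, η⟩ = -c⟨j₁x, η⟩ turns s³⟨j₂y, η⟩ into -s²c⟨j₁x, η⟩.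
    linear_combination (-2 * n * s ^ 2) * hη'
  have hn' : (n : ℝ) ≠ 0 := Nat.cast_ne_zero.2 hn
  have hiff (x) := h.lorentzStrength_eq_zero_iff (nG := n) (nM := nM)
    (sphereProdMetric (V := A) (V' := A) n n) (t.contMDiff (nP := nP) α) x
  constructor
  · intro h0
    set x : Metric.sphere (0 : A) 1 × Metric.sphere (0 : A) 1 := (1, 1)
    -- Up to sign, the derivative of the family in α: it is tangent to the sphere, and horizontal
    -- because the two values of θ on the factors both equal 1 and cancel.
    have h1 := (hiff x).1 (h0 x) (s • j₁ x.1 - c • j₂ x.2) (by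
        rw [inner_sub_right, real_inner_smul_right, real_inner_smul_right, t.coe_apply,
          t.inner_twisted_left, t.inner_twisted_right, inner_self_coe_sphere, hc, hs]
        ring) (by
        rw [t.coe_apply]
        simp only [map_add, map_sub, map_smul, _root_.add_apply, _root_.smul_apply,
          t.connection_left, t.connection_right, t.connection_left_right,
          t.connection_right_left, norm_sq_eq_one]
        module)
    rw [key x _ (by
        rw [inner_sub_right, real_inner_smul_right, real_inner_smul_right, t.coe_apply,
          t.inner_twisted_left, t.inner_twisted_right, inner_self_coe_sphere, hc, hs]
        ring), inner_sub_right, real_inner_smul_right, real_inner_smul_right, t.inner_left,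
        t.inner_left_right, inner_self_coe_sphere] at h1
    have h2 : (n * (-2)) * (c * s * (c ^ 2 - s ^ 2)) = 0 := by linear_combination h1
    exact (mul_eq_zero.1 h2).resolve_left (by simp [hn'])
  · intro h0 x
    refine (hiff x).2 fun η h1 h2 => ?_
    rw [key x η h1]
    have h3 : c * ⟪j₁ x.1, η⟫_ℝ + s * ⟪j₂ x.2, η⟫_ℝ = 0 := by
      rw [t.coe_apply, inner_add_left, real_inner_smul_left, real_inner_smul_left] at h1
      exact h1
    rcases mul_eq_zero.1 h0 with h4 | h4
    · rcases mul_eq_zero.1 h4 with h5 | h5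
      · rw [h5]
        ring
      · rw [h5, zero_mul, add_zero] at h3
        rw [h3]
        ring
    · rw [h4]
      ring

omit h in
-- Pairing with the image of j₁ isolates the first component cos α x, whose squared norm is cos² α.
theorem cos_sq_eq_of_apply_eq {α' : ℝ} {x y : Metric.sphere (0 : A) 1 × Metric.sphere (0 : A) 1}
    (hxy : f α x = f α' y) : Real.cos α ^ 2 = Real.cos α' ^ 2 := by
  have h1 : (f α x : VP) = f α' y := congrArg _ hxy
  rw [t.coe_apply, t.coe_apply] at h1
  have h2 : Real.cos α • (x.1 : A) = Real.cos α' • (y.1 : A) := by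
    refine ext_inner_right ℝ fun z => ?_
    rw [real_inner_smul_left, real_inner_smul_left,
      ← t.inner_twisted_left (Real.cos α) (Real.sin α) x.1 x.2 z, h1, t.inner_twisted_left]
  have h3 := congrArg (fun z => ‖z‖ ^ 2) h2
  simpa [norm_smul] using h3

omit h in
-- Here c² = s² = 1/2, so c and s equal ±√2/2; each negative sign is absorbed by multiplication by
-- the group element ε acting as -1.
theorem exists_translation (hneg : ∃ ε : Metric.sphere (0 : A) 1, ∀ z : Metric.sphere (0 : A) 1,
      ((ε * z : Metric.sphere (0 : A) 1) : A) = -z)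
    (hα : Real.cos α ^ 2 - Real.sin α ^ 2 = 0) :
    ∃ a b : Metric.sphere (0 : A) 1, ∀ z w : Metric.sphere (0 : A) 1,
      f α (z, w) = f (Real.pi / 4) (a * z, b * w) := by
  obtain ⟨ε, hε⟩ := hneg
  have h2 : (√2 / 2) ^ 2 = (1 / 2 : ℝ) := by
    rw [div_pow, Real.sq_sqrt (by norm_num)]
    norm_num
  have hsc := Real.cos_sq_add_sin_sq α
  have aux (c : ℝ) (hc : c ^ 2 = (√2 / 2) ^ 2) : ∃ a : Metric.sphere (0 : A) 1,
      ∀ z : Metric.sphere (0 : A) 1,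
        c • (z : A) = (√2 / 2) • ((a * z : Metric.sphere (0 : A) 1) : A) := by
    rcases sq_eq_sq_iff_eq_or_eq_neg.1 hc with rfl | rfl
    · exact ⟨1, fun z => by rw [one_mul]⟩
    · exact ⟨ε, fun z => by rw [hε, neg_smul, smul_neg]⟩
  obtain ⟨a, ha⟩ := aux (Real.cos α) (by rw [h2]; linarith)
  obtain ⟨b, hb⟩ := aux (Real.sin α) (by rw [h2]; linarith)
  refine ⟨a, b, fun z w => Subtype.ext ?_⟩
  rw [t.coe_apply, t.coe_apply, Real.cos_pi_div_four, Real.sin_pi_div_four]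
  rw [← map_smul, ← map_smul, ← map_smul, ← map_smul, ha z, hb w]

/-- Harmonicity and charge of the maps `(x, y) ↦ cos α j₁ x + sin α j₂ y` and of their
projections. -/
theorem main (hn : n ≠ 0) {r : ℝ} (hr : r ≠ 0) (hr2 : r = 1 / 2)
    [LieGroup (𝓡 n) ∞ (Metric.sphere (0 : A) 1)]
    (hp : IsPrincipalBundle (𝓡 nP) (𝓡 nM) (𝓡 n) act pr)
    (hneg : ∃ ε : Metric.sphere (0 : A) 1, ∀ z : Metric.sphere (0 : A) 1,
      ((ε * z : Metric.sphere (0 : A) 1) : A) = -z) :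
    (¬ (∃ k : ℤ, α = k * (Real.pi / 2)) →
      IsHarmonicImmersion (sphereProdMetric (V := A) (V' := A) n n)
        (sphereMetric (V := VP) nP 1 one_ne_zero) (f α) ∧
      IsGeneralizedMagnetic (𝓡 n) act pr (sphereMetric (V := VP) nP 1 one_ne_zero)
        (sphereMetric (V := VM) nM r hr) (sphereProdMetric (V := A) (V' := A) n n) (pr ∘ f α) ∧
      (IsUncharged (𝓡 nM) (𝓡 n) act pr (sphereMetric (V := VP) nP 1 one_ne_zero)
        (sphereProdMetric (V := A) (V' := A) n n) (f α) ↔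
        ∃ a b : Metric.sphere (0 : A) 1, ∀ z w : Metric.sphere (0 : A) 1,
          f α (z, w) = f (Real.pi / 4) (a * z, b * w)) ∧
      (IsUncharged (𝓡 nM) (𝓡 n) act pr (sphereMetric (V := VP) nP 1 one_ne_zero)
        (sphereProdMetric (V := A) (V' := A) n n) (f α) ↔
        range (f α) = range (f (Real.pi / 4)))) ∧
    (IsUncharged (𝓡 nM) (𝓡 n) act pr (sphereMetric (V := VP) nP 1 one_ne_zero)
        (sphereProdMetric (V := A) (V' := A) n n) (f α) ↔ ∃ k : ℤ, α = k * (Real.pi / 4)) ∧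
    ((∀ x, tension (sphereProdMetric (V := A) (V' := A) n n) (sphereMetric (V := VM) nM r hr)
      (pr ∘ f α) x = 0) ↔ ∃ k : ℤ, α = k * (Real.pi / 4)) := by
  refine ⟨fun hα => ?_, ?_, ?_⟩
  · obtain ⟨hc, hs⟩ := cos_ne_zero_and_sin_ne_zero hα
    have hu := t.isUncharged_iff (n := n) (nP := nP) (nM := nM) α h hn
    have h1 (h0 : IsUncharged (𝓡 nM) (𝓡 n) act pr (sphereMetric (V := VP) nP 1 one_ne_zero)
        (sphereProdMetric (V := A) (V' := A) n n) (f α)) :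
        ∃ a b : Metric.sphere (0 : A) 1, ∀ z w : Metric.sphere (0 : A) 1,
          f α (z, w) = f (Real.pi / 4) (a * z, b * w) :=
      t.exists_translation α hneg ((mul_eq_zero.1 (hu.1 h0)).resolve_left (mul_ne_zero hc hs))
    have h2 (h0 : range (f α) = range (f (Real.pi / 4))) :
        IsUncharged (𝓡 nM) (𝓡 n) act pr (sphereMetric (V := VP) nP 1 one_ne_zero)
          (sphereProdMetric (V := A) (V' := A) n n) (f α) := by
      obtain ⟨y, hy⟩ := h0.subset (mem_range_self (1, 1))
      have h3 := t.cos_sq_eq_of_apply_eq _ hy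
      rw [Real.cos_pi_div_four, div_pow, Real.sq_sqrt (by norm_num)] at h3
      have h4 := Real.cos_sq_add_sin_sq α
      rw [hu]
      have h5 : Real.cos α ^ 2 - Real.sin α ^ 2 = 0 := by linarith
      rw [h5, mul_zero]
    refine ⟨t.isHarmonicImmersion α hc hs, ⟨h.isKaluzaKleinBundle hr hr2 hp,
      h.contMDiff_proj.comp (t.contMDiff (nP := nP) α), f α, t.isHarmonic α, rfl⟩,
      ⟨h1, fun ⟨a, b, hab⟩ => h2 (range_eq_of_translation hab)⟩, ⟨fun h0 => ?_, h2⟩⟩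
    obtain ⟨a, b, hab⟩ := h1 h0
    exact range_eq_of_translation hab
  · rw [t.isUncharged_iff α h hn, cos_mul_sin_mul_eq_zero_iff]
  · rw [← cos_mul_sin_mul_eq_zero_iff]
    have hpr : ContMDiff ((𝓡 n).prod (𝓡 n)) (𝓡 nM) ∞ (pr ∘ f α) :=
      h.contMDiff_proj.comp (t.contMDiff (nP := nP) α)
    exact ⟨fun h0 => (t.tension_proj_eq_zero_iff α h hn hr hr2 hpr (1, 1)).1 (h0 _),
      fun h0 x => (t.tension_proj_eq_zero_iff α h hn hr hr2 hpr x).2 h0⟩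

end Bundle

end IsTwistedFamily

end Twisted

/-! ### Local sections of a Hopf fibration -/

section Trivialization

/-- Smoothness on an open set is smoothness on the open submanifold, where restriction of the
codomain to the sphere applies. -/
theorem contMDiffOn_sphere_of_coe {E : Type*} [NormedAddCommGroup E] [NormedSpace ℝ E]
    {H : Type*} [TopologicalSpace H] {I : ModelWithCorners ℝ E H}
    {M : Type*} [TopologicalSpace M] [ChartedSpace H M] [IsManifold I ∞ M]
    {V : Type*} [NormedAddCommGroup V] [InnerProductSpace ℝ V] {n : ℕ}
    [Fact (finrank ℝ V = n + 1)] {f : M → Metric.sphere (0 : V) 1} {U : Set M} (hU : IsOpen U)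
    (hf : ContMDiffOn I 𝓘(ℝ, V) ∞ (fun x => (f x : V)) U) : ContMDiffOn I (𝓡 n) ∞ f U := by
  let U' : TopologicalSpace.Opens M := ⟨U, hU⟩
  have h1 : ContMDiff I 𝓘(ℝ, V) ∞ fun x : U' => (f x : V) := fun x =>
    contMDiffAt_subtype_iff (f := fun x : M => (f x : V)).2
      (hf.contMDiffAt (hU.mem_nhds x.2))
  have h2 := h1.codRestrict_sphere (n := n) fun x => (f x).2
  intro x hx
  exact (contMDiffAt_subtype_iff (U := U') (f := f) (x := ⟨x, hx⟩)).1 (h2 ⟨x, hx⟩)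
    |>.contMDiffWithinAt

/-- The point of the unit sphere given by a unit vector, and `x₀` for other vectors. -/
def toSphere {V : Type*} [NormedAddCommGroup V] (x₀ : Metric.sphere (0 : V) 1) (v : V) :
    Metric.sphere (0 : V) 1 :=
  open Classical in if h : ‖v‖ = 1 then ⟨v, mem_sphere_zero_iff_norm.2 h⟩ else x₀

theorem coe_toSphere {V : Type*} [NormedAddCommGroup V] (x₀ : Metric.sphere (0 : V) 1) {v : V}
    (h : ‖v‖ = 1) : (toSphere x₀ v : V) = v := by
  rw [toSphere, dif_pos h]

variable {VP : Type*} [NormedAddCommGroup VP] [InnerProductSpace ℝ VP]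
  {nP : ℕ} [Fact (finrank ℝ VP = nP + 1)]
  {VM : Type*} [NormedAddCommGroup VM] [InnerProductSpace ℝ VM]
  {nM : ℕ} [Fact (finrank ℝ VM = nM + 1)]
  {A : Type*} [NormedAddCommGroup A] [InnerProductSpace ℝ A]
  {nG : ℕ} [Fact (finrank ℝ A = nG + 1)]
  [Group (Metric.sphere (0 : A) 1)]

/-- Data for the section `y ↦ r e₀ + (2 r)⁻¹ L y`, where `r = √((1 + T y) / 2)`, of a Hopf
fibration. -/
structure IsHopfSection (B : VP →L[ℝ] A →L[ℝ] VP) (q : VP →L[ℝ] VP →L[ℝ] VM)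
    (T : VM →L[ℝ] ℝ) (L : VM →L[ℝ] VP) (k : VP →L[ℝ] A) (e₀ : VP) (E : VM) : Prop where
  norm_base : ‖e₀‖ = 1
  inner_base : ∀ y, ⟪e₀, L y⟫_ℝ = 0
  norm_sq_section : ∀ y, ‖y‖ = 1 → ‖L y‖ ^ 2 = 1 - T y ^ 2
  proj_base : q e₀ e₀ = E
  proj_section : ∀ y, q (L y) (L y) = -(‖L y‖ ^ 2 • E)
  proj_base_section : ∀ y, q e₀ (L y) = y - T y • E
  norm_sq_coord : ∀ p, ‖p‖ = 1 → ‖k p‖ ^ 2 = (1 + T (q p p)) / 2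
  act_section : ∀ p, B (L (q p p)) (k p) = (2 * ‖k p‖ ^ 2) • (p - B e₀ (k p))

/-- The section of a Hopf fibration determined by the given linear maps. -/
def hopfSection (T : VM →L[ℝ] ℝ) (L : VM →L[ℝ] VP) (e₀ : VP) (y : VM) : VP :=
  √((1 + T y) / 2) • e₀ + (2 * √((1 + T y) / 2))⁻¹ • L y

variable {act : Metric.sphere (0 : VP) 1 → Metric.sphere (0 : A) 1 → Metric.sphere (0 : VP) 1}
  {pr : Metric.sphere (0 : VP) 1 → Metric.sphere (0 : VM) 1}
  {B : VP →L[ℝ] A →L[ℝ] VP} {θ : VP →L[ℝ] VP →L[ℝ] A} {q : VP →L[ℝ] VP →L[ℝ] VM}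
  {T : VM →L[ℝ] ℝ} {L : VM →L[ℝ] VP} {k : VP →L[ℝ] A} {e₀ : VP} {E : VM}

/-- The section is smooth where r > 0, that is, away from T = -1. As ‖L y‖² = 4r²(1 - r²), it has
norm one and lies over y. The group coordinate of p is k p normalized, since ‖k p‖ equals the r of
its projection and `act_section` reconstructs p. -/
theorem IsBilinearHopf.exists_trivialization (h : IsBilinearHopf act pr B θ q)
    (hs : IsHopfSection B q T L k e₀ E) (x : Metric.sphere (0 : VM) 1) (hx : T x ≠ -1) :
    ∃ U : Set (Metric.sphere (0 : VM) 1), IsOpen U ∧ x ∈ U ∧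
      ∃ (s : Metric.sphere (0 : VM) 1 → Metric.sphere (0 : VP) 1)
        (τ : Metric.sphere (0 : VP) 1 → Metric.sphere (0 : A) 1),
      ContMDiffOn (𝓡 nM) (𝓡 nP) ∞ s U ∧ ContMDiffOn (𝓡 nP) (𝓡 nG) ∞ τ (pr ⁻¹' U) ∧
      (∀ y ∈ U, pr (s y) = y) ∧ ∀ p ∈ pr ⁻¹' U, act (s (pr p)) (τ p) = p := by
  set U : Set (Metric.sphere (0 : VM) 1) := {y | T y ≠ -1}
  have hU : IsOpen U :=
    isOpen_ne.preimage (T.continuous.comp continuous_subtype_val)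
  -- The bound T y ≥ -1 comes from 1 - T² = ‖L y‖² ≥ 0; the definition of U makes it strict.
  have hpos (y : Metric.sphere (0 : VM) 1) (hy : y ∈ U) : 0 < (1 + T y) / 2 := by
    have h1 := hs.norm_sq_section y (norm_eq_of_mem_sphere y)
    have h2 : -1 ≤ T y := (abs_le.1 ((sq_le_one_iff_abs_le_one _).1
      (by nlinarith [sq_nonneg ‖L y‖]))).1
    have h3 := lt_of_le_of_ne h2 (Ne.symm hy)
    linarith
  have hnorm (y : Metric.sphere (0 : VM) 1) (hy : y ∈ U) : ‖hopfSection T L e₀ y‖ = 1 := by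
    have hr := Real.sq_sqrt (hpos y hy).le
    have hr0 := (Real.sqrt_pos.2 (hpos y hy)).ne'
    rw [← sq_eq_sq₀ (norm_nonneg _) zero_le_one, hopfSection, ← real_inner_self_eq_norm_sq]
    set r := √((1 + T y) / 2)
    simp only [inner_add_left, inner_add_right, real_inner_smul_left, real_inner_smul_right,
      real_inner_comm e₀ (L y), hs.inner_base]
    rw [real_inner_self_eq_norm_sq, real_inner_self_eq_norm_sq, hs.norm_base,
      hs.norm_sq_section y (norm_eq_of_mem_sphere y)]
    field_simp
    have : T y = 2 * r ^ 2 - 1 := by linarith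
    rw [this]
    ring
  have hproj (y : Metric.sphere (0 : VM) 1) (hy : y ∈ U) :
      q (hopfSection T L e₀ y) (hopfSection T L e₀ y) = y := by
    have hr := Real.sq_sqrt (hpos y hy).le
    have hr0 := (Real.sqrt_pos.2 (hpos y hy)).ne'
    rw [hopfSection]
    set r := √((1 + T y) / 2)
    simp only [map_add, map_smul, _root_.add_apply, _root_.smul_apply, hs.proj_base,
      hs.proj_section, h.symm (L y) e₀, hs.proj_base_section,
      hs.norm_sq_section y (norm_eq_of_mem_sphere y)]
    have ht : T y = 2 * r ^ 2 - 1 := by linarith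
    rw [ht]
    match_scalars <;> field_simp <;> ring
  have hk (p : Metric.sphere (0 : VP) 1) : ‖k p‖ ^ 2 = (1 + T (pr p)) / 2 := by
    rw [hs.norm_sq_coord p (norm_eq_of_mem_sphere p), h.coe_proj]
  have hk0 (p : Metric.sphere (0 : VP) 1) (hp : p ∈ pr ⁻¹' U) : k p ≠ 0 := by
    intro h0
    have h1 := hk p
    rw [h0, norm_zero] at h1
    linarith [hpos _ hp]
  have hkn (p : Metric.sphere (0 : VP) 1) (hp : p ∈ pr ⁻¹' U) : ‖‖k p‖⁻¹ • k p‖ = 1 :=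
    norm_smul_inv_norm (hk0 p hp)
  -- Outside U and its preimage the formulas need not give unit vectors, and `toSphere` falls back
  -- on arbitrary points, here the value over x for s and 1 for τ. Only the values on U and its
  -- preimage matter.
  set s : Metric.sphere (0 : VM) 1 → Metric.sphere (0 : VP) 1 := fun y =>
    toSphere ⟨_, mem_sphere_zero_iff_norm.2 (hnorm x hx)⟩ (hopfSection T L e₀ y) with hs'
  set τ : Metric.sphere (0 : VP) 1 → Metric.sphere (0 : A) 1 := fun p =>
    toSphere 1 (‖k p‖⁻¹ • k p) with hτ'
  have hsc (y) (hy : y ∈ U) : (s y : VP) = hopfSection T L e₀ y := coe_toSphere _ (hnorm y hy)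
  have hτc (p) (hp : p ∈ pr ⁻¹' U) : (τ p : A) = ‖k p‖⁻¹ • k p := coe_toSphere _ (hkn p hp)
  have hU' : IsOpen (pr ⁻¹' U) :=
    hU.preimage (h.contMDiff_proj (nP := nP) (nM := nM)).continuous
  refine ⟨U, hU, hx, s, τ, ?_, ?_, ?_, ?_⟩
  · refine contMDiffOn_sphere_of_coe hU (ContMDiffOn.congr ?_ hsc)
    intro y hy
    have hr0 := (hpos y hy).ne'
    have hr1 := (Real.sqrt_pos.2 (hpos y hy)).ne'
    have hc : ContDiffAt ℝ ∞ (fun z : VM => √((1 + T z) / 2)) (y : VM) :=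
      ((contDiffAt_const.add T.contDiff.contDiffAt).div_const 2).sqrt hr0
    have hd : ContDiffAt ℝ ∞ (hopfSection T L e₀) (y : VM) :=
      (hc.smul contDiffAt_const).add (((contDiffAt_const.mul hc).inv
        (mul_ne_zero two_ne_zero hr1)).smul L.contDiff.contDiffAt)
    exact (hd.contMDiffAt.comp y (contMDiff_coe_sphere y)).contMDiffWithinAt
  · refine contMDiffOn_sphere_of_coe hU' (ContMDiffOn.congr ?_ hτc)
    intro p hp
    have hd : ContDiffAt ℝ ∞ (fun z : VP => ‖k z‖⁻¹ • k z) (p : VP) :=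
      ((k.contDiff.contDiffAt.norm ℝ (hk0 p hp)).inv (norm_ne_zero_iff.2 (hk0 p hp))).smul
        k.contDiff.contDiffAt
    exact (hd.contMDiffAt.comp p (contMDiff_coe_sphere p)).contMDiffWithinAt
  · intro y hy
    refine Subtype.ext ?_
    rw [h.coe_proj, hsc y hy, hproj y hy]
  · intro p hp
    refine Subtype.ext ?_
    have hn0 : ‖k p‖ ≠ 0 := norm_ne_zero_iff.2 (hk0 p hp)
    have hr : √((1 + T (pr p)) / 2) = ‖k p‖ := by
      rw [← hk p, Real.sqrt_sq (norm_nonneg _)]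
    rw [h.coe_act, hsc _ hp, hτc p hp, hopfSection, hr, h.coe_proj]
    simp only [map_add, map_smul, _root_.add_apply, _root_.smul_apply, hs.act_section]
    match_scalars <;> field_simp <;> ring

end Trivialization

/-! ### Inner products in coordinates -/

section Coordinates

theorem quaternion_inner (a b : ℍ[ℝ]) :
    ⟪a, b⟫_ℝ = a.re * b.re + a.imI * b.imI + a.imJ * b.imJ + a.imK * b.imK := by
  rw [Quaternion.inner_def]
  simp

theorem quaternion_norm_sq (a : ℍ[ℝ]) :
    ‖a‖ ^ 2 = a.re ^ 2 + a.imI ^ 2 + a.imJ ^ 2 + a.imK ^ 2 := by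
  rw [← real_inner_self_eq_norm_sq, quaternion_inner]
  ring

theorem complex_inner (a b : ℂ) : ⟪a, b⟫_ℝ = a.re * b.re + a.im * b.im := by
  rw [Complex.inner]
  simp
  ring

theorem complex_norm_sq (a : ℂ) : ‖a‖ ^ 2 = a.re ^ 2 + a.im ^ 2 := by
  rw [← real_inner_self_eq_norm_sq, complex_inner]
  ring

theorem prod_inner {V W : Type*} [NormedAddCommGroup V] [InnerProductSpace ℝ V]
    [NormedAddCommGroup W] [InnerProductSpace ℝ W] (a b : WithLp 2 (V × W)) :
    ⟪a, b⟫_ℝ = ⟪a.fst, b.fst⟫_ℝ + ⟪a.snd, b.snd⟫_ℝ := WithLp.prod_inner_apply a b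

theorem real_inner_eq_mul (a b : ℝ) : ⟪a, b⟫_ℝ = a * b := by
  simp [mul_comm]

theorem prod_ext {V W : Type*} {a b : WithLp 2 (V × W)} (h1 : a.fst = b.fst) (h2 : a.snd = b.snd) :
    a = b := WithLp.ofLp_injective 2 (Prod.ext h1 h2)

theorem toLp_prod_fst {V W : Type*} (a : V) (b : W) : (WithLp.toLp 2 (a, b)).fst = a := rfl

theorem toLp_prod_snd {V W : Type*} (a : V) (b : W) : (WithLp.toLp 2 (a, b)).snd = b := rfl

end Coordinates

/-! ### The quaternionic Hopf fibration -/

section Quaternionic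

/-- The right multiplication of `ℍ × ℍ` by quaternions. -/
def actH : WithLp 2 (ℍ[ℝ] × ℍ[ℝ]) →L[ℝ] ℍ[ℝ] →L[ℝ] WithLp 2 (ℍ[ℝ] × ℍ[ℝ]) :=
  (LinearMap.mk₂ ℝ (fun p a => WithLp.toLp 2 (p.fst * a, p.snd * a))
    (by intros; apply prod_ext <;> simp [add_mul])
    (by intros; apply prod_ext <;> simp)
    (by intros; apply prod_ext <;> simp [mul_add])
    (by intros; apply prod_ext <;> simp)).toContinuousBilinearMap

theorem actH_apply (p : WithLp 2 (ℍ[ℝ] × ℍ[ℝ])) (a : ℍ[ℝ]) :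
    actH p a = WithLp.toLp 2 (p.fst * a, p.snd * a) := rfl

/-- The bilinear map `(p, u) ↦ p̄₁ u₁ + p̄₂ u₂` of `ℍ × ℍ`. -/
def connectionH : WithLp 2 (ℍ[ℝ] × ℍ[ℝ]) →L[ℝ] WithLp 2 (ℍ[ℝ] × ℍ[ℝ]) →L[ℝ] ℍ[ℝ] :=
  (LinearMap.mk₂ ℝ (fun p u => star p.fst * u.fst + star p.snd * u.snd)
    (by intros; simp [add_mul]; abel)
    (by intros; simp)
    (by intros; simp [mul_add]; abel)
    (by intros; simp)).toContinuousBilinearMap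

theorem connectionH_apply (p u : WithLp 2 (ℍ[ℝ] × ℍ[ℝ])) :
    connectionH p u = star p.fst * u.fst + star p.snd * u.snd := rfl

/-- The polarization of the quaternionic Hopf map. -/
def projH : WithLp 2 (ℍ[ℝ] × ℍ[ℝ]) →L[ℝ] WithLp 2 (ℍ[ℝ] × ℍ[ℝ]) →L[ℝ] WithLp 2 (ℍ[ℝ] × ℝ) :=
  (LinearMap.mk₂ ℝ (fun p u => WithLp.toLp 2
      (u.fst * star p.snd + p.fst * star u.snd, ⟪p.fst, u.fst⟫_ℝ - ⟪p.snd, u.snd⟫_ℝ))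
    (by intros; apply prod_ext <;> simp [mul_add, add_mul, inner_add_left] <;> abel)
    (by intros; apply prod_ext <;> simp [real_inner_smul_left, mul_sub])
    (by intros; apply prod_ext <;> simp [mul_add, add_mul, inner_add_right] <;> abel)
    (by intros; apply prod_ext <;> simp [real_inner_smul_right, mul_sub])).toContinuousBilinearMap

theorem projH_apply (p u : WithLp 2 (ℍ[ℝ] × ℍ[ℝ])) :
    projH p u = WithLp.toLp 2
      (u.fst * star p.snd + p.fst * star u.snd, ⟪p.fst, u.fst⟫_ℝ - ⟪p.snd, u.snd⟫_ℝ) := rfl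

theorem star_mul_self_quaternion (a : ℍ[ℝ]) : star a * a = ((‖a‖ ^ 2 : ℝ) : ℍ[ℝ]) := by
  rw [Quaternion.star_mul_self, Quaternion.normSq_eq_norm_mul_self, sq]

theorem connectionH_actH_left (p u : WithLp 2 (ℍ[ℝ] × ℍ[ℝ])) (a : ℍ[ℝ]) :
    connectionH (actH p a) u = star a * connectionH p u := by
  simp [connectionH_apply, actH_apply, mul_add, mul_assoc]

theorem connectionH_actH_right (p u : WithLp 2 (ℍ[ℝ] × ℍ[ℝ])) (a : ℍ[ℝ]) :
    connectionH u (actH p a) = star (connectionH p u) * a := by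
  simp [connectionH_apply, actH_apply, add_mul, mul_assoc]

/-- A polynomial identity in the real coordinates. For u and v orthogonal to p the last term drops,
which gives the splitting into horizontal and vertical parts. -/
theorem inner_projH_add_inner_connectionH (p u v : WithLp 2 (ℍ[ℝ] × ℍ[ℝ])) :
    ⟪projH p u, projH p v⟫_ℝ + ⟪connectionH p u, connectionH p v⟫_ℝ
      = ‖p‖ ^ 2 * ⟪u, v⟫_ℝ + ⟪p, u⟫_ℝ * ⟪p, v⟫_ℝ := by
  obtain ⟨⟨p1, p2⟩⟩ := p
  obtain ⟨⟨u1, u2⟩⟩ := u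
  obtain ⟨⟨v1, v2⟩⟩ := v
  obtain ⟨a1, b1, c1, d1⟩ := p1
  obtain ⟨a2, b2, c2, d2⟩ := p2
  rw [projH_apply, projH_apply, connectionH_apply, connectionH_apply,
    WithLp.prod_norm_sq_eq_of_L2, prod_inner, prod_inner, prod_inner, prod_inner]
  simp only [toLp_prod_fst, toLp_prod_snd]
  rw [real_inner_eq_mul]
  simp only [quaternion_inner, quaternion_norm_sq,
    Quaternion.re_add, Quaternion.imI_add, Quaternion.imJ_add, Quaternion.imK_add,
    Quaternion.re_mul, Quaternion.imI_mul, Quaternion.imJ_mul, Quaternion.imK_mul,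
    Quaternion.re_star, Quaternion.imI_star, Quaternion.imJ_star, Quaternion.imK_star]
  ring

theorem isBilinearHopf_hopfH : IsBilinearHopf actS7 hopfH actH connectionH projH where
  coe_act p a := rfl
  coe_proj p := by
    rw [projH_apply, real_inner_self_eq_norm_sq, real_inner_self_eq_norm_sq, ← two_mul,
      ← mul_assoc]
    rfl
  act_one p := by
    refine Subtype.ext (prod_ext ?_ ?_) <;> simp [actS7]
  symm p u := by
    rw [projH_apply, projH_apply, add_comm, real_inner_comm, real_inner_comm p.snd]
  inner_act_right p u a := by
    simp only [prod_inner, actH_apply, toLp_prod_fst, toLp_prod_snd, quaternion_inner, quaternion_norm_sq,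
      Quaternion.re_mul, Quaternion.imI_mul, Quaternion.imJ_mul, Quaternion.imK_mul]
    ring
  inner_act_left p a b := by
    rw [WithLp.prod_norm_sq_eq_of_L2]
    simp only [prod_inner, actH_apply, toLp_prod_fst, toLp_prod_snd, quaternion_inner, quaternion_norm_sq,
      Quaternion.re_mul, Quaternion.imI_mul, Quaternion.imJ_mul, Quaternion.imK_mul]
    ring
  connection_act p a := by
    rw [connectionH_apply, actH_apply, WithLp.prod_norm_sq_eq_of_L2]
    simp only [toLp_prod_fst, toLp_prod_snd, ← mul_assoc, star_mul_self_quaternion,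
      Quaternion.coe_mul_eq_smul, ← add_smul]
  inner_one_connection p u := by
    simp only [prod_inner, connectionH_apply, quaternion_inner, Metric.unitSphere.coe_one,
      Quaternion.re_add, Quaternion.imI_add, Quaternion.imJ_add, Quaternion.imK_add,
      Quaternion.re_mul, Quaternion.imI_mul, Quaternion.imJ_mul, Quaternion.imK_mul,
      Quaternion.re_star, Quaternion.imI_star, Quaternion.imJ_star, Quaternion.imK_star,
      Quaternion.re_one, Quaternion.imI_one, Quaternion.imJ_one, Quaternion.imK_one]
    ring
  inner_add_inner p u v hu hv := by
    rw [inner_projH_add_inner_connectionH, hu, zero_mul, add_zero]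
  connection_act_left p u a h := by rw [connectionH_actH_left, h, mul_zero]
  connection_act_right p u a h := by rw [connectionH_actH_right, h, star_zero, zero_mul]

/-- The inclusion of the first factor of `ℍ × ℍ`. -/
def inlH : ℍ[ℝ] →L[ℝ] WithLp 2 (ℍ[ℝ] × ℍ[ℝ]) :=
  LinearMap.toContinuousLinearMap
    { toFun := fun a => WithLp.toLp 2 (a, 0)
      map_add' := by intros; apply prod_ext <;> simp
      map_smul' := by intros; apply prod_ext <;> simp }

/-- The inclusion of the second factor of `ℍ × ℍ`. -/
def inrH : ℍ[ℝ] →L[ℝ] WithLp 2 (ℍ[ℝ] × ℍ[ℝ]) :=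
  LinearMap.toContinuousLinearMap
    { toFun := fun a => WithLp.toLp 2 (0, a)
      map_add' := by intros; apply prod_ext <;> simp
      map_smul' := by intros; apply prod_ext <;> simp }

theorem inlH_apply (a : ℍ[ℝ]) : inlH a = WithLp.toLp 2 (a, 0) := rfl

theorem inrH_apply (a : ℍ[ℝ]) : inrH a = WithLp.toLp 2 (0, a) := rfl

/-- As x is orthogonal to a, the quaternion x̄a is imaginary and equals -āx. The other factor is
twice the imaginary part of āy, so the product is -2⟨āx, āy⟩ = -2|a|²⟨x, y⟩. The coordinate identity
`h1` displays the correction 2⟨a, y⟩⟨x, a⟩ that is present without orthogonality. -/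
theorem inner_star_mul_quaternion (x a y : ℍ[ℝ]) (h : ⟪x, a⟫_ℝ = 0) :
    ⟪star x * a, star a * y - star y * a⟫_ℝ = ‖a‖ ^ 2 * (-2 * ⟪x, y⟫_ℝ) := by
  have h1 : ⟪star x * a, star a * y - star y * a⟫_ℝ
      = ‖a‖ ^ 2 * (-2 * ⟪x, y⟫_ℝ) + 2 * ⟪a, y⟫_ℝ * ⟪x, a⟫_ℝ := by
    simp only [quaternion_inner, quaternion_norm_sq,
      Quaternion.re_sub, Quaternion.imI_sub, Quaternion.imJ_sub, Quaternion.imK_sub,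
      Quaternion.re_mul, Quaternion.imI_mul, Quaternion.imJ_mul, Quaternion.imK_mul,
      Quaternion.re_star, Quaternion.imI_star, Quaternion.imJ_star, Quaternion.imK_star]
    ring
  rw [h1, h, mul_zero, add_zero]

theorem isTwistedFamily_twistedSphere :
    IsTwistedFamily twistedSphere connectionH projH inlH inrH (WithLp.toLp 2 (0, 1)) where
  coe_apply α x := by
    refine prod_ext ?_ ?_ <;> simp [twistedSphere, inlH_apply, inrH_apply]
  inner_left a b := by simp [inlH_apply]
  inner_right a b := by simp [inrH_apply]
  inner_left_right a b := by simp [inlH_apply, inrH_apply]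
  connection_left_right a b := by simp [connectionH_apply, inlH_apply, inrH_apply]
  connection_right_left a b := by simp [connectionH_apply, inlH_apply, inrH_apply]
  connection_left a := by
    rw [connectionH_apply, inlH_apply, Metric.unitSphere.coe_one]
    simp only [toLp_prod_fst, toLp_prod_snd, star_mul_self_quaternion, mul_zero, add_zero]
    rw [← Quaternion.coe_mul_eq_smul, mul_one]
  connection_right a := by
    rw [connectionH_apply, inrH_apply, Metric.unitSphere.coe_one]
    simp only [toLp_prod_fst, toLp_prod_snd, star_mul_self_quaternion, mul_zero, zero_add]
    rw [← Quaternion.coe_mul_eq_smul, mul_one]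
  inner_curvature_left x a η h := by
    have h1 := inner_star_mul_quaternion x a η.fst h
    simpa [connectionH_apply, inlH_apply, prod_inner] using h1
  inner_curvature_right x a η h := by
    have h1 := inner_star_mul_quaternion x a η.snd h
    simpa [connectionH_apply, inrH_apply, prod_inner] using h1
  proj_left a := by
    refine prod_ext ?_ ?_ <;> simp [projH_apply, inlH_apply]
  proj_right a := by
    refine prod_ext ?_ ?_ <;> simp [projH_apply, inrH_apply]
  norm_proj a b := by
    rw [← sq_eq_sq₀ (norm_nonneg _) (by positivity), WithLp.prod_norm_sq_eq_of_L2]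
    simp [projH_apply, inlH_apply, inrH_apply]
  inner_proj a b := by simp [projH_apply, inlH_apply, inrH_apply]

/-- The linear part of the section of the quaternionic Hopf fibration over the complement of the
south pole. -/
def sectionH : WithLp 2 (ℍ[ℝ] × ℝ) →L[ℝ] WithLp 2 (ℍ[ℝ] × ℍ[ℝ]) :=
  inrH.comp (LinearMap.toContinuousLinearMap
    { toFun := fun y : WithLp 2 (ℍ[ℝ] × ℝ) => star y.fst
      map_add' := by intros; simp
      map_smul' := by intros; simp })

theorem sectionH_apply (y : WithLp 2 (ℍ[ℝ] × ℝ)) :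
    sectionH y = WithLp.toLp 2 (0, star y.fst) := rfl

/-- Over (w, t) the section picks the point (r, w̄/(2r)) of the fibre with positive real first
coordinate, r = √((1 + t)/2). The group coordinate of p is then the phase of its first component. -/
theorem isHopfSection_sectionH : IsHopfSection actH projH (WithLp.sndL 2 ℝ ℍ[ℝ] ℝ) sectionH
    (WithLp.fstL 2 ℝ ℍ[ℝ] ℍ[ℝ]) (inlH 1) (WithLp.toLp 2 (0, 1)) where
  norm_base := by
    rw [← sq_eq_sq₀ (norm_nonneg _) zero_le_one, WithLp.prod_norm_sq_eq_of_L2]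
    simp [inlH_apply]
  inner_base y := by simp [sectionH_apply, inlH_apply]
  norm_sq_section y hy := by
    have h := WithLp.prod_norm_sq_eq_of_L2 y
    rw [hy, Real.norm_eq_abs, sq_abs] at h
    rw [WithLp.prod_norm_sq_eq_of_L2]
    simp [sectionH_apply]
    linarith
  proj_base := by
    refine prod_ext ?_ ?_ <;> simp [projH_apply, inlH_apply]
  proj_section y := by
    rw [WithLp.prod_norm_sq_eq_of_L2]
    refine prod_ext ?_ ?_ <;> simp [projH_apply, sectionH_apply]
  proj_base_section y := by
    refine prod_ext ?_ ?_ <;> simp [projH_apply, sectionH_apply, inlH_apply]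
  norm_sq_coord p hp := by
    have h := WithLp.prod_norm_sq_eq_of_L2 p
    rw [hp] at h
    simp [projH_apply]
    linarith
  act_section p := by
    refine prod_ext ?_ ?_
    · simp [actH_apply, sectionH_apply, projH_apply, inlH_apply]
    · simp only [actH_apply, sectionH_apply, projH_apply, inlH_apply, WithLp.fstL_apply,
        toLp_prod_fst, toLp_prod_snd, WithLp.sub_snd, WithLp.smul_snd, zero_mul, sub_zero,
        star_add, star_mul, star_star, add_mul, mul_assoc, star_mul_self_quaternion]
      rw [Quaternion.mul_coe_eq_smul, ← add_smul, two_mul]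

/-- The linear part of the section of the quaternionic Hopf fibration over the complement of the
north pole. -/
def sectionH' : WithLp 2 (ℍ[ℝ] × ℝ) →L[ℝ] WithLp 2 (ℍ[ℝ] × ℍ[ℝ]) :=
  inlH.comp (WithLp.fstL 2 ℝ ℍ[ℝ] ℝ)

theorem sectionH'_apply (y : WithLp 2 (ℍ[ℝ] × ℝ)) :
    sectionH' y = WithLp.toLp 2 (y.fst, 0) := rfl

/-- The factors exchange roles: the chosen point is (w/(2r), r), with r = √((1 - t)/2). -/
theorem isHopfSection_sectionH' : IsHopfSection actH projH (-(WithLp.sndL 2 ℝ ℍ[ℝ] ℝ)) sectionH'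
    (WithLp.sndL 2 ℝ ℍ[ℝ] ℍ[ℝ]) (inrH 1) (WithLp.toLp 2 (0, -1)) where
  norm_base := by
    rw [← sq_eq_sq₀ (norm_nonneg _) zero_le_one, WithLp.prod_norm_sq_eq_of_L2]
    simp [inrH_apply]
  inner_base y := by simp [sectionH'_apply, inrH_apply]
  norm_sq_section y hy := by
    have h := WithLp.prod_norm_sq_eq_of_L2 y
    rw [hy, Real.norm_eq_abs, sq_abs] at h
    rw [WithLp.prod_norm_sq_eq_of_L2]
    simp [sectionH'_apply]
    linarith
  proj_base := by
    refine prod_ext ?_ ?_ <;> simp [projH_apply, inrH_apply]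
  proj_section y := by
    rw [WithLp.prod_norm_sq_eq_of_L2]
    refine prod_ext ?_ ?_ <;> simp [projH_apply, sectionH'_apply]
  proj_base_section y := by
    refine prod_ext ?_ ?_ <;> simp [projH_apply, sectionH'_apply, inrH_apply]
  norm_sq_coord p hp := by
    have h := WithLp.prod_norm_sq_eq_of_L2 p
    rw [hp] at h
    simp [projH_apply]
    linarith
  act_section p := by
    refine prod_ext ?_ ?_
    · simp only [actH_apply, sectionH'_apply, projH_apply, inrH_apply, WithLp.sndL_apply,
        toLp_prod_fst, toLp_prod_snd, WithLp.sub_fst, WithLp.smul_fst, zero_mul, sub_zero,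
        add_mul, mul_assoc, star_mul_self_quaternion]
      rw [Quaternion.mul_coe_eq_smul, ← add_smul, two_mul]
    · simp [actH_apply, sectionH'_apply, projH_apply, inrH_apply]

theorem isPrincipalBundle_hopfH : IsPrincipalBundle (𝓡 7) (𝓡 4) (𝓡 3) actS7 hopfH where
  contMDiff_act := isBilinearHopf_hopfH.contMDiff_act
  contMDiff_proj := isBilinearHopf_hopfH.contMDiff_proj
  act_one := isBilinearHopf_hopfH.act_one
  act_mul p a b := by
    refine Subtype.ext (prod_ext ?_ ?_) <;> simp [actS7, mul_assoc]
  free p a h := by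
    -- Applying `connectionH p` recovers the group element from the point p b, so the action is
    -- free.
    have h1 (b : S3) : connectionH p (actS7 p b : WithLp 2 (ℍ[ℝ] × ℍ[ℝ])) = b :=
      isBilinearHopf_hopfH.connection_act_sphere p b
    refine Subtype.ext ?_
    rw [← h1 a, ← h1 1, h, isBilinearHopf_hopfH.act_one]
  proj_act p a := by
    have ha : (a : ℍ[ℝ]) * star (a : ℍ[ℝ]) = 1 := by
      rw [Quaternion.self_mul_star, Quaternion.normSq_eq_norm_mul_self, norm_eq_of_mem_sphere]
      simp
    refine Subtype.ext (prod_ext ?_ ?_)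
    · simp only [hopfH, actS7, toLp_prod_fst, toLp_prod_snd, star_mul]
      rw [← mul_assoc, ← mul_assoc, mul_assoc _ (a : ℍ[ℝ]), ha, mul_one]
    · simp [hopfH, actS7]
  exists_trivialization x := by
    by_cases hx : (x : WithLp 2 (ℍ[ℝ] × ℝ)).snd = -1
    · refine isBilinearHopf_hopfH.exists_trivialization isHopfSection_sectionH' x ?_
      simp [hx]
      norm_num
    · exact isBilinearHopf_hopfH.exists_trivialization isHopfSection_sectionH x hx

end Quaternionic

/-! ### The complex Hopf fibration -/

section ComplexHopf

/-- The first complex coordinate of the quaternion `z₁ + z₂ j`. -/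
def coordC : ℍ[ℝ] →L[ℝ] ℂ :=
  LinearMap.toContinuousLinearMap
    { toFun := fun q => ⟨q.re, q.imI⟩
      map_add' := by intros; apply Complex.ext <;> simp
      map_smul' := by intros; apply Complex.ext <;> simp }

/-- The second complex coordinate of the quaternion `z₁ + z₂ j`. -/
def coordC' : ℍ[ℝ] →L[ℝ] ℂ :=
  LinearMap.toContinuousLinearMap
    { toFun := fun q => ⟨q.imJ, q.imK⟩
      map_add' := by intros; apply Complex.ext <;> simp
      map_smul' := by intros; apply Complex.ext <;> simp }

theorem coordC_re (q : ℍ[ℝ]) : (coordC q).re = q.re := rfl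
theorem coordC_im (q : ℍ[ℝ]) : (coordC q).im = q.imI := rfl
theorem coordC'_re (q : ℍ[ℝ]) : (coordC' q).re = q.imJ := rfl
theorem coordC'_im (q : ℍ[ℝ]) : (coordC' q).im = q.imK := rfl

theorem coordC_ext {p q : ℍ[ℝ]} (h : coordC p = coordC q) (h' : coordC' p = coordC' q) : p = q :=
  QuaternionAlgebra.ext (congrArg Complex.re h) (congrArg Complex.im h) (congrArg Complex.re h')
    (congrArg Complex.im h')

theorem inner_eq_coordC (p q : ℍ[ℝ]) :
    ⟪p, q⟫_ℝ = ⟪coordC p, coordC q⟫_ℝ + ⟪coordC' p, coordC' q⟫_ℝ := by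
  rw [quaternion_inner, complex_inner, complex_inner]
  simp only [coordC_re, coordC_im, coordC'_re, coordC'_im]
  ring

theorem norm_sq_eq_coordC (p : ℍ[ℝ]) : ‖p‖ ^ 2 = ‖coordC p‖ ^ 2 + ‖coordC' p‖ ^ 2 := by
  simp only [← real_inner_self_eq_norm_sq, ← inner_eq_coordC]

/-- The inclusion `z ↦ z` of `ℂ` in the quaternions. -/
def inlC : ℂ →L[ℝ] ℍ[ℝ] :=
  LinearMap.toContinuousLinearMap
    { toFun := fun a => Quaternion.coeComplex a
      map_add' := by intros; simp
      map_smul' := by intros; ext <;> simp }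

/-- The inclusion `z ↦ z j` of `ℂ` in the quaternions. -/
def inrC : ℂ →L[ℝ] ℍ[ℝ] :=
  LinearMap.toContinuousLinearMap
    { toFun := fun a => Quaternion.coeComplex a * quaternionJ
      map_add' := by intros; simp [add_mul]
      map_smul' := by
        intros
        ext <;> simp [quaternionJ_re, quaternionJ_imI, quaternionJ_imJ, quaternionJ_imK] }

theorem inlC_apply (a : ℂ) : inlC a = Quaternion.coeComplex a := rfl

theorem inrC_apply (a : ℂ) : inrC a = Quaternion.coeComplex a * quaternionJ := rfl

theorem coordC_inlC (a : ℂ) : coordC (inlC a) = a := by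
  apply Complex.ext <;> simp [coordC_re, coordC_im, inlC_apply]

theorem coordC'_inlC (a : ℂ) : coordC' (inlC a) = 0 := by
  apply Complex.ext <;> simp [coordC'_re, coordC'_im, inlC_apply]

theorem coordC_inrC (a : ℂ) : coordC (inrC a) = 0 := by
  apply Complex.ext <;> simp [coordC_re, coordC_im, inrC_apply,
    quaternionJ_re, quaternionJ_imI, quaternionJ_imJ, quaternionJ_imK]

theorem coordC'_inrC (a : ℂ) : coordC' (inrC a) = a := by
  apply Complex.ext <;> simp [coordC'_re, coordC'_im, inrC_apply,
    quaternionJ_re, quaternionJ_imI, quaternionJ_imJ, quaternionJ_imK]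

/-- The right multiplication of quaternions by complex numbers. -/
def actC : ℍ[ℝ] →L[ℝ] ℂ →L[ℝ] ℍ[ℝ] :=
  (LinearMap.mk₂ ℝ (fun p a => p * Quaternion.coeComplex a)
    (by intros; simp [add_mul])
    (by intros; simp)
    (by intros; simp [mul_add])
    (by intros; ext <;> simp <;> ring)).toContinuousBilinearMap

theorem actC_apply (p : ℍ[ℝ]) (a : ℂ) : actC p a = p * Quaternion.coeComplex a := rfl

theorem coordC_actC (p : ℍ[ℝ]) (a : ℂ) : coordC (actC p a) = coordC p * a := by
  apply Complex.ext <;> simp [coordC_re, coordC_im, actC_apply]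

/-- The conjugate appears because j a = ā j. -/
theorem coordC'_actC (p : ℍ[ℝ]) (a : ℂ) : coordC' (actC p a) = coordC' p * conj a := by
  apply Complex.ext <;> simp [coordC'_re, coordC'_im, actC_apply]

/-- The bilinear map `(p, u) ↦ p̄₁ u₁ + p₂ ū₂` of `ℂ × ℂ`. -/
def connectionC : ℍ[ℝ] →L[ℝ] ℍ[ℝ] →L[ℝ] ℂ :=
  (LinearMap.mk₂ ℝ (fun p u => conj (coordC p) * coordC u + coordC' p * conj (coordC' u))
    (by intros; simp only [map_add]; ring)
    (by intros; simp; ring)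
    (by intros; simp only [map_add]; ring)
    (by intros; simp; ring)).toContinuousBilinearMap

theorem connectionC_apply (p u : ℍ[ℝ]) :
    connectionC p u = conj (coordC p) * coordC u + coordC' p * conj (coordC' u) := rfl

/-- The polarization of the complex Hopf map. -/
def projC : ℍ[ℝ] →L[ℝ] ℍ[ℝ] →L[ℝ] WithLp 2 (ℂ × ℝ) :=
  (LinearMap.mk₂ ℝ (fun p u => WithLp.toLp 2
      (coordC p * coordC' u + coordC u * coordC' p,
        ⟪coordC p, coordC u⟫_ℝ - ⟪coordC' p, coordC' u⟫_ℝ))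
    (by intros; apply prod_ext <;> simp [inner_add_left] <;> ring)
    (by intros; apply prod_ext <;> simp <;> ring)
    (by intros; apply prod_ext <;> simp [inner_add_right] <;> ring)
    (by intros; apply prod_ext <;> simp <;> ring)).toContinuousBilinearMap

theorem projC_apply (p u : ℍ[ℝ]) :
    projC p u = WithLp.toLp 2 (coordC p * coordC' u + coordC u * coordC' p,
      ⟪coordC p, coordC u⟫_ℝ - ⟪coordC' p, coordC' u⟫_ℝ) := rfl

theorem connectionC_actC_left (p u : ℍ[ℝ]) (a : ℂ) :
    connectionC (actC p a) u = conj a * connectionC p u := by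
  simp only [connectionC_apply, coordC_actC, coordC'_actC, map_mul]
  ring

theorem connectionC_actC_right (p u : ℍ[ℝ]) (a : ℂ) :
    connectionC u (actC p a) = conj (connectionC p u) * a := by
  simp only [connectionC_apply, coordC_actC, coordC'_actC, map_mul, map_add, Complex.conj_conj]
  ring

theorem inner_projC_add_inner_connectionC (p u v : ℍ[ℝ]) :
    ⟪projC p u, projC p v⟫_ℝ + ⟪connectionC p u, connectionC p v⟫_ℝ
      = ‖p‖ ^ 2 * ⟪u, v⟫_ℝ + ⟪p, u⟫_ℝ * ⟪p, v⟫_ℝ := by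
  simp only [projC_apply, connectionC_apply, prod_inner, toLp_prod_fst, toLp_prod_snd, inner_eq_coordC,
    norm_sq_eq_coordC]
  rw [real_inner_eq_mul]
  simp only [complex_inner, complex_norm_sq, Complex.add_re, Complex.add_im, Complex.mul_re,
    Complex.mul_im, Complex.conj_re, Complex.conj_im]
  ring

/-- Here `connectionC p u` is the component of p̄u in ℂ. The twist j a = ā j conjugates the second
coordinates, which makes z₁z₂, rather than z₁z̄₂, invariant under the action. -/
theorem isBilinearHopf_hopfC : IsBilinearHopf actS3 hopfC actC connectionC projC where
  coe_act p a := rfl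
  coe_proj p := by
    rw [projC_apply, real_inner_self_eq_norm_sq, real_inner_self_eq_norm_sq, ← two_mul,
      ← mul_assoc]
    rfl
  act_one p := Subtype.ext (by simp [actS3])
  symm p u := by
    rw [projC_apply, projC_apply, add_comm, real_inner_comm, real_inner_comm (coordC' p)]
  inner_act_right p u a := by
    simp only [inner_eq_coordC, coordC_actC, coordC'_actC, complex_inner, complex_norm_sq,
      Complex.mul_re, Complex.mul_im, Complex.conj_re, Complex.conj_im]
    ring
  inner_act_left p a b := by
    simp only [inner_eq_coordC, norm_sq_eq_coordC, coordC_actC, coordC'_actC, complex_inner,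
      complex_norm_sq, Complex.mul_re, Complex.mul_im, Complex.conj_re, Complex.conj_im]
    ring
  connection_act p a := by
    rw [norm_sq_eq_coordC, Complex.real_smul, Complex.ofReal_add, Complex.ofReal_pow,
      Complex.ofReal_pow, ← Complex.conj_mul', ← Complex.conj_mul']
    simp only [connectionC_apply, coordC_actC, coordC'_actC, map_mul, Complex.conj_conj]
    ring
  inner_one_connection p u := by
    simp only [inner_eq_coordC, connectionC_apply, complex_inner, Metric.unitSphere.coe_one,
      Complex.one_re, Complex.one_im, Complex.add_re, Complex.mul_re, Complex.add_im,
      Complex.mul_im, Complex.conj_re, Complex.conj_im]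
    ring
  inner_add_inner p u v hu hv := by
    rw [inner_projC_add_inner_connectionC, hu, zero_mul, add_zero]
  connection_act_left p u a h := by rw [connectionC_actC_left, h, mul_zero]
  connection_act_right p u a h := by rw [connectionC_actC_right, h, map_zero, zero_mul]

theorem inner_curvature_complex (x a y : ℂ) (h : ⟪x, a⟫_ℝ = 0) :
    ⟪conj x * a, conj a * y - conj y * a⟫_ℝ = ‖a‖ ^ 2 * (-2 * ⟪x, y⟫_ℝ) := by
  have h1 : ⟪conj x * a, conj a * y - conj y * a⟫_ℝ
      = ‖a‖ ^ 2 * (-2 * ⟪x, y⟫_ℝ) + 2 * ⟪a, y⟫_ℝ * ⟪x, a⟫_ℝ := by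
    simp only [complex_inner, complex_norm_sq, Complex.sub_re, Complex.sub_im, Complex.mul_re,
      Complex.mul_im, Complex.conj_re, Complex.conj_im]
    ring
  rw [h1, h, mul_zero, add_zero]

theorem isTwistedFamily_twistedTorus :
    IsTwistedFamily twistedTorus connectionC projC inlC inrC (WithLp.toLp 2 (0, 1)) where
  coe_apply α x := rfl
  inner_left a b := by simp [inner_eq_coordC, coordC_inlC, coordC'_inlC]
  inner_right a b := by simp [inner_eq_coordC, coordC_inrC, coordC'_inrC]
  inner_left_right a b := by
    simp [inner_eq_coordC, coordC_inlC, coordC'_inlC, coordC_inrC, coordC'_inrC]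
  connection_left_right a b := by
    simp [connectionC_apply, coordC_inlC, coordC'_inlC, coordC_inrC, coordC'_inrC]
  connection_right_left a b := by
    simp [connectionC_apply, coordC_inlC, coordC'_inlC, coordC_inrC, coordC'_inrC]
  connection_left a := by
    simp [connectionC_apply, coordC_inlC, coordC'_inlC, Complex.conj_mul']
  connection_right a := by
    simp [connectionC_apply, coordC_inrC, coordC'_inrC, Complex.mul_conj']
  inner_curvature_left x a η h := by
    have h1 := inner_curvature_complex x a (coordC η) h
    simpa [connectionC_apply, inner_eq_coordC, coordC_inlC, coordC'_inlC] using h1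
  inner_curvature_right x a η h := by
    have h1 := inner_curvature_complex x a (coordC' η) h
    simp only [connectionC_apply, inner_eq_coordC, coordC_inrC, coordC'_inrC, map_zero, zero_mul,
      mul_zero, zero_add, inner_zero_left]
    -- In the second factor both entries of the inner product are the conjugates of those in `h1`,
    -- which leaves the inner product unchanged.
    rw [← h1, complex_inner, complex_inner]
    simp
    ring
  proj_left a := by
    refine prod_ext ?_ ?_ <;> simp [projC_apply, coordC_inlC, coordC'_inlC]
  proj_right a := by
    refine prod_ext ?_ ?_ <;> simp [projC_apply, coordC_inrC, coordC'_inrC]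
  norm_proj a b := by
    rw [← sq_eq_sq₀ (norm_nonneg _) (by positivity), WithLp.prod_norm_sq_eq_of_L2]
    simp [projC_apply, coordC_inlC, coordC'_inlC, coordC_inrC, coordC'_inrC]
  inner_proj a b := by
    simp [projC_apply, coordC_inlC, coordC'_inlC, coordC_inrC, coordC'_inrC]

/-- The linear part of the section of the complex Hopf fibration over the complement of the south
pole. -/
def sectionC : WithLp 2 (ℂ × ℝ) →L[ℝ] ℍ[ℝ] := inrC.comp (WithLp.fstL 2 ℝ ℂ ℝ)

theorem sectionC_apply (y : WithLp 2 (ℂ × ℝ)) : sectionC y = inrC y.fst := rfl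

theorem isHopfSection_sectionC : IsHopfSection actC projC (WithLp.sndL 2 ℝ ℂ ℝ) sectionC
    coordC (inlC 1) (WithLp.toLp 2 (0, 1)) where
  norm_base := by
    rw [← sq_eq_sq₀ (norm_nonneg _) zero_le_one, norm_sq_eq_coordC]
    simp [coordC_inlC, coordC'_inlC]
  inner_base y := isTwistedFamily_twistedTorus.inner_left_right _ _
  norm_sq_section y hy := by
    have h := WithLp.prod_norm_sq_eq_of_L2 y
    rw [hy, Real.norm_eq_abs, sq_abs] at h
    rw [norm_sq_eq_coordC]
    simp [sectionC_apply, coordC_inrC, coordC'_inrC]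
    linarith
  proj_base := by simpa using isTwistedFamily_twistedTorus.proj_left 1
  proj_section y := by
    rw [norm_sq_eq_coordC]
    refine prod_ext ?_ ?_ <;> simp [projC_apply, sectionC_apply, coordC_inrC, coordC'_inrC]
  proj_base_section y := by
    refine prod_ext ?_ ?_ <;>
      simp [projC_apply, sectionC_apply, coordC_inlC, coordC'_inlC, coordC_inrC, coordC'_inrC]
  norm_sq_coord p hp := by
    have h := norm_sq_eq_coordC p
    rw [hp] at h
    simp [projC_apply]
    linarith
  act_section p := by
    refine coordC_ext ?_ ?_
    · simp [coordC_actC, sectionC_apply, projC_apply, coordC_inlC, coordC_inrC]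
    · simp only [coordC'_actC, sectionC_apply, projC_apply, coordC'_inrC, coordC'_inlC, map_smul,
        map_sub, Complex.real_smul, Complex.ofReal_mul, Complex.ofReal_pow, ← Complex.mul_conj',
        Complex.ofReal_ofNat, toLp_prod_fst]
      ring

/-- The linear part of the section of the complex Hopf fibration over the complement of the north
pole. -/
def sectionC' : WithLp 2 (ℂ × ℝ) →L[ℝ] ℍ[ℝ] := inlC.comp (WithLp.fstL 2 ℝ ℂ ℝ)

theorem sectionC'_apply (y : WithLp 2 (ℂ × ℝ)) : sectionC' y = inlC y.fst := rfl

/-- The chosen point over (w, t) is w/(2r) + r j with r = √((1 - t)/2). Since j a = ā j, the group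
coordinate is the phase of the conjugate of the second coordinate. -/
theorem isHopfSection_sectionC' : IsHopfSection actC projC (-(WithLp.sndL 2 ℝ ℂ ℝ)) sectionC'
    ((Complex.conjCLE : ℂ →L[ℝ] ℂ).comp coordC') (inrC 1) (WithLp.toLp 2 (0, -1)) where
  norm_base := by
    rw [← sq_eq_sq₀ (norm_nonneg _) zero_le_one, norm_sq_eq_coordC]
    simp [coordC_inrC, coordC'_inrC]
  inner_base y := by
    rw [real_inner_comm]
    exact isTwistedFamily_twistedTorus.inner_left_right _ _
  norm_sq_section y hy := by
    have h := WithLp.prod_norm_sq_eq_of_L2 y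
    rw [hy, Real.norm_eq_abs, sq_abs] at h
    rw [norm_sq_eq_coordC]
    simp [sectionC'_apply, coordC_inlC, coordC'_inlC]
    linarith
  proj_base := by
    refine prod_ext ?_ ?_ <;> simp [projC_apply, coordC_inrC, coordC'_inrC]
  proj_section y := by
    rw [norm_sq_eq_coordC]
    refine prod_ext ?_ ?_ <;> simp [projC_apply, sectionC'_apply, coordC_inlC, coordC'_inlC]
  proj_base_section y := by
    refine prod_ext ?_ ?_ <;>
      simp [projC_apply, sectionC'_apply, coordC_inlC, coordC'_inlC, coordC_inrC, coordC'_inrC]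
  norm_sq_coord p hp := by
    have h := norm_sq_eq_coordC p
    rw [hp] at h
    simp [projC_apply]
    linarith
  act_section p := by
    refine coordC_ext ?_ ?_
    · simp only [coordC_actC, sectionC'_apply, projC_apply, coordC_inrC, coordC_inlC, map_smul,
        map_sub, Complex.real_smul, Complex.ofReal_mul, Complex.ofReal_pow, ← Complex.mul_conj',
        Complex.ofReal_ofNat, toLp_prod_fst, ContinuousLinearMap.comp_apply,
        ContinuousLinearEquiv.coe_coe, Complex.conjCLE_apply, Complex.conj_conj]
      ring
    · simp [coordC'_actC, sectionC'_apply, projC_apply, coordC'_inlC, coordC'_inrC]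

theorem isPrincipalBundle_hopfC : IsPrincipalBundle (𝓡 3) (𝓡 2) (𝓡 1) actS3 hopfC where
  contMDiff_act := isBilinearHopf_hopfC.contMDiff_act
  contMDiff_proj := isBilinearHopf_hopfC.contMDiff_proj
  act_one := isBilinearHopf_hopfC.act_one
  act_mul p a b := Subtype.ext (by simp [actS3, mul_assoc])
  free p a h := by
    have h1 (b : S1) : connectionC p (actS3 p b : ℍ[ℝ]) = b :=
      isBilinearHopf_hopfC.connection_act_sphere p b
    refine Subtype.ext ?_
    rw [← h1 a, ← h1 1, h, isBilinearHopf_hopfC.act_one]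
  proj_act p a := by
    have ha : (a : ℂ) * conj (a : ℂ) = 1 := by
      rw [Complex.mul_conj', norm_eq_of_mem_sphere]
      simp
    refine Subtype.ext ?_
    rw [isBilinearHopf_hopfC.coe_proj, isBilinearHopf_hopfC.coe_proj,
      isBilinearHopf_hopfC.coe_act, projC_apply, projC_apply, coordC_actC, coordC'_actC]
    refine prod_ext ?_ ?_
    · simp only [toLp_prod_fst]
      linear_combination (2 * coordC (p : ℍ[ℝ]) * coordC' (p : ℍ[ℝ])) * ha
    · simp
  exists_trivialization x := by
    by_cases hx : (x : WithLp 2 (ℂ × ℝ)).snd = -1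
    · refine isBilinearHopf_hopfC.exists_trivialization isHopfSection_sectionC' x ?_
      simp [hx]
      norm_num
    · exact isBilinearHopf_hopfC.exists_trivialization isHopfSection_sectionC x hx

end ComplexHopf

end KaluzaKlein

end

theorem mainTheorem12 (α : ℝ) :
    -- the torus in the complex Hopf fibration
    ((¬ (∃ k : ℤ, α = k * (Real.pi / 2)) →
      IsHarmonicImmersion metricT2 metricS3 (twistedTorus α) ∧
      IsGeneralizedMagnetic (𝓡 1) actS3 hopfC metricS3 metricS2 metricT2
        (hopfC ∘ twistedTorus α) ∧
      (IsUncharged (𝓡 2) (𝓡 1) actS3 hopfC metricS3 metricT2 (twistedTorus α) ↔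
        ∃ a b : S1, ∀ z w : S1, twistedTorus α (z, w) = twistedTorus (Real.pi / 4) (a * z, b * w)) ∧
      (IsUncharged (𝓡 2) (𝓡 1) actS3 hopfC metricS3 metricT2 (twistedTorus α) ↔
        Set.range (twistedTorus α) = Set.range (twistedTorus (Real.pi / 4)))) ∧
    (IsUncharged (𝓡 2) (𝓡 1) actS3 hopfC metricS3 metricT2 (twistedTorus α) ↔
      ∃ k : ℤ, α = k * (Real.pi / 4)) ∧
    ((∀ x, tension metricT2 metricS2 (hopfC ∘ twistedTorus α) x = 0) ↔
      ∃ k : ℤ, α = k * (Real.pi / 4))) ∧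
    -- the product of spheres in the quaternionic Hopf fibration
    ((¬ (∃ k : ℤ, α = k * (Real.pi / 2)) →
      IsHarmonicImmersion metricS3S3 metricS7 (twistedSphere α) ∧
      IsGeneralizedMagnetic (𝓡 3) actS7 hopfH metricS7 metricS4 metricS3S3
        (hopfH ∘ twistedSphere α) ∧
      (IsUncharged (𝓡 4) (𝓡 3) actS7 hopfH metricS7 metricS3S3 (twistedSphere α) ↔
        ∃ a b : S3, ∀ p q : S3,
          twistedSphere α (p, q) = twistedSphere (Real.pi / 4) (a * p, b * q)) ∧
      (IsUncharged (𝓡 4) (𝓡 3) actS7 hopfH metricS7 metricS3S3 (twistedSphere α) ↔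
        Set.range (twistedSphere α) = Set.range (twistedSphere (Real.pi / 4)))) ∧
    (IsUncharged (𝓡 4) (𝓡 3) actS7 hopfH metricS7 metricS3S3 (twistedSphere α) ↔
      ∃ k : ℤ, α = k * (Real.pi / 4)) ∧
    ((∀ x, tension metricS3S3 metricS4 (hopfH ∘ twistedSphere α) x = 0) ↔
      ∃ k : ℤ, α = k * (Real.pi / 4))) := 
  -- The group element -1 supplies the sign changes needed for the translations; the base radius is
  -- 1/2 by definition of its metric.
  ⟨isTwistedFamily_twistedTorus.main α isBilinearHopf_hopfC one_ne_zero _ rfl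
      isPrincipalBundle_hopfC ⟨-1, fun z => by simp⟩,
    isTwistedFamily_twistedSphere.main α isBilinearHopf_hopfH three_ne_zero _ rfl
      isPrincipalBundle_hopfH ⟨-1, fun z => by simp⟩⟩
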